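/- **Notation and definitions.** Let $X,Y,Z$ be the Pauli matrices and write $XX=X\otimes X$, $YY=Y\otimes Y$, $ZZ=Z\otimes Z$. For a set $\mathcal S$ of two-qubit operators, an *$\mathcal S^+$-Hamiltonian on $n$ qubits* is an operator $H=\sum_{\ell=1}^{m} w_\ell H_\ell$ on $(\mathbb C^2)^{\otimes n}$, where each $H_\ell$ is an element of $\mathcal S$ acting on two distinct qubits (and as the identity on the others) and each weight satisfies $w_\ell>0$. A Hamiltonian $H_{\mathrm{sim}}$ on $\mathcal H_{\mathrm{sim}}$ and an isometry $\mathcal E:\mathcal H\to\mathcal H_{\mathrm{sim}}$ *simulate* a Hamiltonian $H_{\mathrm{target}}$ on $\mathcal H$, $\dim\mathcal H=D$, with error $(\eta,\epsilon)$ if there is an isometry $\widetilde{\mathcal E}:\mathcal H\to\mathcal H_{\mathrm{sim}}$ whose image is the subspace spanned by the $D$ lowest-energy eigenvectors of $H_{\mathrm{sim}}$ (that is, by the first $D$ vectors of some orthonormal eigenbasis of $H_{\mathrm{sim}}$ ordered by nondecreasing eigenvalue), with $\|H_{\mathrm{target}}-\widetilde{\mathcal E}^\dagger H_{\mathrm{sim}}\widetilde{\mathcal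 E}\|\le\epsilon$ and $\|\mathcal E-\widetilde{\mathcal E}\|\le\eta$ in operator norm. Say that the terms $\mathcal S$ *can simulate* the terms $\mathcal T$ *to inverse-polynomial error* if for all polynomials $p,q$ with coefficients in $\mathbb N$ there is a polynomial $P$ with coefficients in $\mathbb N$ such that, for every $n$ and every $\mathcal T^+$-Hamiltonian $H$ on $n$ qubits with at most $p(n)$ terms and all weights at most $p(n)$, there exist $N\le P(n)$, an $\mathcal S^+$-Hamiltonian $H'$ on $N$ qubits with at most $P(n)$ terms and all weights at most $P(n)$, a real number $c$ with $|c|\le P(n)$, and an isometry $\mathcal E:(\mathbb C^2)^{\otimes n}\to(\mathbb C^2)^{\otimes N}$, such that $(H'+cI,\mathcal E)$ simulates $H$ with error $\left(\tfrac1{q(n)+1},\tfrac1{q(n)+1}\right)$. **Lemma.** For every real $a>1$, the term $aXX-ZZ$ can simulate the terms $\{XX,-YY\}$ to inverse-polynomial error. -/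

import Mathlib

open scoped Kronecker

noncomputable section

namespace QubitSim

/-- The Hilbert space `(ℂ²)^{⊗ n}` of `n` qubits, with the computational basis indexed by
bit strings of length `n`. -/
abbrev QubitSpace (n : ℕ) : Type := EuclideanSpace ℂ (Fin n → Fin 2)

/-- Operators on two qubits, as matrices in the computational basis. -/
abbrev TwoQubitOp : Type := Matrix (Fin 2 × Fin 2) (Fin 2 × Fin 2) ℂ

/-- The Pauli matrix `X`. -/
def pauliX : Matrix (Fin 2) (Fin 2) ℂ := !![0, 1; 1, 0]

/-- The Pauli matrix `Y`. -/
def pauliY : Matrix (Fin 2) (Fin 2) ℂ := !![0, -Complex.I; Complex.I, 0]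

/-- The Pauli matrix `Z`. -/
def pauliZ : Matrix (Fin 2) (Fin 2) ℂ := !![1, 0; 0, -1]

/-- The two-qubit term `XX = X ⊗ X`. -/
def termXX : TwoQubitOp := pauliX ⊗ₖ pauliX

/-- The two-qubit term `YY = Y ⊗ Y`. -/
def termYY : TwoQubitOp := pauliY ⊗ₖ pauliY

/-- The two-qubit term `ZZ = Z ⊗ Z`. -/
def termZZ : TwoQubitOp := pauliZ ⊗ₖ pauliZ

/-- The two-qubit operator `A` acting on qubits `i` and `j` (in this order) of `n` qubits, and
as the identity on all the others. Only used for `i ≠ j`. -/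
def onQubits {n : ℕ} (A : TwoQubitOp) (i j : Fin n) :
    Matrix (Fin n → Fin 2) (Fin n → Fin 2) ℂ :=
  Matrix.of fun x y =>
    if ∀ k, k ≠ i → k ≠ j → x k = y k then A (x i, x j) (y i, y j) else 0

/-- A weighted sum `∑ ℓ, w ℓ • H ℓ` on `n` qubits, with every `H ℓ` a term of `S` placed on two
distinct qubits and every weight `w ℓ` positive. -/
structure PlusHamiltonian (S : Set TwoQubitOp) (n : ℕ) where
  numTerms : ℕ
  term : Fin numTerms → TwoQubitOp
  term_mem : ∀ l, term l ∈ S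
  fst : Fin numTerms → Fin n
  snd : Fin numTerms → Fin n
  fst_ne_snd : ∀ l, fst l ≠ snd l
  weight : Fin numTerms → ℝ
  weight_pos : ∀ l, 0 < weight l

namespace PlusHamiltonian

variable {S : Set TwoQubitOp} {n : ℕ}

/-- The matrix of the Hamiltonian. -/
def toMatrix (H : PlusHamiltonian S n) : Matrix (Fin n → Fin 2) (Fin n → Fin 2) ℂ :=
  ∑ l, (H.weight l : ℂ) • onQubits (H.term l) (H.fst l) (H.snd l)

/-- The Hamiltonian as an operator on the Hilbert space of `n` qubits. -/
def toOperator (H : PlusHamiltonian S n) : QubitSpace n →L[ℂ] QubitSpace n :=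
  Matrix.toEuclideanCLM (𝕜 := ℂ) H.toMatrix

/-- Both the number of terms and every weight are at most `B`. -/
def BoundedBy (H : PlusHamiltonian S n) (B : ℕ) : Prop :=
  H.numTerms ≤ B ∧ ∀ l, H.weight l ≤ (B : ℝ)

end PlusHamiltonian

section Simulation

variable {V W : Type*}
  [NormedAddCommGroup V] [InnerProductSpace ℂ V] [CompleteSpace V] [FiniteDimensional ℂ V]
  [NormedAddCommGroup W] [InnerProductSpace ℂ W] [CompleteSpace W] [FiniteDimensional ℂ W]

/-- `U` is spanned by the first `N` vectors of some orthonormal basis of eigenvectors of `H`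
listed in nondecreasing order of energy, and `N` is at most the dimension of the whole space. -/
def IsLowestEnergySubspace (H : W →L[ℂ] W) (N : ℕ) (U : Submodule ℂ W) : Prop :=
  N ≤ Module.finrank ℂ W ∧
  ∃ (b : OrthonormalBasis (Fin (Module.finrank ℂ W)) ℂ W)
    (energy : Fin (Module.finrank ℂ W) → ℝ),
    Monotone energy ∧ (∀ i, H (b i) = (energy i : ℂ) • b i) ∧
      U = Submodule.span ℂ (b '' {i | (i : ℕ) < N})

/-- The Hamiltonian `Hsim` and the isometry `E` simulate `Htarget` with error `(η, ε)`. -/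
def Simulates (Hsim : W →L[ℂ] W) (E : V →ₗᵢ[ℂ] W) (Htarget : V →L[ℂ] V) (η ε : ℝ) : Prop :=
  ∃ E' : V →ₗᵢ[ℂ] W,
    IsLowestEnergySubspace Hsim (Module.finrank ℂ V) (LinearMap.range E'.toLinearMap) ∧
    ‖Htarget - (ContinuousLinearMap.adjoint E'.toContinuousLinearMap).comp
        (Hsim.comp E'.toContinuousLinearMap)‖ ≤ ε ∧
    ‖E.toContinuousLinearMap - E'.toContinuousLinearMap‖ ≤ η

end Simulation

/-- The terms `S` can simulate the terms `T` to inverse-polynomial error: for every polynomial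
bound `p` on the targets and every inverse-polynomial error `1 / (q n + 1)`, each `T`-Hamiltonian
is simulated, up to a shift by a multiple of the identity, by an `S`-Hamiltonian with
polynomially bounded number of qubits, number of terms, weights and shift. -/
def CanSimulate (S T : Set TwoQubitOp) : Prop :=
  ∀ p q : Polynomial ℕ, ∃ P : Polynomial ℕ,
    ∀ (n : ℕ) (H : PlusHamiltonian T n), H.BoundedBy (p.eval n) →
      ∃ (N : ℕ) (H' : PlusHamiltonian S N) (c : ℝ) (E : QubitSpace n →ₗᵢ[ℂ] QubitSpace N),
        N ≤ P.eval n ∧ H'.BoundedBy (P.eval n) ∧ |c| ≤ ((P.eval n : ℕ) : ℝ) ∧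
        Simulates (H'.toOperator + (c : ℂ) • ContinuousLinearMap.id ℂ (QubitSpace N)) E
          H.toOperator
          (1 / (((q.eval n : ℕ) : ℝ) + 1)) (1 / (((q.eval n : ℕ) : ℝ) + 1))

end QubitSim

end

/-! Each target qubit is encoded in an open chain of `d * 2 + 1` physical qubits with the given term
on every bond. Under a Jordan–Wigner transformation with strings of Y the chain Hamiltonian becomes
quadratic in Majorana operators and splits into two decoupled families, each pairing `d + 1`
Majoranas on even sites with `d` on odd sites. Each family therefore has one unpaired zero mode. The
other modes have energies bounded below because the tridiagonal matrix `chainN`, with diagonal 1 +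
a² and off-diagonal -a, is at least (a - 1)². Hence the ground space has dimension 2 and gap at
least 2(a - 1) uniformly in `d`, and the zero modes act on it as X and Y of a logical qubit
(`exists_free_fermion_ground_projection`, `exists_qubit_encoding`, `exists_isChainEncoding`).

The zero-mode coefficients are geometric. The logical-X mode sits at the left end, with amplitude x
on the first qubit satisfying x² ≥ 1 - a⁻². The logical-Y mode sits at the right end and reaches the
first qubit only with amplitude z = x a⁻ᵈ. Compressing the term between the first qubits of two
blocks gives a x² XX - z² YY, which after rescaling is XX up to an error a⁻²ᵈ/a. Between the first
qubit of one block and the second qubit of the other the result is a x² t XX - z² t' YY, where t is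
negative and bounded away from 0 while t' ≥ 0. These signs follow from the gap applied to a trial
state (`IsChainEncoding.exists_conj_firstBond`). Combining the two interactions with weights
proportional to -t and 1 cancels XX exactly and leaves -YY (`exists_gadget_weights`).

The weights needed are of order a²ᵈ, so a polynomially small error and polynomial weights are
reconciled by choosing a^d of polynomial size. Finally the chains are multiplied by a large Δ and
the block interactions are treated to first order: a perturbation much smaller than the gap yields
its compression to the ground space (`simulates_of_gap`, `exists_simulation`). -/

noncomputable section

namespace QubitSim

open Matrix
open scoped ComplexOrder MatrixOrder Matrix.Norms.L2Operator

/-! ### Tensor products of matrices and one-site operators -/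

section PiTensor

variable {ι α β γ : Type*} [Fintype ι]

/-- The tensor product of a finite family of matrices. -/
def piTensor (M : ι → Matrix α β ℂ) : Matrix (ι → α) (ι → β) ℂ :=
  Matrix.of fun x y => ∏ i, M i (x i) (y i)

theorem piTensor_apply (M : ι → Matrix α β ℂ) (x : ι → α) (y : ι → β) :
    piTensor M x y = ∏ i, M i (x i) (y i) := rfl

theorem piTensor_mul [DecidableEq ι] [Fintype β] (M : ι → Matrix α β ℂ) (N : ι → Matrix β γ ℂ) :
    piTensor M * piTensor N = piTensor fun i => M i * N i := by
  ext x z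
  simp only [Matrix.mul_apply, piTensor_apply]
  rw [Finset.prod_univ_sum, Fintype.piFinset_univ]
  exact Finset.sum_congr rfl fun y _ => (Finset.prod_mul_distrib).symm

theorem piTensor_conjTranspose (M : ι → Matrix α β ℂ) :
    (piTensor M)ᴴ = piTensor fun i => (M i)ᴴ := by
  ext x y
  simp [piTensor_apply, Matrix.conjTranspose_apply]

theorem piTensor_one [DecidableEq ι] [DecidableEq α] :
    piTensor (fun _ : ι => (1 : Matrix α α ℂ)) = 1 := by
  ext x y
  simp only [piTensor_apply, Matrix.one_apply, Finset.prod_ite_zero, Finset.prod_const_one,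
    Finset.mem_univ, true_imp_iff, funext_iff]

theorem piTensor_smul (c : ι → ℂ) (M : ι → Matrix α β ℂ) :
    piTensor (fun i => c i • M i) = (∏ i, c i) • piTensor M := by
  ext x y
  simp [piTensor_apply, Finset.prod_mul_distrib]

variable [DecidableEq ι]

theorem piTensor_update_add (M : ι → Matrix α β ℂ) (i : ι) (A B : Matrix α β ℂ) :
    piTensor (Function.update M i (A + B)) =
      piTensor (Function.update M i A) + piTensor (Function.update M i B) := by
  ext x y
  have h : ∀ C : Matrix α β ℂ, piTensor (Function.update M i C) x y =
      C (x i) (y i) * ∏ j ∈ Finset.univ.erase i, M j (x j) (y j) := by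
    intro C
    rw [piTensor_apply, ← Finset.mul_prod_erase _ _ (Finset.mem_univ i), Function.update_self]
    congr 1
    exact Finset.prod_congr rfl fun j hj => by
      rw [Function.update_of_ne (Finset.ne_of_mem_erase hj)]
  rw [Matrix.add_apply, h, h, h, Matrix.add_apply, add_mul]

theorem piTensor_update_smul (M : ι → Matrix α β ℂ) (i : ι) (c : ℂ) (A : Matrix α β ℂ) :
    piTensor (Function.update M i (c • A)) = c • piTensor (Function.update M i A) := by
  have h : Function.update M i (c • A) =
      fun j => (Function.update (fun _ => (1 : ℂ)) i c) j • Function.update M i A j := by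
    funext j
    rcases eq_or_ne j i with rfl | h
    · simp
    · simp [h]
  rw [h, piTensor_smul]
  simp [Finset.prod_update_of_mem]

theorem piTensor_isometry [Fintype α] {φ : Matrix α β ℂ} [DecidableEq β] (hφ : φᴴ * φ = 1) :
    (piTensor fun _ : ι => φ)ᴴ * (piTensor fun _ : ι => φ) = 1 := by
  rw [piTensor_conjTranspose, piTensor_mul, hφ, piTensor_one]

/-- Two tensor products commute up to the product of the local commutation factors. -/
theorem piTensor_mul_eq_smul [Fintype α] {M N : ι → Matrix α α ℂ} {c : ι → ℂ}
    (h : ∀ i, M i * N i = c i • (N i * M i)) :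
    piTensor M * piTensor N = (∏ i, c i) • (piTensor N * piTensor M) := by
  rw [piTensor_mul, piTensor_mul, ← piTensor_smul]
  congr 1
  funext i
  exact h i

/-- The one-site operator `A` at the site `i`. -/
def site [DecidableEq α] (i : ι) (A : Matrix α α ℂ) : Matrix (ι → α) (ι → α) ℂ :=
  piTensor (Function.update (fun _ => 1) i A)

section Site

variable [DecidableEq α]

theorem site_add (i : ι) (A B : Matrix α α ℂ) : site i (A + B) = site i A + site i B :=
  piTensor_update_add _ _ _ _

theorem site_smul (i : ι) (c : ℂ) (A : Matrix α α ℂ) : site i (c • A) = c • site i A :=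
  piTensor_update_smul _ _ _ _

theorem site_zero (i : ι) : site i (0 : Matrix α α ℂ) = 0 := by
  simpa using site_smul i 0 (0 : Matrix α α ℂ)

theorem site_neg (i : ι) (A : Matrix α α ℂ) : site i (-A) = -site i A := by
  simpa using site_smul i (-1) A

theorem site_sub (i : ι) (A B : Matrix α α ℂ) : site i (A - B) = site i A - site i B := by
  rw [sub_eq_add_neg, site_add, site_neg, sub_eq_add_neg]

theorem site_sum {κ : Type*} (i : ι) (s : Finset κ) (A : κ → Matrix α α ℂ) :
    site i (∑ k ∈ s, A k) = ∑ k ∈ s, site i (A k) := by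
  classical
  induction s using Finset.induction_on with
  | empty => simp [site_zero]
  | insert k s hk ih => rw [Finset.sum_insert hk, Finset.sum_insert hk, site_add, ih]

theorem site_one (i : ι) : site i (1 : Matrix α α ℂ) = 1 := by
  rw [site, Function.update_eq_self_iff.mpr rfl, piTensor_one]

theorem site_conjTranspose (i : ι) (A : Matrix α α ℂ) : (site i A)ᴴ = site i Aᴴ := by
  rw [site, piTensor_conjTranspose, site]
  congr 1
  funext j
  rcases eq_or_ne j i with rfl | h
  · simp
  · simp [h]

variable [Fintype α]

theorem site_mul (i : ι) (A B : Matrix α α ℂ) : site i A * site i B = site i (A * B) := by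
  rw [site, site, piTensor_mul, site]
  congr 1
  funext j
  rcases eq_or_ne j i with rfl | h
  · simp
  · simp [h]

theorem site_mul_site {i j : ι} (hij : i ≠ j) (A B : Matrix α α ℂ) :
    site i A * site j B =
      piTensor (Function.update (Function.update (fun _ => 1) i A) j B) := by
  rw [site, site, piTensor_mul]
  congr 1
  funext l
  rcases eq_or_ne l j with rfl | h
  · simp [hij.symm]
  · simp [h]

theorem site_comm {i j : ι} (hij : i ≠ j) (A B : Matrix α α ℂ) :
    site i A * site j B = site j B * site i A := by
  rw [site_mul_site hij, site_mul_site hij.symm, Function.update_comm hij]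

theorem piTensor_conj_site_mul_site {φ : Matrix α β ℂ} [Fintype β] [DecidableEq β]
    (hφ : φᴴ * φ = 1) {i j : ι} (hij : i ≠ j) (A B : Matrix α α ℂ) :
    (piTensor fun _ : ι => φ)ᴴ * (site i A * site j B) * (piTensor fun _ : ι => φ) =
      site i (φᴴ * A * φ) * site j (φᴴ * B * φ) := by
  rw [site_mul_site hij, site_mul_site hij, piTensor_conjTranspose, piTensor_mul, piTensor_mul]
  congr 1
  funext l
  rcases eq_or_ne l j with rfl | h
  · simp
  · rcases eq_or_ne l i with rfl | h'
    · simp [h]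
    · simp [h, h', hφ]

theorem site_mul_piTensor {φ : Matrix α β ℂ} {A : Matrix α α ℂ} {c : ℂ} (h : A * φ = c • φ)
    (i : ι) : site i A * (piTensor fun _ : ι => φ) = c • piTensor fun _ : ι => φ := by
  rw [site, piTensor_mul]
  have h' : (fun j => Function.update (fun _ : ι => (1 : Matrix α α ℂ)) i A j * φ) =
      Function.update (fun _ => φ) i (c • φ) := by
    funext j
    rcases eq_or_ne j i with rfl | hj
    · simp [h]
    · simp [hj]
  rw [h', piTensor_update_smul, Function.update_eq_self_iff.mpr rfl]

theorem site_posSemidef {A : Matrix α α ℂ} (hA : A.PosSemidef) (i : ι) :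
    (site i A).PosSemidef := by
  obtain ⟨B, rfl⟩ := CStarAlgebra.nonneg_iff_eq_star_mul_self.mp hA.nonneg
  rw [Matrix.star_eq_conjTranspose, ← site_mul, ← site_conjTranspose]
  exact Matrix.posSemidef_conjTranspose_mul_self _

end Site

end PiTensor

/-! ### Two-qubit terms as products of site operators, and grouping of qubits into blocks -/

section OnQubits

theorem onQubits_kronecker {n : ℕ} (A B : Matrix (Fin 2) (Fin 2) ℂ) {i j : Fin n} (hij : i ≠ j) :
    onQubits (A ⊗ₖ B) i j = site i A * site j B := by
  rw [site_mul_site hij]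
  ext x y
  rw [onQubits, Matrix.of_apply, piTensor_apply, ← Finset.mul_prod_erase _ _ (Finset.mem_univ i),
    ← Finset.mul_prod_erase _ _ (Finset.mem_erase.mpr ⟨hij.symm, Finset.mem_univ j⟩),
    Function.update_self, Function.update_of_ne hij, Function.update_self, ← mul_assoc]
  have h : ∀ k ∈ (Finset.univ.erase i).erase j,
      (Function.update (Function.update (fun _ => (1 : Matrix (Fin 2) (Fin 2) ℂ)) i A) j B) k
        (x k) (y k) = if x k = y k then 1 else 0 := by
    intro k hk
    rw [Finset.mem_erase, Finset.mem_erase] at hk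
    rw [Function.update_of_ne hk.1, Function.update_of_ne hk.2.1, Matrix.one_apply]
  rw [Finset.prod_congr rfl h, Finset.prod_ite_zero]
  simp only [Finset.mem_erase, Finset.mem_univ, and_true, Matrix.kroneckerMap_apply,
    Finset.prod_const_one, mul_ite, mul_one, mul_zero]
  congr 1
  exact propext ⟨fun h k hk => h k hk.2 hk.1, fun h k h1 h2 => h k ⟨h2, h1⟩⟩

/-- Configurations of `n * k` qubits are configurations of `n` blocks of `k` qubits. -/
def blockEquiv (n k : ℕ) : (Fin (n * k) → Fin 2) ≃ (Fin n → Fin k → Fin 2) :=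
  (Equiv.arrowCongr finProdFinEquiv.symm (Equiv.refl _)).trans (Equiv.curry _ _ _)

theorem blockEquiv_apply {n k : ℕ} (x : Fin (n * k) → Fin 2) (b : Fin n) (i : Fin k) :
    blockEquiv n k x b i = x (finProdFinEquiv (b, i)) := rfl

/-- Lets a block be treated as a single site with a larger local space, so that the same tensor
lemmas serve both levels. -/
theorem site_finProdFinEquiv {n k : ℕ} (b : Fin n) (i : Fin k) (A : Matrix (Fin 2) (Fin 2) ℂ) :
    site (finProdFinEquiv (b, i)) A =
      (site b (site i A)).submatrix (blockEquiv n k) (blockEquiv n k) := by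
  ext x y
  rw [Matrix.submatrix_apply, site, piTensor_apply, site, piTensor_apply,
    ← finProdFinEquiv.prod_comp, Fintype.prod_prod_type]
  refine Finset.prod_congr rfl fun b' _ => ?_
  rcases eq_or_ne b' b with rfl | hb
  · rw [Function.update_self, site, piTensor_apply]
    refine Finset.prod_congr rfl fun i' _ => ?_
    rw [blockEquiv_apply, blockEquiv_apply]
    rcases eq_or_ne i' i with rfl | hi
    · simp
    · rw [Function.update_of_ne hi, Function.update_of_ne]
      simpa using hi
  · rw [Function.update_of_ne hb, ← piTensor_one, piTensor_apply]
    refine Finset.prod_congr rfl fun i' _ => ?_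
    rw [Function.update_of_ne, blockEquiv_apply, blockEquiv_apply]
    simp [hb]

end OnQubits

/-! ### Positivity, commuting projections and anticommutators -/

section Algebra

variable {κ : Type*}

theorem smul_nonneg_matrix {c : ℝ} (hc : 0 ≤ c) {A : Matrix κ κ ℂ} (hA : 0 ≤ A) :
    0 ≤ (c : ℂ) • A := by
  rw [Matrix.nonneg_iff_posSemidef] at hA ⊢
  exact hA.smul (Complex.zero_le_real.mpr hc)

variable [Fintype κ]

theorem nonneg_of_projection {A : Matrix κ κ ℂ} (h1 : Aᴴ = A) (h2 : A * A = A) : 0 ≤ A := by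
  rw [Matrix.nonneg_iff_posSemidef]
  have h := Matrix.posSemidef_conjTranspose_mul_self A
  rwa [h1, h2] at h

variable [DecidableEq κ]

theorem nonneg_one_add_involution {A : Matrix κ κ ℂ} (h1 : Aᴴ = A) (h2 : A * A = 1) :
    0 ≤ 1 + A := by
  have h : 0 ≤ (1 / 2 : ℂ) • (1 + A) := by
    refine nonneg_of_projection ?_ ?_
    · simp [Matrix.conjTranspose_smul, h1]
    · rw [smul_mul_smul_comm, mul_add, add_mul, add_mul, h2]
      simp only [mul_one, one_mul]
      module
  rw [Matrix.nonneg_iff_posSemidef] at h ⊢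
  have := h.smul (show (0 : ℂ) ≤ 2 by norm_num)
  rwa [smul_smul, show (2 : ℂ) * (1 / 2) = 1 by norm_num, one_smul] at this

/-- The joint `-1` eigenprojection of commuting Hermitian involutions, each of which can be
flipped independently of the others. -/
theorem exists_joint_projection {J : Type*} (n q : J → Matrix κ κ ℂ)
    (hn : ∀ j, (n j)ᴴ = n j) (hn2 : ∀ j, n j * n j = 1)
    (hcomm : ∀ i j, n i * n j = n j * n i) (hq : ∀ j, q j * q j = 1)
    (hqn : ∀ j, q j * n j = -(n j * q j)) (hqn' : ∀ i j, i ≠ j → q i * n j = n j * q i)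
    (S : Finset J) :
    ∃ P : Matrix κ κ ℂ, Pᴴ = P ∧ P * P = P ∧
      (∀ B, (∀ j ∈ S, B * n j = n j * B) → B * P = P * B) ∧ (∀ j ∈ S, n j * P = -P) ∧
      1 - P ≤ ∑ j ∈ S, (1 / 2 : ℂ) • (1 + n j) ∧
      2 ^ S.card * P.trace = Fintype.card κ := by
  classical
  induction S using Finset.induction_on with
  | empty =>
    exact ⟨1, by simp, by simp, by simp, by simp, by simp, by simp⟩
  | insert c S hc ih =>
    obtain ⟨P, hP, hP2, hPc, hPn, hPle, hPtr⟩ := ih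
    have hcP : n c * P = P * n c := hPc _ fun j _ => hcomm c j
    have hqP : q c * P = P * q c := hPc _ fun j hj => hqn' c j (by rintro rfl; exact hc hj)
    -- The projection is the product of the factors (1 - n j)/2; the induction multiplies by one
    -- more.
    set M : Matrix κ κ ℂ := (1 / 2 : ℂ) • (1 - n c) with hM
    have hMP : M * P = P * M := by
      rw [hM, smul_mul_assoc, mul_smul_comm, sub_mul, mul_sub, hcP, one_mul, mul_one]
    have hMM : M * M = M := by
      rw [hM, smul_mul_smul_comm, mul_sub, sub_mul, sub_mul, hn2]
      simp only [mul_one, one_mul]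
      module
    have hMh : Mᴴ = M := by simp [hM, Matrix.conjTranspose_smul, hn]
    have hnM : n c * M = -M := by
      rw [hM, mul_smul_comm, mul_sub, hn2, mul_one]
      module
    refine ⟨P * M, ?_, ?_, ?_, ?_, ?_, ?_⟩
    · rw [Matrix.conjTranspose_mul, hP, hMh, hMP]
    · rw [mul_assoc, ← mul_assoc M, hMP, mul_assoc, hMM, ← mul_assoc, hP2]
    · intro B hB
      have h1 := hPc B fun j hj => hB j (Finset.mem_insert_of_mem hj)
      have h2 := hB c (Finset.mem_insert_self _ _)
      have h3 : B * M = M * B := by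
        rw [hM, mul_smul_comm, smul_mul_assoc, mul_sub, sub_mul, h2, one_mul, mul_one]
      rw [← mul_assoc, h1, mul_assoc, h3, mul_assoc]
    · intro j hj
      rcases Finset.mem_insert.mp hj with rfl | hj
      · rw [← hMP, ← mul_assoc, hnM, neg_mul]
      · rw [← mul_assoc, hPn j hj, neg_mul]
    · rw [Finset.sum_insert hc]
      -- A product of commuting projections is positive; expanding it is the union bound.
      have h1 : (0 : Matrix κ κ ℂ) ≤ (1 - M) * (1 - P) := by
        have hc' : (1 - M) * (1 - P) = (1 - P) * (1 - M) := by
          simp only [mul_sub, sub_mul, hMP, mul_one, one_mul]; abel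
        refine nonneg_of_projection ?_ ?_
        · rw [Matrix.conjTranspose_mul, hc']
          simp [hMh, hP]
        · rw [mul_assoc, ← mul_assoc (1 - P), ← hc', mul_assoc, ← mul_assoc (1 - M)]
          have h3 : (1 - M) * (1 - M) = 1 - M := by
            simp only [mul_sub, sub_mul, hMM, mul_one, one_mul]; abel
          have h4 : (1 - P) * (1 - P) = 1 - P := by
            simp only [mul_sub, sub_mul, hP2, mul_one, one_mul]; abel
          rw [h3, h4]
      have h2 : (1 / 2 : ℂ) • (1 + n c) = 1 - M := by rw [hM]; module
      rw [h2]
      have h3 : (1 - M) + (1 - P) - (1 - P * M) = (1 - M) * (1 - P) := by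
        rw [← hMP]; simp only [mul_sub, sub_mul, mul_one, one_mul]; abel
      have h4 : 1 - P * M ≤ (1 - M) + (1 - P) := by rw [← sub_nonneg, h3]; exact h1
      exact h4.trans (by gcongr)
    · have h1 : (P * n c).trace = 0 := by
        -- Conjugation by `q c` flips `n c` and fixes `P`, so each new factor exactly halves the
        -- trace.
        have h2 : (P * n c).trace = -(P * n c).trace := by
          calc (P * n c).trace = (q c * (q c * (P * n c))).trace := by
                rw [← mul_assoc, hq, one_mul]
            _ = (q c * (P * n c) * q c).trace := Matrix.trace_mul_comm _ _
            _ = (-(P * n c)).trace := by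
                rw [← mul_assoc, hqP, mul_assoc P, hqn, mul_neg, neg_mul, mul_assoc P,
                  mul_assoc (n c), hq, mul_one]
            _ = -(P * n c).trace := Matrix.trace_neg _
        exact self_eq_neg.mp h2
      have h2 : (P * M).trace = (1 / 2 : ℂ) * P.trace := by
        rw [hM, mul_smul_comm, Matrix.trace_smul, mul_sub, mul_one, Matrix.trace_sub, h1, sub_zero,
          smul_eq_mul]
      rw [Finset.card_insert_of_notMem hc, h2, ← hPtr]
      ring

/-- Bilinearity of the anticommutator. It turns relations among fermionic modes into real quadratic
forms in their coefficients. -/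
theorem anticommutator_sum {I J : Type*} [Fintype I] [Fintype J] (A : I → Matrix κ κ ℂ)
    (B : J → Matrix κ κ ℂ) (c : I → J → ℝ)
    (h : ∀ i j, A i * B j + B j * A i = (c i j : ℂ) • 1) (x : I → ℝ) (y : J → ℝ) :
    (∑ i, (x i : ℂ) • A i) * (∑ j, (y j : ℂ) • B j) +
        (∑ j, (y j : ℂ) • B j) * (∑ i, (x i : ℂ) • A i) =
      ((∑ i, ∑ j, x i * c i j * y j : ℝ) : ℂ) • 1 := by
  rw [Finset.sum_mul_sum, Finset.sum_mul_sum, Finset.sum_comm (s := Finset.univ (α := J)),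
    ← Finset.sum_add_distrib]
  push_cast
  rw [Finset.sum_smul]
  refine Finset.sum_congr rfl fun i _ => ?_
  rw [← Finset.sum_add_distrib, Finset.sum_smul]
  refine Finset.sum_congr rfl fun j _ => ?_
  have h' := congrArg (fun M => ((x i : ℂ) * y j) • M) (h i j)
  simp only [smul_add, smul_smul] at h'
  rw [smul_mul_smul_comm, smul_mul_smul_comm, mul_comm (y j : ℂ), h']
  congr 1
  ring

end Algebra

/-- Diagonalizing over the reals matters: real combinations of Hermitian modes stay Hermitian. -/
theorem exists_real_diagonalization {J : Type*} [Fintype J] [DecidableEq J] {N : Matrix J J ℝ}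
    (hN : N.IsHermitian) :
    ∃ (U : Matrix J J ℝ) (μ : J → ℝ), (∀ i j, ∑ k, U k i * U k j = if i = j then 1 else 0) ∧
      (∀ i j, ∑ k, U i k * U j k = if i = j then 1 else 0) ∧
      ∀ i j, ∑ k, ∑ l, U k i * N k l * U l j = if i = j then μ i else 0 := by
  set U : Matrix J J ℝ := (hN.eigenvectorUnitary : Matrix J J ℝ) with hU
  have h1 : star U * U = 1 := Unitary.coe_star_mul_self hN.eigenvectorUnitary
  have h2 : U * star U = 1 := Unitary.coe_mul_star_self hN.eigenvectorUnitary
  have h3 : star U * N * U = Matrix.diagonal hN.eigenvalues := by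
    have h := hN.spectral_theorem
    rw [Unitary.conjStarAlgAut_apply] at h
    have h : N = U * Matrix.diagonal hN.eigenvalues * star U := h
    calc star U * N * U = star U * (U * Matrix.diagonal hN.eigenvalues * star U) * U :=
          congrArg (fun M => star U * M * U) h
      _ = (star U * U) * Matrix.diagonal hN.eigenvalues * (star U * U) := by
          simp only [mul_assoc]
      _ = _ := by rw [h1, one_mul, mul_one]
  refine ⟨U, hN.eigenvalues, fun i j => ?_, fun i j => ?_, fun i j => ?_⟩
  · simpa [Matrix.mul_apply, Matrix.one_apply] using congrFun (congrFun h1 i) j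
  · simpa [Matrix.mul_apply, Matrix.one_apply] using congrFun (congrFun h2 i) j
  · have h := congrFun (congrFun h3 i) j
    rw [Matrix.diagonal_apply, Matrix.mul_apply] at h
    rw [← h, Finset.sum_comm]
    refine Finset.sum_congr rfl fun l _ => ?_
    rw [Matrix.mul_apply, Finset.sum_mul]
    rfl

/-! ### Ground space and gap of a quadratic fermionic Hamiltonian -/

section FreeFermion

variable {κ : Type*} [Fintype κ] [DecidableEq κ] {J : Type*} [Fintype J] [DecidableEq J]

/-- The ground space and the gap of a quadratic fermionic Hamiltonian `i ∑ j, G j * q j`. -/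
theorem exists_free_fermion_ground_projection (G q : J → Matrix κ κ ℂ) (N : Matrix J J ℝ) {m : ℝ}
    (hm : 0 < m) (hNh : N.IsHermitian)
    (hNm : ∀ x : J → ℝ, m ^ 2 * ∑ i, x i ^ 2 ≤ ∑ i, ∑ j, x i * N i j * x j)
    (hGh : ∀ j, (G j)ᴴ = G j) (hqh : ∀ j, (q j)ᴴ = q j)
    (hGG : ∀ i j, G i * G j + G j * G i = ((2 * N i j : ℝ) : ℂ) • 1)
    (hqq : ∀ i j, q i * q j + q j * q i = ((if i = j then 2 else 0 : ℝ) : ℂ) • 1)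
    (hGq : ∀ i j, G i * q j + q j * G i = 0) :
    ∃ (P : Matrix κ κ ℂ) (E : ℝ), Pᴴ = P ∧ P * P = P ∧
      (∀ B, (∀ j, B * G j = -(G j * B)) → (∀ j, B * q j = -(q j * B)) → B * P = P * B) ∧
      (∑ j, Complex.I • (G j * q j)) * P = (E : ℂ) • P ∧
      ((2 * m : ℝ) : ℂ) • (1 - P) ≤ (∑ j, Complex.I • (G j * q j)) - (E : ℂ) • 1 ∧
      2 ^ Fintype.card J * P.trace = Fintype.card κ := by
  obtain ⟨U, μ, hU1, hU2, hU3⟩ := exists_real_diagonalization hNh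
  have hμ : ∀ k, m ^ 2 ≤ μ k := by
    intro k
    have h := hNm fun i => U i k
    have h1 := hU1 k k
    have h3 := hU3 k k
    simp only [if_true] at h1 h3
    rw [h3] at h
    simp only [pow_two (U _ _), h1, mul_one] at h
    exact h
  set σ : J → ℝ := fun k => Real.sqrt (μ k) with hσ
  have hσm : ∀ k, m ≤ σ k := fun k => Real.le_sqrt_of_sq_le (hμ k)
  have hσpos : ∀ k, 0 < σ k := fun k => hm.trans_le (hσm k)
  have hσsq : ∀ k, σ k * σ k = μ k := fun k => Real.mul_self_sqrt ((sq_nonneg m).trans (hμ k))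
  have hσne : ∀ k, (σ k : ℂ) ≠ 0 := fun k => Complex.ofReal_ne_zero.mpr (hσpos k).ne'
  -- The same orthogonal matrix rotates both families. This leaves ∑ G q unchanged and keeps the q's
  -- orthonormal, so no separate left and right singular vectors are needed.
  set G' : J → Matrix κ κ ℂ := fun k => ∑ j, (U j k : ℂ) • G j with hG'
  set q' : J → Matrix κ κ ℂ := fun k => ∑ j, (U j k : ℂ) • q j with hq'
  have hG'h : ∀ k, (G' k)ᴴ = G' k := fun k => by
    simp [hG', Matrix.conjTranspose_sum, Matrix.conjTranspose_smul, hGh]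
  have hq'h : ∀ k, (q' k)ᴴ = q' k := fun k => by
    simp [hq', Matrix.conjTranspose_sum, Matrix.conjTranspose_smul, hqh]
  have hGG' : ∀ k l, G' k * G' l + G' l * G' k = ((if k = l then 2 * μ k else 0 : ℝ) : ℂ) • 1 := by
    intro k l
    rw [hG', anticommutator_sum G G _ hGG]
    have h : ∑ i, ∑ j, U i k * (2 * N i j) * U j l = 2 * ∑ i, ∑ j, U i k * N i j * U j l := by
      simp only [Finset.mul_sum]
      exact Finset.sum_congr rfl fun i _ => Finset.sum_congr rfl fun j _ => by ring
    rw [h, hU3]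
    congr 2
    split_ifs <;> simp
  have hqq' : ∀ k l, q' k * q' l + q' l * q' k = ((if k = l then 2 else 0 : ℝ) : ℂ) • 1 := by
    intro k l
    rw [hq', anticommutator_sum q q _ hqq]
    have h : ∑ i, ∑ j, U i k * (if i = j then (2 : ℝ) else 0) * U j l =
        2 * ∑ i, U i k * U i l := by
      simp only [mul_ite, mul_zero, ite_mul, zero_mul, Finset.sum_ite_eq, Finset.mem_univ, if_true,
        Finset.mul_sum]
      exact Finset.sum_congr rfl fun i _ => by ring
    rw [h, hU1]
    congr 2
    split_ifs <;> simp
  have hGq' : ∀ k l, q' l * G' k = -(G' k * q' l) := by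
    intro k l
    have h := anticommutator_sum G q (fun _ _ => 0) (fun i j => by simpa using hGq i j)
      (fun i => U i k) (fun i => U i l)
    rw [eq_neg_iff_add_eq_zero, add_comm]
    simp only [mul_zero, zero_mul, Finset.sum_const_zero, Complex.ofReal_zero, zero_smul] at h
    exact h
  have hGself : ∀ k, G' k * G' k = (μ k : ℂ) • 1 := by
    intro k
    have h := hGG' k k
    rw [if_pos rfl, ← two_smul ℂ] at h
    have h' := congrArg (fun M => (1 / 2 : ℂ) • M) h
    simp only [smul_smul] at h'
    push_cast at h'
    rw [← mul_assoc, show (1 / 2 : ℂ) * 2 = 1 by norm_num, one_mul, one_smul] at h'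
    exact h'
  have hqself : ∀ k, q' k * q' k = 1 := by
    intro k
    have h := hqq' k k
    rw [if_pos rfl, ← two_smul ℂ] at h
    have h' := congrArg (fun M => (1 / 2 : ℂ) • M) h
    simp only [smul_smul] at h'
    push_cast at h'
    rw [show (1 / 2 : ℂ) * 2 = 1 by norm_num, one_smul, one_smul] at h'
    exact h'
  have hGne : ∀ k l, k ≠ l → G' k * G' l = -(G' l * G' k) := fun k l h => by
    have h' := hGG' k l
    rw [if_neg h] at h'
    exact eq_neg_of_add_eq_zero_left (by simpa using h')
  have hqne : ∀ k l, k ≠ l → q' k * q' l = -(q' l * q' k) := fun k l h => by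
    have h' := hqq' k l
    rw [if_neg h] at h'
    exact eq_neg_of_add_eq_zero_left (by simpa using h')
  -- Since `G' k` squares to σ², division by σ makes each mode an involution, and the Hamiltonian
  -- becomes ∑ σ n.
  set n : J → Matrix κ κ ℂ := fun k => (Complex.I / σ k) • (G' k * q' k) with hn
  have hIσ : ∀ k, (Complex.I / σ k) * (Complex.I / σ k) * (μ k : ℂ) = -1 := fun k => by
    have := hσne k
    rw [← hσsq]
    push_cast
    field_simp
    exact Complex.I_sq
  -- an operator anticommuting with both factors of a mode commutes with the mode
  have hmode : ∀ (B : Matrix κ κ ℂ) k, B * G' k = -(G' k * B) → B * q' k = -(q' k * B) →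
      B * n k = n k * B := by
    intro B k h1 h2
    simp only [hn, mul_smul_comm, smul_mul_assoc]
    rw [← mul_assoc, h1, neg_mul, mul_assoc, h2, mul_neg, neg_neg, mul_assoc]
  have hqn' : ∀ i j, i ≠ j → q' i * n j = n j * q' i := fun i j h =>
    hmode _ _ (hGq' j i) (hqne i j h)
  have hGn' : ∀ i j, i ≠ j → G' i * n j = n j * G' i := fun i j h =>
    hmode _ _ (hGne i j h) (by rw [hGq' i j, neg_neg])
  have hnsq : ∀ k, n k * n k = 1 := by
    intro k
    simp only [hn, smul_mul_smul_comm]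
    rw [mul_assoc, ← mul_assoc (q' k), hGq', neg_mul, mul_neg, ← mul_assoc, ← mul_assoc,
      hGself, mul_assoc, hqself, mul_one, smul_neg, smul_smul, hIσ, neg_smul, neg_neg, one_smul]
  have hnh : ∀ k, (n k)ᴴ = n k := by
    intro k
    simp only [hn, Matrix.conjTranspose_smul, Matrix.conjTranspose_mul, hG'h, hq'h, hGq']
    rw [smul_neg, ← neg_smul]
    congr 1
    simp [neg_div]
  obtain ⟨P, hP, hP2, hPc, hPn, hPle, hPtr⟩ := exists_joint_projection n q' hnh hnsq
    (by
      intro i j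
      rcases eq_or_ne i j with rfl | h
      · rfl
      · exact ((Commute.mul_left (hGn' i j h) (hqn' i j h)).smul_left (Complex.I / (σ i : ℂ))).eq)
    hqself
    (by
      intro k
      simp only [hn, mul_smul_comm, smul_mul_assoc]
      rw [← mul_assoc, hGq', neg_mul, smul_neg])
    hqn' Finset.univ
  have hH : ∑ j, Complex.I • (G j * q j) = ∑ k, (σ k : ℂ) • n k := by
    have h1 : ∀ k, (σ k : ℂ) • n k = Complex.I • (G' k * q' k) := fun k => by
      simp only [hn, smul_smul]
      rw [mul_div_cancel₀ _ (hσne k)]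
    simp only [h1, ← Finset.smul_sum]
    congr 1
    simp only [hG', hq', Finset.sum_mul_sum, smul_mul_smul_comm]
    rw [Finset.sum_comm]
    refine Finset.sum_congr rfl fun i _ => ?_
    rw [Finset.sum_comm]
    have h2 : ∀ j, ∑ k, ((U i k : ℂ) * U j k) • (G i * q j) =
        if i = j then G i * q j else 0 := fun j => by
      rw [← Finset.sum_smul]
      have := congrArg (fun r : ℝ => (r : ℂ)) (hU2 i j)
      push_cast at this
      rw [this]
      split_ifs <;> simp
    simp only [h2, Finset.sum_ite_eq, Finset.mem_univ, if_true]
  refine ⟨P, -∑ k, σ k, hP, hP2, ?_, ?_, ?_, by simpa using hPtr⟩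
  · intro B hBG hBq
    refine hPc B fun k _ => hmode B k ?_ ?_
    · simp only [hG', Finset.mul_sum, Finset.sum_mul, mul_smul_comm, smul_mul_assoc, hBG, smul_neg,
        Finset.sum_neg_distrib]
    · simp only [hq', Finset.mul_sum, Finset.sum_mul, mul_smul_comm, smul_mul_assoc, hBq, smul_neg,
        Finset.sum_neg_distrib]
  · rw [hH, Finset.sum_mul]
    simp only [smul_mul_assoc, hPn _ (Finset.mem_univ _)]
    push_cast
    rw [neg_smul, Finset.sum_smul, ← Finset.sum_neg_distrib]
    simp
  -- Split σ = m + (σ - m): the first part dominates 2m(1 - P) by the union bound, and the second is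
  -- positive.
  · have h1 : (∑ j, Complex.I • (G j * q j)) - ((-∑ k, σ k : ℝ) : ℂ) • (1 : Matrix κ κ ℂ) =
        ((2 * m : ℝ) : ℂ) • (∑ k, (1 / 2 : ℂ) • (1 + n k)) +
          ∑ k, ((σ k - m : ℝ) : ℂ) • (1 + n k) := by
      rw [hH]
      push_cast
      rw [neg_smul, sub_neg_eq_add, Finset.sum_smul, ← Finset.sum_add_distrib, Finset.smul_sum,
        ← Finset.sum_add_distrib]
      refine Finset.sum_congr rfl fun k _ => ?_
      module
    rw [h1, ← sub_nonneg]
    have h2 : (0 : Matrix κ κ ℂ) ≤ ∑ k, ((σ k - m : ℝ) : ℂ) • (1 + n k) :=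
      Finset.sum_nonneg fun k _ => smul_nonneg_matrix (sub_nonneg.mpr (hσm k))
        (nonneg_one_add_involution (hnh k) (hnsq k))
    have h3 := smul_nonneg_matrix (mul_nonneg zero_le_two hm.le) (sub_nonneg.mpr hPle)
    have h4 := add_nonneg h3 h2
    convert h4 using 1
    rw [add_sub_right_comm, ← smul_sub]

end FreeFermion

/-! ### Pauli relations -/

section Pauli

theorem pauliX_mul_self : pauliX * pauliX = 1 := by
  ext i j; fin_cases i <;> fin_cases j <;> simp [pauliX, Matrix.mul_apply]

theorem pauliY_mul_self : pauliY * pauliY = 1 := by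
  ext i j; fin_cases i <;> fin_cases j <;> simp [pauliY, Matrix.mul_apply]

theorem pauliZ_mul_self : pauliZ * pauliZ = 1 := by
  ext i j; fin_cases i <;> fin_cases j <;> simp [pauliZ, Matrix.mul_apply]

theorem pauliX_conjTranspose : pauliXᴴ = pauliX := by
  ext i j; fin_cases i <;> fin_cases j <;> simp [pauliX]

theorem pauliY_conjTranspose : pauliYᴴ = pauliY := by
  ext i j; fin_cases i <;> fin_cases j <;> simp [pauliY]

theorem pauliZ_conjTranspose : pauliZᴴ = pauliZ := by
  ext i j; fin_cases i <;> fin_cases j <;> simp [pauliZ]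

theorem pauliX_mul_pauliY : pauliX * pauliY = Complex.I • pauliZ := by
  ext i j; fin_cases i <;> fin_cases j <;> simp [pauliX, pauliY, pauliZ, Matrix.mul_apply]

theorem pauliY_mul_pauliX : pauliY * pauliX = -Complex.I • pauliZ := by
  ext i j; fin_cases i <;> fin_cases j <;> simp [pauliX, pauliY, pauliZ, Matrix.mul_apply]

theorem pauliZ_mul_pauliY : pauliZ * pauliY = -Complex.I • pauliX := by
  ext i j; fin_cases i <;> fin_cases j <;> simp [pauliX, pauliY, pauliZ, Matrix.mul_apply]

theorem pauliY_mul_pauliZ : pauliY * pauliZ = Complex.I • pauliX := by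
  ext i j; fin_cases i <;> fin_cases j <;> simp [pauliX, pauliY, pauliZ, Matrix.mul_apply]

theorem pauliX_mul_pauliZ : pauliX * pauliZ = -(pauliZ * pauliX) := by
  ext i j; fin_cases i <;> fin_cases j <;> simp [pauliX, pauliZ, Matrix.mul_apply]

end Pauli

theorem exists_real_of_nonneg {z : ℂ} (hz : 0 ≤ z) : ∃ r : ℝ, 0 ≤ r ∧ (r : ℂ) = z :=
  ⟨z.re, (Complex.nonneg_iff.mp hz).1, Complex.ext rfl (Complex.nonneg_iff.mp hz).2⟩

theorem matrix_eq_zero_of_eq_neg {α β : Type*} {M : Matrix α β ℂ} (h : M = -M) : M = 0 := by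
  ext i j
  exact self_eq_neg.mp (congrFun (congrFun h i) j)

/-! ### Logical qubits from projections, and symmetries of a gapped ground space -/

section Encoding

variable {κ : Type*} [Fintype κ]

/-- A nonzero column of A, normalized, is fixed by A. Then A - y y† is again a Hermitian idempotent
and has trace 0, so it vanishes. -/
theorem exists_eq_vecMulVec_of_trace_eq_one {A : Matrix κ κ ℂ} (h1 : Aᴴ = A) (h2 : A * A = A)
    (h3 : A.trace = 1) : ∃ y : κ → ℂ, star y ⬝ᵥ y = 1 ∧ A = vecMulVec y (star y) := by
  have hj : ∃ j, A j j ≠ 0 := by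
    by_contra! h
    have : A.trace = 0 := Finset.sum_eq_zero fun j _ => h j
    rw [h3] at this
    exact one_ne_zero this
  obtain ⟨j, hj⟩ := hj
  have hpos : 0 ≤ A j j := (Matrix.nonneg_iff_posSemidef.mp (nonneg_of_projection h1 h2)).diag_nonneg
  obtain ⟨r, hr0, hr⟩ := exists_real_of_nonneg hpos
  have hrpos : 0 < r := lt_of_le_of_ne hr0 fun h => hj (by rw [← hr, ← h]; simp)
  set s : ℝ := (Real.sqrt r)⁻¹ with hs
  have hss : (s : ℂ) * s * A j j = 1 := by
    rw [← hr, ← Complex.ofReal_mul, ← Complex.ofReal_mul, hs, ← mul_inv, Real.mul_self_sqrt hr0,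
      inv_mul_cancel₀ hrpos.ne', Complex.ofReal_one]
  set y : κ → ℂ := fun k => s * A k j with hy
  have hAstar : ∀ k l, star (A k l) = A l k := fun k l => by
    conv_rhs => rw [← h1]
    rfl
  have hyy : star y ⬝ᵥ y = 1 := by
    have h := congrFun (congrFun h2 j) j
    rw [Matrix.mul_apply] at h
    rw [← hss, ← h, Finset.mul_sum]
    refine Finset.sum_congr rfl fun k _ => ?_
    simp only [hy, Pi.star_apply, star_mul', hAstar]
    simp
    ring
  have hAy : A *ᵥ y = y := by
    funext k
    have h := congrFun (congrFun h2 k) j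
    rw [Matrix.mul_apply] at h
    simp only [hy, Matrix.mulVec, dotProduct]
    rw [← h, Finset.mul_sum]
    exact Finset.sum_congr rfl fun l _ => by ring
  refine ⟨y, hyy, ?_⟩
  set B := vecMulVec y (star y) with hB
  have hBh : Bᴴ = B := by rw [hB, Matrix.conjTranspose_vecMulVec, star_star]
  have hBB : B * B = B := by
    rw [hB, Matrix.vecMulVec_mul_vecMulVec, hyy, one_smul]
  have hAB : A * B = B := by rw [hB, Matrix.mul_vecMulVec, hAy]
  have hBA : B * A = B := by
    have h := congrArg Matrix.conjTranspose hAB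
    rwa [Matrix.conjTranspose_mul, h1, hBh] at h
  have hBt : B.trace = 1 := by rw [hB, Matrix.trace_vecMulVec, dotProduct_comm, hyy]
  have h0 : ((A - B)ᴴ * (A - B)).trace = 0 := by
    rw [Matrix.conjTranspose_sub, h1, hBh, mul_sub, sub_mul, sub_mul, h2, hAB, hBA, hBB]
    simp [h3, hBt]
  exact sub_eq_zero.mp (Matrix.trace_conjTranspose_mul_self_eq_zero_iff.mp h0)

variable [DecidableEq κ]

/-- A two-dimensional space carrying two anticommuting Hermitian involutions is a qubit. -/
theorem exists_qubit_encoding {P Γ Γ' : Matrix κ κ ℂ} (hP : Pᴴ = P) (hP2 : P * P = P)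
    (htr : P.trace = 2) (hΓ : Γᴴ = Γ) (hΓ' : Γ'ᴴ = Γ') (hΓ2 : Γ * Γ = 1) (hΓ2' : Γ' * Γ' = 1)
    (hanti : Γ * Γ' = -(Γ' * Γ)) (hΓP : Γ * P = P * Γ) (hΓP' : Γ' * P = P * Γ') :
    ∃ φ : Matrix κ (Fin 2) ℂ, φᴴ * φ = 1 ∧ φ * φᴴ = P ∧ Γ * φ = φ * pauliX ∧
      Γ' * φ = φ * pauliY := by
  -- `W` plays the role of Z. Its +1 eigenvector in the range of `P` is the logical |0⟩, and `Γ`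
  -- maps it to the logical |1⟩.
  set W : Matrix κ κ ℂ := -Complex.I • (Γ * Γ') with hW
  have hWh : Wᴴ = W := by
    rw [hW, Matrix.conjTranspose_smul, Matrix.conjTranspose_mul, hΓ, hΓ', hanti]
    simp
  have hWW : W * W = 1 := by
    have h : Γ * Γ' * (Γ * Γ') = -1 := by
      rw [mul_assoc, ← mul_assoc Γ', show Γ' * Γ = -(Γ * Γ') by rw [hanti, neg_neg], neg_mul,
        mul_neg, mul_assoc Γ Γ', hΓ2', mul_one, hΓ2]
    rw [hW, smul_mul_smul_comm, h, neg_mul_neg, Complex.I_mul_I]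
    simp
  have hWP : W * P = P * W := by
    rw [hW, smul_mul_assoc, mul_smul_comm, mul_assoc, hΓP', ← mul_assoc, hΓP, mul_assoc]
  have hΓW : Γ * W = -(W * Γ) := by
    rw [hW, mul_smul_comm, smul_mul_assoc, hanti, mul_neg, neg_mul, smul_neg, smul_neg, neg_neg,
      ← mul_assoc, hanti, mul_assoc, neg_mul, smul_neg]
    simp [mul_assoc]
  have hΓ'eq : Γ' = Complex.I • (Γ * W) := by
    rw [hW, mul_smul_comm, ← mul_assoc, hΓ2, one_mul, smul_smul]
    simp
  set A : Matrix κ κ ℂ := (1 / 2 : ℂ) • (P * (1 + W)) with hA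
  have hAh : Aᴴ = A := by
    rw [hA, Matrix.conjTranspose_smul, Matrix.conjTranspose_mul, Matrix.conjTranspose_add, hWh, hP,
      Matrix.conjTranspose_one, add_mul, one_mul, hWP, mul_add, mul_one]
    simp
  have hAA : A * A = A := by
    have h1 : (1 + W) * P = P * (1 + W) := by rw [add_mul, mul_add, hWP, one_mul, mul_one]
    have h2 : (1 + W) * (1 + W) = (2 : ℂ) • (1 + W) := by
      rw [mul_add, add_mul, add_mul, hWW]
      simp only [mul_one, one_mul]
      module
    rw [hA, smul_mul_smul_comm, mul_assoc, ← mul_assoc (1 + W), h1, mul_assoc, h2, ← mul_assoc, hP2,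
      mul_smul_comm, smul_smul]
    norm_num
  have hPW : (P * W).trace = 0 := by
    have h : (P * W).trace = -(P * W).trace := by
      calc (P * W).trace = (Γ * (Γ * (P * W))).trace := by rw [← mul_assoc, hΓ2, one_mul]
        _ = (Γ * (P * W) * Γ).trace := Matrix.trace_mul_comm _ _
        _ = (-(P * W)).trace := by
          rw [← mul_assoc, hΓP, mul_assoc P, hΓW, mul_neg, neg_mul, mul_assoc P, mul_assoc W, hΓ2,
            mul_one]
        _ = -(P * W).trace := Matrix.trace_neg _
    exact self_eq_neg.mp h
  have hAtr : A.trace = 1 := by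
    rw [hA, Matrix.trace_smul, mul_add, mul_one, Matrix.trace_add, hPW, htr]
    simp
  obtain ⟨y, hyy, hAy⟩ := exists_eq_vecMulVec_of_trace_eq_one hAh hAA hAtr
  have hAyy : A *ᵥ y = y := by
    rw [hAy, Matrix.vecMulVec_mulVec, hyy]
    simp
  have hWA : W * A = A := by
    rw [hA, mul_smul_comm, ← mul_assoc, hWP, mul_assoc, mul_add, hWW, mul_one, add_comm]
  have hWy : W *ᵥ y = y := by rw [← hAyy, Matrix.mulVec_mulVec, hWA]
  set y' : κ → ℂ := Γ *ᵥ y with hy'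
  have hΓy' : Γ *ᵥ y' = y := by rw [hy', Matrix.mulVec_mulVec, hΓ2, Matrix.one_mulVec]
  have hΓ'y : Γ' *ᵥ y = Complex.I • y' := by
    rw [hΓ'eq, Matrix.smul_mulVec, ← Matrix.mulVec_mulVec, hWy]
  have hΓ'y' : Γ' *ᵥ y' = -Complex.I • y := by
    rw [hy', Matrix.mulVec_mulVec, show Γ' * Γ = -(Γ * Γ') by rw [hanti, neg_neg],
      Matrix.neg_mulVec, ← Matrix.mulVec_mulVec, hΓ'y, Matrix.mulVec_smul, hΓy', neg_smul]
  have hstar : ∀ (M : Matrix κ κ ℂ) (v w : κ → ℂ), Mᴴ = M → star (M *ᵥ v) ⬝ᵥ w = star v ⬝ᵥ (M *ᵥ w) := by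
    intro M v w hM
    rw [Matrix.star_mulVec, hM, Matrix.dotProduct_mulVec]
  have hyy' : star y ⬝ᵥ y' = 0 := by
    have h : star y ⬝ᵥ y' = -(star y ⬝ᵥ y') := by
      conv_lhs => rw [← hWy, hstar W _ _ hWh, hy', Matrix.mulVec_mulVec,
        show W * Γ = -(Γ * W) by rw [hΓW, neg_neg], Matrix.neg_mulVec, ← Matrix.mulVec_mulVec, hWy,
        dotProduct_neg]
    exact self_eq_neg.mp h
  have hy'y : star y' ⬝ᵥ y = 0 := by rw [hy', hstar Γ _ _ hΓ, ← hy', hyy']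
  have hy'y' : star y' ⬝ᵥ y' = 1 := by rw [hy', hstar Γ _ _ hΓ, ← hy', hΓy', hyy]
  refine ⟨Matrix.of fun x b => ![y x, y' x] b, ?_, ?_, ?_, ?_⟩
  · ext i j
    rw [Matrix.mul_apply]
    fin_cases i <;> fin_cases j
    · simpa [dotProduct] using hyy
    · simpa [dotProduct] using hyy'
    · simpa [dotProduct] using hy'y
    · simpa [dotProduct] using hy'y'
  · have h1 : P = A + Γ * A * Γ := by
      have h2 : Γ * A * Γ = (1 / 2 : ℂ) • (P * (1 - W)) := by
        rw [hA, mul_smul_comm, smul_mul_assoc, ← mul_assoc, hΓP, mul_assoc P, mul_assoc P, mul_add,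
          add_mul, mul_one, hΓ2, hΓW, neg_mul, mul_assoc W, hΓ2, mul_one, ← sub_eq_add_neg]
      rw [h2, hA, mul_add, mul_sub, mul_one]
      module
    have h3 : Γ * A * Γ = vecMulVec y' (star y') := by
      rw [hAy, Matrix.mul_vecMulVec, Matrix.vecMulVec_mul, hy', Matrix.star_mulVec, hΓ]
    rw [h1, h3, hAy]
    ext i j
    simp [Matrix.mul_apply, Fin.sum_univ_two, vecMulVec_apply]
  · ext x b
    rw [Matrix.mul_apply, Matrix.mul_apply, Fin.sum_univ_two]
    fin_cases b
    · simpa [pauliX, Matrix.mulVec, dotProduct] using congrFun hy'.symm x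
    · simpa [pauliX, Matrix.mulVec, dotProduct] using congrFun hΓy' x
  · ext x b
    rw [Matrix.mul_apply, Matrix.mul_apply, Fin.sum_univ_two]
    fin_cases b
    · simpa [pauliY, Matrix.mulVec, dotProduct, mul_comm] using congrFun hΓ'y x
    · simpa [pauliY, Matrix.mulVec, dotProduct, mul_comm] using congrFun hΓ'y' x

/-- Since B commutes with H, the columns of B φ still have energy E. The gap inequality then forces
their component outside the range of φ to have zero Hilbert–Schmidt norm. -/
theorem ground_invariant {τ : Type*} [Fintype τ] {φ : Matrix κ τ ℂ} {H B : Matrix κ κ ℂ} {E g : ℝ}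
    (hg : 0 < g) [DecidableEq τ] (hφ : φᴴ * φ = 1) (hH : H * φ = (E : ℂ) • φ)
    (hgap : (g : ℂ) • (1 - φ * φᴴ) ≤ H - (E : ℂ) • 1) (hB : B * H = H * B) :
    B * φ = φ * (φᴴ * B * φ) := by
  set P := φ * φᴴ with hP
  have hPh : Pᴴ = P := by rw [hP, Matrix.conjTranspose_mul, Matrix.conjTranspose_conjTranspose]
  have hPP : P * P = P := by rw [hP, Matrix.mul_assoc, ← Matrix.mul_assoc φᴴ, hφ, Matrix.one_mul]
  set R := (1 - P) * (B * φ) with hR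
  have h1 : (H - (E : ℂ) • 1) * (B * φ) = 0 := by
    rw [Matrix.sub_mul, ← Matrix.mul_assoc, ← hB, Matrix.mul_assoc, hH]
    simp
  have h2 := (Matrix.le_iff.mp hgap).conjTranspose_mul_mul_same (B * φ)
  rw [Matrix.mul_assoc, Matrix.sub_mul _ _ (B * φ), h1, zero_sub, Matrix.mul_neg,
    Matrix.smul_mul, Matrix.mul_smul] at h2
  have h3 : (B * φ)ᴴ * ((1 - P) * (B * φ)) = Rᴴ * R := by
    rw [hR, Matrix.conjTranspose_mul (1 - P), Matrix.conjTranspose_sub, hPh,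
      Matrix.conjTranspose_one, Matrix.mul_assoc, ← Matrix.mul_assoc (1 - P) (1 - P)]
    congr 2
    simp only [mul_sub, sub_mul, hPP, mul_one, one_mul]
    abel
  rw [h3] at h2
  have h4 := h2.trace_nonneg
  rw [Matrix.trace_neg, Matrix.trace_smul, smul_eq_mul] at h4
  have h5 := (Matrix.posSemidef_conjTranspose_mul_self R).trace_nonneg
  have h6 : (Rᴴ * R).trace = 0 := by
    obtain ⟨r, hr0, hr⟩ := exists_real_of_nonneg h5
    rw [← hr, ← Complex.ofReal_mul, ← Complex.ofReal_neg, Complex.zero_le_real] at h4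
    have : r = 0 := by nlinarith
    rw [← hr, this, Complex.ofReal_zero]
  have h7 := Matrix.trace_conjTranspose_mul_self_eq_zero_iff.mp h6
  rw [hR, Matrix.sub_mul, Matrix.one_mul, sub_eq_zero] at h7
  rw [h7, hP]
  simp only [Matrix.mul_assoc]

end Encoding

/-! ### A Schur-type criterion on one qubit -/

section Scalar

/-- The commutant of X is spanned by 1 and X, and commuting with an involution that anticommutes
with X removes the X component. -/
theorem eq_smul_one_of_commute_pauliX {A w : Matrix (Fin 2) (Fin 2) ℂ}
    (h : A * pauliX = pauliX * A) (hw : w * w = 1) (hwX : w * pauliX = -(pauliX * w))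
    (hwA : A * w = w * A) : ∃ c : ℂ, A = c • 1 := by
  have h00 := congrFun (congrFun h 0) 0
  have h01 := congrFun (congrFun h 0) 1
  have hA : A = A 0 0 • 1 + A 0 1 • pauliX := by
    simp [pauliX, Matrix.mul_apply, Fin.sum_univ_two] at h00 h01
    ext i j; fin_cases i <;> fin_cases j <;> simp [pauliX, h00, h01]
  have h1 : (A 0 1) • (pauliX * w) = 0 := by
    rw [hA, add_mul, mul_add] at hwA
    simp only [smul_mul_assoc, mul_smul_comm, one_mul, mul_one, hwX] at hwA
    have h2 := add_left_cancel hwA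
    rw [smul_neg] at h2
    exact matrix_eq_zero_of_eq_neg h2
  have h3 : A 0 1 = 0 := by
    have h4 := congrArg (fun M => pauliX * M * w) h1
    simp only [mul_smul_comm, smul_mul_assoc, mul_zero, zero_mul] at h4
    rw [← mul_assoc, pauliX_mul_self, one_mul, hw] at h4
    simpa using congrFun (congrFun h4 0) 0
  exact ⟨A 0 0, by rw [h3, zero_smul, add_zero] at hA; exact hA⟩

theorem eq_smul_one_of_commute_pauliY {A w : Matrix (Fin 2) (Fin 2) ℂ}
    (h : A * pauliY = pauliY * A) (hw : w * w = 1) (hwY : w * pauliY = -(pauliY * w))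
    (hwA : A * w = w * A) : ∃ c : ℂ, A = c • 1 := by
  have h00 := congrFun (congrFun h 0) 0
  have h01 := congrFun (congrFun h 0) 1
  have hA : A = A 0 0 • 1 + (Complex.I * A 0 1) • pauliY := by
    simp [pauliY, Matrix.mul_apply, Fin.sum_univ_two] at h00 h01
    ext i j; fin_cases i <;> fin_cases j
    · simp [pauliY]
    · simp [pauliY]; linear_combination A 0 1 * Complex.I_mul_I
    · simp [pauliY]; linear_combination (-Complex.I) * h00 + A 1 0 * Complex.I_mul_I
    · simp [pauliY]; linear_combination (Complex.I) * h01 + (A 1 1 - A 0 0) * Complex.I_mul_I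
  have h1 : (Complex.I * A 0 1) • (pauliY * w) = 0 := by
    rw [hA, add_mul, mul_add] at hwA
    simp only [smul_mul_assoc, mul_smul_comm, one_mul, mul_one, hwY] at hwA
    have h2 := add_left_cancel hwA
    rw [smul_neg] at h2
    exact matrix_eq_zero_of_eq_neg h2
  have h3 : Complex.I * A 0 1 = 0 := by
    have h4 := congrArg (fun M => pauliY * M * w) h1
    simp only [mul_smul_comm, smul_mul_assoc, mul_zero, zero_mul] at h4
    rw [← mul_assoc, pauliY_mul_self, one_mul, hw] at h4
    simpa using congrFun (congrFun h4 0) 0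
  exact ⟨A 0 0, by rw [h3, zero_smul, add_zero] at hA; exact hA⟩

end Scalar

/-! ### Jordan–Wigner Majorana operators with Y strings -/

section Majorana

/-- The Pauli matrix `X` or `Z`. -/
def pauliXZ (c : Bool) : Matrix (Fin 2) (Fin 2) ℂ := if c then pauliX else pauliZ

theorem pauliXZ_mul_self (c : Bool) : pauliXZ c * pauliXZ c = 1 := by
  cases c <;> simp [pauliXZ, pauliX_mul_self, pauliZ_mul_self]

theorem pauliXZ_conjTranspose (c : Bool) : (pauliXZ c)ᴴ = pauliXZ c := by
  cases c <;> simp [pauliXZ, pauliX_conjTranspose, pauliZ_conjTranspose]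

theorem pauliXZ_mul_pauliY (c : Bool) : pauliXZ c * pauliY = -(pauliY * pauliXZ c) := by
  cases c <;> simp [pauliXZ, pauliX_mul_pauliY, pauliY_mul_pauliX, pauliZ_mul_pauliY,
    pauliY_mul_pauliZ]

theorem pauliXZ_anticomm {c c' : Bool} (h : c ≠ c') :
    pauliXZ c * pauliXZ c' = -(pauliXZ c' * pauliXZ c) := by
  cases c <;> cases c' <;> simp_all [pauliXZ, pauliX_mul_pauliZ]

/-- The Jordan–Wigner Majorana operators of a chain of `k` qubits. -/
def majorana (k : ℕ) (c : Bool) (i : ℕ) : Matrix (Fin k → Fin 2) (Fin k → Fin 2) ℂ :=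
  piTensor fun j => if (j : ℕ) < i then pauliY else if (j : ℕ) = i then pauliXZ c else 1

variable {k : ℕ}

theorem majorana_conjTranspose (c : Bool) (i : ℕ) : (majorana k c i)ᴴ = majorana k c i := by
  rw [majorana, piTensor_conjTranspose]
  congr 1
  funext j
  split_ifs <;> simp [pauliY_conjTranspose, pauliXZ_conjTranspose]

theorem majorana_mul_self (c : Bool) (i : ℕ) : majorana k c i * majorana k c i = 1 := by
  rw [majorana, piTensor_mul, ← piTensor_one]
  congr 1
  funext j
  split_ifs <;> simp [pauliY_mul_self, pauliXZ_mul_self]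

theorem prod_neg_one_at {i : ℕ} (hi : i < k) :
    ∏ j : Fin k, (if (j : ℕ) = i then (-1 : ℂ) else 1) = -1 := by
  rw [Finset.prod_eq_single (⟨i, hi⟩ : Fin k)]
  · simp
  · intro b _ hb
    rw [if_neg]
    exact fun h => hb (Fin.ext h)
  · simp

/-- The local factors commute at every site except `min i j`, where they anticommute: there the head
of one operator meets the string, or the other head, of the second. -/
theorem majorana_anticomm {c c' : Bool} {i j : ℕ} (hi : i < k) (hj : j < k)
    (h : c ≠ c' ∨ i ≠ j) :
    majorana k c i * majorana k c' j = -(majorana k c' j * majorana k c i) := by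
  rw [majorana, majorana, piTensor_mul_eq_smul
    (c := fun l : Fin k => if (l : ℕ) = min i j then (-1 : ℂ) else 1),
    prod_neg_one_at (lt_of_le_of_lt (min_le_left i j) hi), neg_one_smul]
  intro l
  rcases lt_trichotomy i j with hij | rfl | hij
  · rw [min_eq_left hij.le]
    rcases lt_trichotomy (l : ℕ) i with hl | hl | hl
    · simp [hl, hl.trans hij, hl.ne]
    · simp [hl, hij, pauliXZ_mul_pauliY]
    · simp [hl.not_gt, hl.ne']
  · rw [min_self]
    have hc : c ≠ c' := by simpa using h
    rcases lt_trichotomy (l : ℕ) i with hl | hl | hl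
    · simp [hl, hl.ne]
    · simp [hl, pauliXZ_anticomm hc]
    · simp [hl.not_gt, hl.ne']
  · rw [min_eq_right hij.le]
    rcases lt_trichotomy (l : ℕ) j with hl | hl | hl
    · simp [hl, hl.trans hij, hl.ne]
    · simp [hl, hij, pauliXZ_mul_pauliY]
    · simp [hl.not_gt, hl.ne']

theorem majorana_anticommutator {c c' : Bool} {i j : ℕ} (hi : i < k) (hj : j < k) :
    majorana k c i * majorana k c' j + majorana k c' j * majorana k c i =
      ((if c = c' ∧ i = j then 2 else 0 : ℝ) : ℂ) • 1 := by
  split_ifs with h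
  · obtain ⟨rfl, rfl⟩ := h
    rw [majorana_mul_self, ← two_smul ℂ]
    simp
  · rw [majorana_anticomm hi hj (by tauto)]
    simp

/-- The fermion parity operator. -/
def parity (k : ℕ) : Matrix (Fin k → Fin 2) (Fin k → Fin 2) ℂ := piTensor fun _ => pauliY

theorem parity_mul_self : parity k * parity k = 1 := by
  rw [parity, piTensor_mul, ← piTensor_one]
  simp only [pauliY_mul_self]

theorem parity_mul_majorana {c : Bool} {i : ℕ} (hi : i < k) :
    parity k * majorana k c i = -(majorana k c i * parity k) := by
  rw [majorana, parity, piTensor_mul_eq_smul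
    (c := fun l : Fin k => if (l : ℕ) = i then (-1 : ℂ) else 1), prod_neg_one_at hi, neg_one_smul]
  intro l
  rcases lt_trichotomy (l : ℕ) i with hl | hl | hl
  · simp [hl, hl.ne]
  · simp [hl, pauliXZ_mul_pauliY]
  · simp [hl.not_gt, hl.ne']

theorem majorana_zero (c : Bool) (h : 0 < k) : majorana k c 0 = site ⟨0, h⟩ (pauliXZ c) := by
  rw [majorana, site]
  congr 1
  funext j
  rcases eq_or_ne j ⟨0, h⟩ with rfl | hj
  · simp
  · rw [Function.update_of_ne hj, if_neg (by simp), if_neg (fun h' => hj (Fin.ext h'))]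

/-- The Y strings cancel below site i, and at site i the leftover string of the second factor gives
ZY = -iX. For ZZ the corresponding product is XY = iZ, whence the opposite sign. -/
theorem site_pauliX_mul_site_pauliX {i : ℕ} (h : i + 1 < k) :
    site ⟨i, by omega⟩ pauliX * site ⟨i + 1, h⟩ pauliX =
      Complex.I • (majorana k false i * majorana k true (i + 1)) := by
  have h1 : majorana k false i * majorana k true (i + 1) =
      (∏ j : Fin k, if j = ⟨i, by omega⟩ then -Complex.I else 1) •
        (site ⟨i, by omega⟩ pauliX * site ⟨i + 1, h⟩ pauliX) := by
    rw [site_mul_site (by simp), majorana, majorana, piTensor_mul, ← piTensor_smul]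
    congr 1
    funext j
    rcases lt_trichotomy (j : ℕ) i with hl | hl | hl
    · have h2 : j ≠ ⟨i, by omega⟩ := fun h => by simp [h] at hl
      have h3 : j ≠ ⟨i + 1, h⟩ := fun h => by simp [h] at hl
      simp [hl, h2, h3, hl.trans, pauliY_mul_self]
    · subst hl
      have h2 : j ≠ ⟨j + 1, h⟩ := fun h' => by simpa using congrArg Fin.val h'
      simp [pauliXZ, pauliZ_mul_pauliY, Function.update_of_ne h2]
    · have h2 : j ≠ ⟨i, by omega⟩ := fun h => by simp [h] at hl
      rcases eq_or_ne j ⟨i + 1, h⟩ with rfl | h3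
      · simp [pauliXZ]
      · have h4 : (j : ℕ) ≠ i + 1 := fun h => h3 (Fin.ext h)
        simp [h2, h3, h4, hl.not_gt, hl.ne', show ¬ (j : ℕ) < i + 1 by omega]
  rw [h1, Finset.prod_ite_eq', if_pos (Finset.mem_univ _), smul_smul]
  simp

theorem site_pauliZ_mul_site_pauliZ {i : ℕ} (h : i + 1 < k) :
    site ⟨i, by omega⟩ pauliZ * site ⟨i + 1, h⟩ pauliZ =
      -(Complex.I • (majorana k true i * majorana k false (i + 1))) := by
  have h1 : majorana k true i * majorana k false (i + 1) =
      (∏ j : Fin k, if j = ⟨i, by omega⟩ then Complex.I else 1) •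
        (site ⟨i, by omega⟩ pauliZ * site ⟨i + 1, h⟩ pauliZ) := by
    rw [site_mul_site (by simp), majorana, majorana, piTensor_mul, ← piTensor_smul]
    congr 1
    funext j
    rcases lt_trichotomy (j : ℕ) i with hl | hl | hl
    · have h2 : j ≠ ⟨i, by omega⟩ := fun h => by simp [h] at hl
      have h3 : j ≠ ⟨i + 1, h⟩ := fun h => by simp [h] at hl
      simp [hl, h2, h3, hl.trans, pauliY_mul_self]
    · subst hl
      have h2 : j ≠ ⟨j + 1, h⟩ := fun h' => by simpa using congrArg Fin.val h'
      simp [pauliXZ, pauliX_mul_pauliY, Function.update_of_ne h2]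
    · have h2 : j ≠ ⟨i, by omega⟩ := fun h => by simp [h] at hl
      rcases eq_or_ne j ⟨i + 1, h⟩ with rfl | h3
      · simp [pauliXZ]
      · have h4 : (j : ℕ) ≠ i + 1 := fun h => h3 (Fin.ext h)
        simp [h2, h3, h4, hl.not_gt, hl.ne', show ¬ (j : ℕ) < i + 1 by omega]
  rw [h1, Finset.prod_ite_eq', if_pos (Finset.mem_univ _), smul_smul]
  simp

end Majorana

/-! ### The chain as two Majorana hopping families, and the bound behind its gap -/

section Chain

/-- The Hamiltonian `∑ (a X X - Z Z)` of an open chain with `2 d` bonds. -/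
def chainHamiltonian (a : ℝ) (d : ℕ) :
    Matrix (Fin (d * 2 + 1) → Fin 2) (Fin (d * 2 + 1) → Fin 2) ℂ :=
  ∑ i : Fin (d * 2), ((a : ℂ) • (site i.castSucc pauliX * site i.succ pauliX) -
    site i.castSucc pauliZ * site i.succ pauliZ)

/-- Coefficients of the two Majorana chains: the left neighbours. -/
def leftCoeff (a : ℝ) (c : Bool) : ℝ := if c then 1 else a

/-- Coefficients of the two Majorana chains: the right neighbours. -/
def rightCoeff (a : ℝ) (c : Bool) : ℝ := if c then a else 1

/-- The combination of even Majorana operators coupled to the odd one. -/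
def chainG (a : ℝ) (d : ℕ) (j : Bool × Fin d) :
    Matrix (Fin (d * 2 + 1) → Fin 2) (Fin (d * 2 + 1) → Fin 2) ℂ :=
  (leftCoeff a j.1 : ℂ) • majorana _ j.1 (2 * j.2) -
    (rightCoeff a j.1 : ℂ) • majorana _ j.1 (2 * (j.2 + 1))

/-- The odd Majorana operators. -/
def chainQ (d : ℕ) (j : Bool × Fin d) :
    Matrix (Fin (d * 2 + 1) → Fin 2) (Fin (d * 2 + 1) → Fin 2) ℂ :=
  majorana _ (!j.1) (2 * j.2 + 1)

/-- Bonds are grouped in pairs 2l, 2l + 1 around the odd site 2l + 1. Each odd Majorana couples only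
to the even ones of the opposite Pauli type on its two sides; the minus sign in `chainG` comes from
reordering the right-hand bond. -/
theorem chainHamiltonian_eq (a : ℝ) (d : ℕ) :
    chainHamiltonian a d = ∑ j, Complex.I • (chainG a d j * chainQ d j) := by
  have h1 : ∀ i : Fin (d * 2), (a : ℂ) • (site i.castSucc pauliX * site i.succ pauliX) -
      site i.castSucc pauliZ * site i.succ pauliZ =
      (a * Complex.I) • (majorana (d * 2 + 1) false i * majorana _ true (i + 1)) +
        Complex.I • (majorana (d * 2 + 1) true i * majorana _ false (i + 1)) := by
    intro i
    have hx := site_pauliX_mul_site_pauliX (k := d * 2 + 1) (i := i) (by omega)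
    have hz := site_pauliZ_mul_site_pauliZ (k := d * 2 + 1) (i := i) (by omega)
    change site i.castSucc pauliX * site i.succ pauliX = _ at hx
    change site i.castSucc pauliZ * site i.succ pauliZ = _ at hz
    rw [hx, hz, smul_smul, sub_neg_eq_add]
  rw [chainHamiltonian]
  simp only [h1]
  rw [← finProdFinEquiv.sum_comp, Fintype.sum_prod_type, Fintype.sum_prod_type, Fintype.sum_bool,
    ← Finset.sum_add_distrib]
  refine Finset.sum_congr rfl fun l _ => ?_
  rw [Fin.sum_univ_two]
  have hl : 2 * (l : ℕ) + 1 + 1 = 2 * ((l : ℕ) + 1) := by ring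
  have h2 : majorana (d * 2 + 1) true (2 * (l + 1)) * majorana _ false (2 * l + 1) =
      -(majorana _ false (2 * l + 1) * majorana _ true (2 * (l + 1))) :=
    majorana_anticomm (by omega) (by omega) (by simp)
  have h3 : majorana (d * 2 + 1) false (2 * (l + 1)) * majorana _ true (2 * l + 1) =
      -(majorana _ true (2 * l + 1) * majorana _ false (2 * (l + 1))) :=
    majorana_anticomm (by omega) (by omega) (by simp)
  simp only [finProdFinEquiv_apply_val, chainG, chainQ, leftCoeff, rightCoeff, Fin.val_zero,
    Fin.val_one, zero_add, add_comm 1 (2 * (l : ℕ)), hl, sub_mul, smul_mul_assoc, h2, h3,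
    Bool.not_true, Bool.not_false, if_true, Bool.false_eq_true, if_false, Complex.ofReal_one,
    one_smul]
  module

variable {a : ℝ} {d : ℕ}

theorem chainQ_anticomm_even (c c' : Bool) (i : ℕ) (hi : i ≤ d) (l : Fin d) :
    majorana _ c' (2 * i) * chainQ d (c, l) = -(chainQ d (c, l) * majorana _ c' (2 * i)) :=
  majorana_anticomm (by omega) (by omega) (by right; omega)

theorem chainG_mul_chainQ (i j : Bool × Fin d) :
    chainG a d i * chainQ d j = -(chainQ d j * chainG a d i) := by
  rw [chainG, sub_mul, mul_sub, smul_mul_assoc, smul_mul_assoc, mul_smul_comm, mul_smul_comm,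
    chainQ_anticomm_even j.1 i.1 i.2 (by omega) j.2,
    chainQ_anticomm_even j.1 i.1 (i.2 + 1) (by omega) j.2]
  module

theorem chainG_conjTranspose (j : Bool × Fin d) : (chainG a d j)ᴴ = chainG a d j := by
  simp [chainG, Matrix.conjTranspose_smul, majorana_conjTranspose]

theorem chainQ_conjTranspose (j : Bool × Fin d) : (chainQ d j)ᴴ = chainQ d j :=
  majorana_conjTranspose _ _

theorem chainQ_anticommutator (i j : Bool × Fin d) :
    chainQ d i * chainQ d j + chainQ d j * chainQ d i =
      ((if i = j then 2 else 0 : ℝ) : ℂ) • 1 := by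
  rw [chainQ, chainQ, majorana_anticommutator (by omega) (by omega)]
  congr 2
  refine if_congr ?_ rfl rfl
  rw [Prod.ext_iff, Fin.ext_iff]
  simp

/-- The adjacency matrix of the two directed Majorana chains. -/
def chainStep (d : ℕ) (i j : Bool × Fin d) : ℝ :=
  if i.1 = j.1 ∧ (i.2 : ℕ) = j.2 + 1 then 1 else 0

/-- Half the anticommutators of the operators `chainG`. -/
def chainN (a : ℝ) (d : ℕ) : Matrix (Bool × Fin d) (Bool × Fin d) ℝ :=
  Matrix.of fun i j => (1 + a ^ 2) * (if i = j then 1 else 0) - a * chainStep d i j -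
    a * chainStep d j i

theorem leftCoeff_mul_rightCoeff (a : ℝ) (c : Bool) : leftCoeff a c * rightCoeff a c = a := by
  cases c <;> simp [leftCoeff, rightCoeff]

theorem leftCoeff_sq_add (a : ℝ) (c : Bool) : leftCoeff a c ^ 2 + rightCoeff a c ^ 2 = 1 + a ^ 2 := by
  cases c <;> simp [leftCoeff, rightCoeff, add_comm]

theorem chainG_anticommutator (i j : Bool × Fin d) :
    chainG a d i * chainG a d j + chainG a d j * chainG a d i =
      ((2 * chainN a d i j : ℝ) : ℂ) • 1 := by
  obtain ⟨c, l⟩ := i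
  obtain ⟨c', l'⟩ := j
  have h1 := majorana_anticommutator (k := d * 2 + 1) (c := c) (c' := c') (i := 2 * l)
    (j := 2 * l') (by omega) (by omega)
  have h2 := majorana_anticommutator (k := d * 2 + 1) (c := c) (c' := c') (i := 2 * l)
    (j := 2 * (l' + 1)) (by omega) (by omega)
  have h3 := majorana_anticommutator (k := d * 2 + 1) (c := c) (c' := c') (i := 2 * (l + 1))
    (j := 2 * l') (by omega) (by omega)
  have h4 := majorana_anticommutator (k := d * 2 + 1) (c := c) (c' := c') (i := 2 * (l + 1))
    (j := 2 * (l' + 1)) (by omega) (by omega)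
  have h5 : chainG a d (c, l) * chainG a d (c', l') + chainG a d (c', l') * chainG a d (c, l) =
      ((leftCoeff a c * leftCoeff a c' : ℝ) : ℂ) • (((if c = c' ∧ 2 * (l : ℕ) = 2 * l' then 2 else 0 : ℝ) : ℂ) • 1)
      - ((leftCoeff a c * rightCoeff a c' : ℝ) : ℂ) •
        (((if c = c' ∧ 2 * (l : ℕ) = 2 * (l' + 1) then 2 else 0 : ℝ) : ℂ) • 1)
      - ((rightCoeff a c * leftCoeff a c' : ℝ) : ℂ) •
        (((if c = c' ∧ 2 * ((l : ℕ) + 1) = 2 * l' then 2 else 0 : ℝ) : ℂ) • 1)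
      + ((rightCoeff a c * rightCoeff a c' : ℝ) : ℂ) •
        (((if c = c' ∧ 2 * ((l : ℕ) + 1) = 2 * (l' + 1) then 2 else 0 : ℝ) : ℂ) • 1) := by
    rw [← h1, ← h2, ← h3, ← h4, chainG, chainG]
    simp only [sub_mul, mul_sub, smul_mul_assoc, mul_smul_comm]
    push_cast
    module
  rw [h5, smul_smul, smul_smul, smul_smul, smul_smul, ← sub_smul, ← sub_smul, ← add_smul]
  simp only [← Complex.ofReal_mul, ← Complex.ofReal_sub, ← Complex.ofReal_add]
  congr 2
  simp only [chainN, chainStep, Matrix.of_apply, Prod.mk.injEq, Fin.ext_iff]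
  rcases eq_or_ne c c' with rfl | hc
  · have e1 := leftCoeff_mul_rightCoeff a c
    have e2 := leftCoeff_sq_add a c
    simp only [true_and, show (2 * (l : ℕ) = 2 * l') ↔ (l : ℕ) = l' by omega,
      show (2 * (l : ℕ) = 2 * (l' + 1)) ↔ (l : ℕ) = l' + 1 by omega,
      show (2 * ((l : ℕ) + 1) = 2 * l') ↔ (l' : ℕ) = l + 1 by omega,
      show (2 * ((l : ℕ) + 1) = 2 * (l' + 1)) ↔ (l : ℕ) = l' by omega]
    have h2 : ∀ (p : Prop) [Decidable p], (if p then (2 : ℝ) else 0) = 2 * if p then 1 else 0 := by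
      intro p _
      split_ifs <;> norm_num
    simp only [h2]
    linear_combination (2 * if (l : ℕ) = l' then (1 : ℝ) else 0) * e2 -
      2 * ((if (l : ℕ) = l' + 1 then (1 : ℝ) else 0) + if (l' : ℕ) = l + 1 then 1 else 0) * e1
  · simp [hc, hc.symm]

theorem chainN_isHermitian : (chainN a d).IsHermitian := by
  ext i j
  simp only [Matrix.conjTranspose_apply, chainN, Matrix.of_apply, star_trivial, eq_comm (a := j)]
  ring

/-- Schur's test: 2 x y ≤ x² + y² on each entry, followed by the row and column sum bounds. -/
theorem sum_mul_mul_le {J : Type*} [Fintype J] (e : J → J → ℝ) (he : ∀ i j, 0 ≤ e i j)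
    (h1 : ∀ i, ∑ j, e i j ≤ 1) (h2 : ∀ j, ∑ i, e i j ≤ 1) (x : J → ℝ) :
    ∑ i, ∑ j, x i * e i j * x j ≤ ∑ i, x i ^ 2 := by
  have h3 : ∑ i, ∑ j, x i * e i j * x j ≤
      ∑ i, ∑ j, ((1 / 2) * x i ^ 2 * e i j + (1 / 2) * x j ^ 2 * e i j) :=
    Finset.sum_le_sum fun i _ => Finset.sum_le_sum fun j _ => by
      nlinarith [mul_nonneg (he i j) (sq_nonneg (x i - x j))]
  refine h3.trans ?_
  simp only [Finset.sum_add_distrib]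
  rw [Finset.sum_comm (f := fun i j => (1 / 2) * x j ^ 2 * e i j)]
  simp only [← Finset.mul_sum]
  have h4 : ∑ i, (1 / 2) * x i ^ 2 * ∑ j, e i j ≤ ∑ i, (1 / 2) * x i ^ 2 :=
    Finset.sum_le_sum fun i _ => mul_le_of_le_one_right (by positivity) (h1 i)
  have h5 : ∑ j, (1 / 2) * x j ^ 2 * ∑ i, e i j ≤ ∑ i, (1 / 2) * x i ^ 2 :=
    Finset.sum_le_sum fun i _ => mul_le_of_le_one_right (by positivity) (h2 i)
  rw [← Finset.mul_sum] at h4 h5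
  linarith

theorem chainStep_sum_le (x : Bool × Fin d → ℝ) :
    ∑ i, ∑ j, x i * chainStep d i j * x j ≤ ∑ i, x i ^ 2 := by
  refine sum_mul_mul_le _ (fun i j => ?_) (fun i => ?_) (fun j => ?_) x
  · rw [chainStep]; split_ifs <;> norm_num
  · simp only [chainStep]
    rw [Finset.sum_boole]
    norm_cast
    refine Finset.card_le_one.mpr fun u hu v hv => ?_
    simp only [Finset.mem_filter, Finset.mem_univ, true_and] at hu hv
    exact Prod.ext (hu.1.symm.trans hv.1) (Fin.ext (by omega))
  · simp only [chainStep]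
    rw [Finset.sum_boole]
    norm_cast
    refine Finset.card_le_one.mpr fun u hu v hv => ?_
    simp only [Finset.mem_filter, Finset.mem_univ, true_and] at hu hv
    exact Prod.ext (hu.1.trans hv.1.symm) (Fin.ext (by omega))

/-- Each of the two shift terms costs at most a ∑ x², which leaves 1 + a² - 2a. -/
theorem chainN_lower_bound (ha : 0 ≤ a) (x : Bool × Fin d → ℝ) :
    (a - 1) ^ 2 * ∑ i, x i ^ 2 ≤ ∑ i, ∑ j, x i * chainN a d i j * x j := by
  have h1 : ∑ i, ∑ j, x i * chainN a d i j * x j =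
      (1 + a ^ 2) * ∑ i, x i ^ 2 - a * (∑ i, ∑ j, x i * chainStep d i j * x j) -
        a * ∑ i, ∑ j, x i * chainStep d j i * x j := by
    simp only [Finset.mul_sum, ← Finset.sum_sub_distrib]
    refine Finset.sum_congr rfl fun i _ => ?_
    have h : (1 + a ^ 2) * x i ^ 2 = ∑ j, x i * ((1 + a ^ 2) * if i = j then 1 else 0) * x j := by
      simp
      ring
    rw [h, ← Finset.sum_sub_distrib, ← Finset.sum_sub_distrib]
    refine Finset.sum_congr rfl fun j _ => ?_
    simp only [chainN, Matrix.of_apply]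
    ring
  have h2 : ∑ i, ∑ j, x i * chainStep d j i * x j = ∑ i, ∑ j, x i * chainStep d i j * x j := by
    rw [Finset.sum_comm]
    exact Finset.sum_congr rfl fun i _ => Finset.sum_congr rfl fun j _ => by ring
  have h3 := chainStep_sum_le x
  rw [h1, h2]
  nlinarith [mul_le_mul_of_nonneg_left h3 ha]

end Chain

/-! ### The two unpaired Majorana zero modes -/

section ZeroMode

/-- The ratio of consecutive coefficients of a zero mode. -/
def decay (a : ℝ) (c : Bool) : ℝ := leftCoeff a c / rightCoeff a c

/-- The amplitude of a zero mode at the first qubit. -/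
def edgeAmp (a : ℝ) (d : ℕ) (c : Bool) : ℝ :=
  (Real.sqrt (∑ l : Fin (d + 1), (decay a c ^ (l : ℕ)) ^ 2))⁻¹

/-- The normalized Majorana zero modes of the chain. -/
def zeroMode (a : ℝ) (d : ℕ) (c : Bool) :
    Matrix (Fin (d * 2 + 1) → Fin 2) (Fin (d * 2 + 1) → Fin 2) ℂ :=
  ∑ l : Fin (d + 1), ((edgeAmp a d c * decay a c ^ (l : ℕ) : ℝ) : ℂ) • majorana _ c (2 * l)

variable {a : ℝ} {d : ℕ}

theorem rightCoeff_pos (ha : 1 < a) (c : Bool) : 0 < rightCoeff a c := by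
  cases c <;> simp [rightCoeff]; linarith

theorem edgeAmp_normSq_pos (a : ℝ) (d : ℕ) (c : Bool) :
    0 < ∑ l : Fin (d + 1), (decay a c ^ (l : ℕ)) ^ 2 :=
  Finset.sum_pos' (fun _ _ => sq_nonneg _) ⟨0, Finset.mem_univ _, by simp⟩

theorem edgeAmp_pos (a : ℝ) (d : ℕ) (c : Bool) : 0 < edgeAmp a d c :=
  inv_pos.mpr (Real.sqrt_pos.mpr (edgeAmp_normSq_pos a d c))

theorem edgeAmp_sq (a : ℝ) (d : ℕ) (c : Bool) :
    edgeAmp a d c ^ 2 = (∑ l : Fin (d + 1), (decay a c ^ (l : ℕ)) ^ 2)⁻¹ := by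
  rw [edgeAmp, inv_pow, Real.sq_sqrt (edgeAmp_normSq_pos a d c).le]

theorem edgeAmp_sq_mul_sum (a : ℝ) (d : ℕ) (c : Bool) :
    edgeAmp a d c ^ 2 * ∑ l : Fin (d + 1), (decay a c ^ (l : ℕ)) ^ 2 = 1 := by
  rw [edgeAmp_sq, inv_mul_cancel₀ (edgeAmp_normSq_pos a d c).ne']

theorem zeroMode_conjTranspose (c : Bool) : (zeroMode a d c)ᴴ = zeroMode a d c := by
  simp only [zeroMode, Matrix.conjTranspose_sum, Matrix.conjTranspose_smul, majorana_conjTranspose,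
    Complex.star_def, Complex.conj_ofReal]

theorem zeroMode_anticommutator_even (c c' : Bool) {i : ℕ} (hi : i ≤ d) :
    zeroMode a d c * majorana _ c' (2 * i) + majorana _ c' (2 * i) * zeroMode a d c =
      ((if c = c' then 2 * (edgeAmp a d c * decay a c ^ i) else 0 : ℝ) : ℂ) • 1 := by
  rw [zeroMode, Finset.sum_mul, Finset.mul_sum, ← Finset.sum_add_distrib]
  have h : ∀ l : Fin (d + 1), ((edgeAmp a d c * decay a c ^ (l : ℕ) : ℝ) : ℂ) •
        majorana (d * 2 + 1) c (2 * l) * majorana _ c' (2 * i) +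
      majorana _ c' (2 * i) * ((edgeAmp a d c * decay a c ^ (l : ℕ) : ℝ) : ℂ) •
        majorana _ c (2 * l) =
      if l = ⟨i, by omega⟩ then
        ((if c = c' then 2 * (edgeAmp a d c * decay a c ^ i) else 0 : ℝ) : ℂ) • 1 else 0 := by
    intro l
    rw [smul_mul_assoc, mul_smul_comm, ← smul_add, majorana_anticommutator (by omega) (by omega),
      smul_smul, ← Complex.ofReal_mul]
    rcases eq_or_ne l ⟨i, by omega⟩ with rfl | hl
    · simp only [and_true, if_true]
      congr 2
      split_ifs <;> ring
    · have hl' : 2 * (l : ℕ) ≠ 2 * i := fun h' => hl (Fin.ext (by simp; omega))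
      simp [hl, hl']
  simp only [h, Finset.sum_ite_eq', Finset.mem_univ, if_true]

theorem zeroMode_mul_majorana_odd (c c' : Bool) {i : ℕ} (hi : i < d) :
    zeroMode a d c * majorana _ c' (2 * i + 1) = -(majorana _ c' (2 * i + 1) * zeroMode a d c) := by
  rw [zeroMode, Finset.sum_mul, Finset.mul_sum, ← Finset.sum_neg_distrib]
  refine Finset.sum_congr rfl fun l _ => ?_
  rw [smul_mul_assoc, mul_smul_comm, majorana_anticomm (by omega) (by omega) (by right; omega),
    smul_neg]

theorem zeroMode_mul_chainQ (c : Bool) (j : Bool × Fin d) :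
    zeroMode a d c * chainQ d j = -(chainQ d j * zeroMode a d c) :=
  zeroMode_mul_majorana_odd _ _ j.2.2

/-- The ratio `decay` is chosen so that left · uₗ = right · uₗ₊₁, making the coefficient vector of
the zero mode orthogonal to that of every `chainG`. -/
theorem zeroMode_mul_chainG (ha : 1 < a) (c : Bool) (j : Bool × Fin d) :
    zeroMode a d c * chainG a d j = -(chainG a d j * zeroMode a d c) := by
  obtain ⟨c', l⟩ := j
  have h1 := zeroMode_anticommutator_even (a := a) (d := d) c c' (i := l) (by omega)
  have h2 := zeroMode_anticommutator_even (a := a) (d := d) c c' (i := l + 1) (by omega)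
  rw [eq_neg_iff_add_eq_zero]
  have h3 : zeroMode a d c * chainG a d (c', l) + chainG a d (c', l) * zeroMode a d c =
      (leftCoeff a c' : ℂ) • (((if c = c' then 2 * (edgeAmp a d c * decay a c ^ (l : ℕ)) else 0 : ℝ)
        : ℂ) • 1) - (rightCoeff a c' : ℂ) •
        (((if c = c' then 2 * (edgeAmp a d c * decay a c ^ ((l : ℕ) + 1)) else 0 : ℝ) : ℂ) • 1) := by
    rw [← h1, ← h2, chainG]
    simp only [sub_mul, mul_sub, smul_mul_assoc, mul_smul_comm]
    module
  rw [h3, smul_smul, smul_smul, ← sub_smul, ← Complex.ofReal_mul, ← Complex.ofReal_mul,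
    ← Complex.ofReal_sub]
  split_ifs with h
  · subst h
    have h4 : rightCoeff a c * decay a c = leftCoeff a c := by
      rw [decay, mul_div_cancel₀ _ (rightCoeff_pos ha c).ne']
    rw [← h4, pow_succ]
    have : rightCoeff a c * decay a c * (2 * (edgeAmp a d c * decay a c ^ (l : ℕ))) -
        rightCoeff a c * (2 * (edgeAmp a d c * (decay a c ^ (l : ℕ) * decay a c))) = 0 := by ring
    rw [this]
    simp
  · simp

theorem zeroMode_mul_self (c : Bool) : zeroMode a d c * zeroMode a d c = 1 := by
  have h := anticommutator_sum (fun l : Fin (d + 1) => majorana (d * 2 + 1) c (2 * l))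
    (fun l : Fin (d + 1) => majorana (d * 2 + 1) c (2 * l)) (fun l l' => if l = l' then 2 else 0)
    (fun l l' => by
      rw [majorana_anticommutator (by omega) (by omega)]
      congr 2
      exact if_congr (by simp [Fin.ext_iff]) rfl rfl)
    (fun l => edgeAmp a d c * decay a c ^ (l : ℕ)) (fun l => edgeAmp a d c * decay a c ^ (l : ℕ))
  have h1 : ∑ l : Fin (d + 1), ∑ l' : Fin (d + 1), edgeAmp a d c * decay a c ^ (l : ℕ) *
      (if l = l' then (2 : ℝ) else 0) * (edgeAmp a d c * decay a c ^ (l' : ℕ)) = 2 := by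
    simp only [mul_ite, mul_zero, ite_mul, zero_mul, Finset.sum_ite_eq, Finset.mem_univ, if_true]
    refine Eq.trans ?_ ((congrArg (2 * ·) (edgeAmp_sq_mul_sum a d c)).trans (mul_one 2))
    simp only [Finset.mul_sum]
    exact Finset.sum_congr rfl fun l _ => by ring
  rw [h1] at h
  change zeroMode a d c * zeroMode a d c + zeroMode a d c * zeroMode a d c = _ at h
  rw [← two_smul ℂ] at h
  have h2 := congrArg (fun M => (1 / 2 : ℂ) • M) h
  simp only [smul_smul] at h2
  norm_num at h2
  exact h2

theorem zeroMode_anticomm {c c' : Bool} (h : c ≠ c') :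
    zeroMode a d c * zeroMode a d c' = -(zeroMode a d c' * zeroMode a d c) := by
  simp only [zeroMode, Finset.sum_mul_sum, smul_mul_smul_comm]
  rw [Finset.sum_comm, ← Finset.sum_neg_distrib]
  refine Finset.sum_congr rfl fun l _ => ?_
  rw [← Finset.sum_neg_distrib]
  refine Finset.sum_congr rfl fun l' _ => ?_
  rw [majorana_anticomm (by omega) (by omega) (Or.inl h), smul_neg,
    mul_comm (Complex.ofReal _)]

end ZeroMode

/-! ### The logical qubit of a chain and the symmetries used to compute compressions -/

section ChainEncoding

/-- The Pauli matrices `X` and `Y`. -/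
def pauliXY (c : Bool) : Matrix (Fin 2) (Fin 2) ℂ := if c then pauliX else pauliY

theorem pauliXY_mul_self (c : Bool) : pauliXY c * pauliXY c = 1 := by
  cases c <;> simp [pauliXY, pauliX_mul_self, pauliY_mul_self]

theorem pauliXY_conjTranspose (c : Bool) : (pauliXY c)ᴴ = pauliXY c := by
  cases c <;> simp [pauliXY, pauliX_conjTranspose, pauliY_conjTranspose]

theorem eq_smul_one_of_commute_pauliXY {c : Bool} {A w : Matrix (Fin 2) (Fin 2) ℂ}
    (h : A * pauliXY c = pauliXY c * A) (hw : w * w = 1) (hwS : w * pauliXY c = -(pauliXY c * w))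
    (hwA : A * w = w * A) : ∃ r : ℂ, A = r • 1 := by
  cases c
  · exact eq_smul_one_of_commute_pauliY h hw hwS hwA
  · exact eq_smul_one_of_commute_pauliX h hw hwS hwA

/-- `φ` encodes a qubit into the ground space of the chain, at energy `E`. -/
structure IsChainEncoding (a : ℝ) (d : ℕ) (φ : Matrix (Fin (d * 2 + 1) → Fin 2) (Fin 2) ℂ)
    (E : ℝ) : Prop where
  isometry : φᴴ * φ = 1
  eigen : chainHamiltonian a d * φ = (E : ℂ) • φ
  gap : ((2 * (a - 1) : ℝ) : ℂ) • (1 - φ * φᴴ) ≤ chainHamiltonian a d - (E : ℂ) • 1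
  zeroMode_mul : ∀ c, zeroMode a d c * φ = φ * pauliXY c

theorem exists_isChainEncoding {a : ℝ} (ha : 1 < a) (d : ℕ) :
    ∃ (φ : Matrix (Fin (d * 2 + 1) → Fin 2) (Fin 2) ℂ) (E : ℝ), IsChainEncoding a d φ E := by
  obtain ⟨P, E, hP, hP2, hPc, hPE, hPgap, hPtr⟩ := exists_free_fermion_ground_projection
    (chainG a d) (chainQ d) (chainN a d) (sub_pos.mpr ha) chainN_isHermitian
    (chainN_lower_bound (by linarith)) chainG_conjTranspose chainQ_conjTranspose
    chainG_anticommutator chainQ_anticommutator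
    (fun i j => by rw [chainG_mul_chainQ, neg_add_cancel])
  rw [← chainHamiltonian_eq] at hPE hPgap
  -- There are 2d fermionic modes on 2d + 1 qubits, so exactly one factor of 2 remains.
  have htr : P.trace = 2 := by
    simp only [Fintype.card_prod, Fintype.card_bool, Fintype.card_fin, Fintype.card_fun] at hPtr
    rw [mul_comm 2 d, pow_succ] at hPtr
    push_cast at hPtr
    exact mul_left_cancel₀ (pow_ne_zero _ two_ne_zero) hPtr
  have hcomm : ∀ c, zeroMode a d c * P = P * zeroMode a d c := fun c =>
    hPc _ (fun j => zeroMode_mul_chainG ha c j) (fun j => zeroMode_mul_chainQ c j)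
  obtain ⟨φ, hφ, hφP, hX, hY⟩ := exists_qubit_encoding hP hP2 htr
    (zeroMode_conjTranspose true) (zeroMode_conjTranspose false) (zeroMode_mul_self true)
    (zeroMode_mul_self false) (zeroMode_anticomm (by simp)) (hcomm true) (hcomm false)
  refine ⟨φ, E, hφ, ?_, by rw [hφP]; exact hPgap, ?_⟩
  · have h1 : P * φ = φ := by rw [← hφP, Matrix.mul_assoc, hφ, Matrix.mul_one]
    rw [← h1, ← Matrix.mul_assoc, hPE, Matrix.smul_mul]
  · intro c
    cases c
    · exact hY
    · exact hX

/-- One of the two Majorana chains making up the chain Hamiltonian. -/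
def halfHamiltonian (a : ℝ) (d : ℕ) (c : Bool) :
    Matrix (Fin (d * 2 + 1) → Fin 2) (Fin (d * 2 + 1) → Fin 2) ℂ :=
  ∑ l : Fin d, Complex.I • (chainG a d (c, l) * chainQ d (c, l))

/-- The term of the chain Hamiltonian joining the first two qubits. -/
def firstBond (d : ℕ) (c : Bool) :
    Matrix (Fin (d * 2 + 1) → Fin 2) (Fin (d * 2 + 1) → Fin 2) ℂ :=
  Complex.I • (majorana _ (!c) 0 * majorana _ c 1)

variable {a : ℝ} {d : ℕ}

theorem chainHamiltonian_eq_half (c : Bool) :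
    chainHamiltonian a d = halfHamiltonian a d c + halfHamiltonian a d (!c) := by
  rw [chainHamiltonian_eq, Fintype.sum_prod_type, Fintype.sum_bool]
  cases c
  · exact add_comm _ _
  · rfl

theorem commute_mul_of_anticomm {R : Type*} [Ring R] {B x y : R}
    (h1 : B * x = -(x * B)) (h2 : B * y = -(y * B)) : B * (x * y) = x * y * B := by
  rw [← mul_assoc, h1, neg_mul, mul_assoc, h2, mul_neg, neg_neg, mul_assoc]

theorem commute_halfHamiltonian {c : Bool}
    {B : Matrix (Fin (d * 2 + 1) → Fin 2) (Fin (d * 2 + 1) → Fin 2) ℂ}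
    (h : ∀ l, B * (chainG a d (c, l) * chainQ d (c, l)) =
      chainG a d (c, l) * chainQ d (c, l) * B) :
    B * halfHamiltonian a d c = halfHamiltonian a d c * B := by
  rw [halfHamiltonian, Finset.mul_sum, Finset.sum_mul]
  exact Finset.sum_congr rfl fun l _ => by rw [mul_smul_comm, smul_mul_assoc, h]

theorem zeroMode_mul_halfHamiltonian (ha : 1 < a) (c c' : Bool) :
    zeroMode a d c * halfHamiltonian a d c' = halfHamiltonian a d c' * zeroMode a d c :=
  commute_halfHamiltonian fun _ => commute_mul_of_anticomm (zeroMode_mul_chainG ha c _)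
    (zeroMode_mul_chainQ c _)

theorem anticomm_chainG {c : Bool} {l : Fin d}
    {B : Matrix (Fin (d * 2 + 1) → Fin 2) (Fin (d * 2 + 1) → Fin 2) ℂ}
    (h : ∀ i ≤ d, B * majorana _ c (2 * i) = -(majorana _ c (2 * i) * B)) :
    B * chainG a d (c, l) = -(chainG a d (c, l) * B) := by
  rw [chainG, mul_sub, sub_mul, mul_smul_comm, mul_smul_comm, smul_mul_assoc, smul_mul_assoc,
    h _ (by omega), h _ (by omega)]
  module

theorem parity_mul_halfHamiltonian (c : Bool) :
    parity _ * halfHamiltonian a d c = halfHamiltonian a d c * parity _ :=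
  commute_halfHamiltonian fun l => commute_mul_of_anticomm
    (anticomm_chainG fun i hi => parity_mul_majorana (by omega))
    (parity_mul_majorana (by simp only; omega))

theorem parity_mul_zeroMode (c : Bool) :
    parity _ * zeroMode a d c = -(zeroMode a d c * parity _) := by
  rw [zeroMode, Finset.sum_mul, Finset.mul_sum, ← Finset.sum_neg_distrib]
  refine Finset.sum_congr rfl fun l _ => ?_
  rw [smul_mul_assoc, mul_smul_comm, parity_mul_majorana (by omega), smul_neg]

/-- The halves are even in disjoint sets of Majoranas: even sites of type c with odd sites of type
!c, and vice versa. -/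
theorem halfHamiltonian_comm (c : Bool) :
    halfHamiltonian a d (!c) * halfHamiltonian a d c =
      halfHamiltonian a d c * halfHamiltonian a d (!c) := by
  have h : ∀ (c' : Bool) (i : ℕ), c' = (!c) → i ≤ d * 2 → i % 2 = 0 →
      majorana _ c' i * halfHamiltonian a d c = halfHamiltonian a d c * majorana _ c' i := by
    intro c' i hc hi hi2
    refine commute_halfHamiltonian fun l => commute_mul_of_anticomm
      (anticomm_chainG fun j hj => majorana_anticomm (by omega) (by omega) (by simp [hc]))
      (majorana_anticomm (by omega) (by simp only; omega) (by right; simp only; omega))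
  have h' : ∀ (i : ℕ), i < d →
      majorana _ c (2 * i + 1) * halfHamiltonian a d c =
        halfHamiltonian a d c * majorana _ c (2 * i + 1) := by
    intro i hi
    refine commute_halfHamiltonian fun l => commute_mul_of_anticomm
      (anticomm_chainG fun j hj => majorana_anticomm (by omega) (by omega) (by right; omega))
      (majorana_anticomm (by omega) (by simp only; omega) (by left; simp))
  conv_lhs => rw [halfHamiltonian]
  conv_rhs => rw [halfHamiltonian.eq_def a d (!c)]
  rw [Finset.sum_mul, Finset.mul_sum]
  refine Finset.sum_congr rfl fun l _ => ?_
  have h1 : chainQ d (!c, l) * halfHamiltonian a d c = halfHamiltonian a d c * chainQ d (!c, l) := by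
    rw [chainQ]
    simp only [Bool.not_not]
    exact h' _ l.2
  have h2 : chainG a d (!c, l) * halfHamiltonian a d c =
      halfHamiltonian a d c * chainG a d (!c, l) := by
    rw [chainG, sub_mul, mul_sub, smul_mul_assoc, smul_mul_assoc, mul_smul_comm, mul_smul_comm,
      h _ _ rfl (by simp only; omega) (by omega), h _ _ rfl (by simp only; omega) (by omega)]
  rw [smul_mul_assoc, mul_smul_comm, mul_assoc, h1, ← mul_assoc, h2, mul_assoc]

/-- Exhibits `chainG` as a commutator with the half Hamiltonian; expectations of such commutators
vanish in its eigenstates. -/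
theorem halfHamiltonian_mul_chainQ (c : Bool) (l : Fin d) :
    halfHamiltonian a d c * chainQ d (c, l) - chainQ d (c, l) * halfHamiltonian a d c =
      (2 * Complex.I) • chainG a d (c, l) := by
  rw [halfHamiltonian, Finset.sum_mul, Finset.mul_sum, ← Finset.sum_sub_distrib]
  have h : ∀ m : Fin d, Complex.I • (chainG a d (c, m) * chainQ d (c, m)) * chainQ d (c, l) -
      chainQ d (c, l) * Complex.I • (chainG a d (c, m) * chainQ d (c, m)) =
      if m = l then (2 * Complex.I) • chainG a d (c, l) else 0 := by
    intro m
    have h1 : chainQ d (c, l) * chainG a d (c, m) = -(chainG a d (c, m) * chainQ d (c, l)) := by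
      rw [chainG_mul_chainQ, neg_neg]
    rw [smul_mul_assoc, mul_smul_comm, ← smul_sub, ← mul_assoc, h1, neg_mul, sub_neg_eq_add,
      mul_assoc, mul_assoc, ← mul_add, chainQ_anticommutator, mul_smul_comm, mul_one, smul_smul]
    rcases eq_or_ne m l with rfl | h
    · simp [mul_comm]
    · simp [h]
  simp only [h, Finset.sum_ite_eq', Finset.mem_univ, if_true]

theorem firstBond_comm_majorana {c c' : Bool} {i : ℕ} (hd : 0 < d) (hi : i ≤ d * 2)
    (h0 : c' ≠ (!c) ∨ i ≠ 0) (h1 : c' ≠ c ∨ i ≠ 1) :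
    majorana _ c' i * firstBond d c = firstBond d c * majorana _ c' i := by
  rw [firstBond, mul_smul_comm, smul_mul_assoc, commute_mul_of_anticomm
    (majorana_anticomm (by omega) (by omega) h0) (majorana_anticomm (by omega) (by omega) h1)]

/-- The bond labelled c is a product of Majoranas of the other half !c, hence it is even and
disjoint from half c. -/
theorem firstBond_mul_halfHamiltonian (hd : 0 < d) (c : Bool) :
    firstBond d c * halfHamiltonian a d c = halfHamiltonian a d c * firstBond d c := by
  refine commute_halfHamiltonian fun l => ?_
  have h1 : firstBond d c * chainG a d (c, l) = chainG a d (c, l) * firstBond d c := by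
    rw [chainG, sub_mul, mul_sub, smul_mul_assoc, smul_mul_assoc, mul_smul_comm, mul_smul_comm,
      firstBond_comm_majorana hd (by simp only; omega) (by simp) (by right; omega),
      firstBond_comm_majorana hd (by simp only; omega) (by simp) (by right; omega)]
  have h2 : firstBond d c * chainQ d (c, l) = chainQ d (c, l) * firstBond d c := by
    rw [chainQ, firstBond_comm_majorana hd (by simp only; omega) (by right; omega) (by simp)]
  rw [← mul_assoc, h1, mul_assoc, h2, mul_assoc]

theorem firstBond_mul_zeroMode (hd : 0 < d) (c : Bool) :
    firstBond d c * zeroMode a d c = zeroMode a d c * firstBond d c := by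
  rw [zeroMode, Finset.sum_mul, Finset.mul_sum]
  refine Finset.sum_congr rfl fun l _ => ?_
  rw [smul_mul_assoc, mul_smul_comm,
    firstBond_comm_majorana hd (by omega) (by simp) (by right; omega)]

theorem parity_mul_firstBond (hd : 0 < d) (c : Bool) :
    parity _ * firstBond d c = firstBond d c * parity _ := by
  rw [firstBond, mul_smul_comm, smul_mul_assoc, commute_mul_of_anticomm
    (parity_mul_majorana (by omega)) (parity_mul_majorana (by omega))]

theorem firstBond_conjTranspose (hd : 0 < d) (c : Bool) : (firstBond d c)ᴴ = firstBond d c := by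
  rw [firstBond, Matrix.conjTranspose_smul, Matrix.conjTranspose_mul, majorana_conjTranspose,
    majorana_conjTranspose, majorana_anticomm (by omega) (by omega) (by simp)]
  simp

/-- The Majorana at site 0 enters a single quadratic term, so conjugation by it flips the sign of
that bond only. -/
theorem majorana_conj_chainHamiltonian (hd : 0 < d) (c : Bool) :
    majorana _ (!c) 0 * chainHamiltonian a d * majorana _ (!c) 0 =
      chainHamiltonian a d - ((2 * leftCoeff a (!c) : ℝ) : ℂ) • firstBond d c := by
  set D := majorana (d * 2 + 1) (!c) 0 with hD
  have hDD : D * D = 1 := majorana_mul_self _ _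
  rw [chainHamiltonian_eq, Finset.mul_sum, Finset.sum_mul]
  have h : ∀ j : Bool × Fin d, D * Complex.I • (chainG a d j * chainQ d j) * D =
      Complex.I • (chainG a d j * chainQ d j) -
        if j = (!c, ⟨0, hd⟩) then ((2 * leftCoeff a (!c) : ℝ) : ℂ) • firstBond d c else 0 := by
    rintro ⟨c', l⟩
    have hq : D * chainQ d (c', l) = -(chainQ d (c', l) * D) :=
      majorana_anticomm (by omega) (by simp only; omega) (by right; simp only; omega)
    have hg : D * chainG a d (c', l) = -(chainG a d (c', l) * D) +
        ((if (c', l) = (!c, (⟨0, hd⟩ : Fin d)) then 2 * leftCoeff a (!c) else 0 : ℝ) : ℂ) • 1 := by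
      rw [neg_add_eq_sub, eq_sub_iff_add_eq]
      have h1 := majorana_anticommutator (k := d * 2 + 1) (c := !c) (c' := c') (i := 0)
        (j := 2 * l) (by omega) (by omega)
      have h2 := majorana_anticommutator (k := d * 2 + 1) (c := !c) (c' := c') (i := 0)
        (j := 2 * (l + 1)) (by omega) (by omega)
      rw [if_neg (by omega), Complex.ofReal_zero, zero_smul] at h2
      have h3 : D * chainG a d (c', l) + chainG a d (c', l) * D = (leftCoeff a c' : ℂ) •
          (((if (!c) = c' ∧ 0 = 2 * (l : ℕ) then 2 else 0 : ℝ) : ℂ) • 1) -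
          (rightCoeff a c' : ℂ) • 0 := by
        rw [← h1, ← h2, chainG]
        simp only [sub_mul, mul_sub, smul_mul_assoc, mul_smul_comm]
        module
      rw [h3, smul_zero, sub_zero, smul_smul, ← Complex.ofReal_mul]
      congr 2
      rcases eq_or_ne (!c) c' with rfl | hc
      · simp only [true_and, Prod.mk.injEq, Fin.ext_iff]
        rw [mul_ite, mul_zero]
        exact if_congr (by omega) (mul_comm _ _) rfl
      · simp [hc, hc.symm]
    rw [mul_smul_comm, smul_mul_assoc, ← mul_assoc, hg, add_mul, neg_mul, mul_assoc _ D, hq, mul_neg,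
      neg_neg, add_mul, mul_assoc, mul_assoc, hDD, mul_one, smul_mul_assoc, one_mul,
      smul_mul_assoc]
    rw [show chainQ d (c', l) * D = -(D * chainQ d (c', l)) by rw [hq, neg_neg]]
    split_ifs with hj
    · rw [hj, firstBond, chainQ]
      simp only [Bool.not_not, mul_zero, zero_add]
      rw [← hD]
      module
    · simp
  simp only [h, Finset.sum_sub_distrib, Finset.sum_ite_eq', Finset.mem_univ, if_true]

end ChainEncoding

/-! ### Compressions of operators to the logical qubit -/

namespace IsChainEncoding

variable {a : ℝ} {d : ℕ} {φ : Matrix (Fin (d * 2 + 1) → Fin 2) (Fin 2) ℂ} {E : ℝ}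

theorem conj_mul_zeroMode (h : IsChainEncoding a d φ E) (c : Bool) :
    φᴴ * zeroMode a d c = pauliXY c * φᴴ := by
  have h1 := congrArg Matrix.conjTranspose (h.zeroMode_mul c)
  rwa [Matrix.conjTranspose_mul, Matrix.conjTranspose_mul, zeroMode_conjTranspose,
    pauliXY_conjTranspose] at h1

theorem invariant (h : IsChainEncoding a d φ E) (ha : 1 < a)
    {B : Matrix (Fin (d * 2 + 1) → Fin 2) (Fin (d * 2 + 1) → Fin 2) ℂ}
    (hB : ∀ c, B * halfHamiltonian a d c = halfHamiltonian a d c * B) :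
    B * φ = φ * (φᴴ * B * φ) := by
  refine ground_invariant (by linarith) h.isometry h.eigen h.gap ?_
  rw [chainHamiltonian_eq_half true, mul_add, add_mul, hB, hB]

theorem conj_commute (h : IsChainEncoding a d φ E) (c : Bool)
    {B : Matrix (Fin (d * 2 + 1) → Fin 2) (Fin (d * 2 + 1) → Fin 2) ℂ}
    (hB : B * zeroMode a d c = zeroMode a d c * B) :
    φᴴ * B * φ * pauliXY c = pauliXY c * (φᴴ * B * φ) := by
  rw [Matrix.mul_assoc, ← h.zeroMode_mul, ← Matrix.mul_assoc, Matrix.mul_assoc φᴴ, hB,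
    ← Matrix.mul_assoc, h.conj_mul_zeroMode]
  simp only [Matrix.mul_assoc]

/-- Fermion parity preserves the ground space and acts there as an involution w anticommuting with
the logical Paulis. The compression of B commutes with one logical Pauli and with w, hence is
scalar; it is real since B is Hermitian. -/
theorem conj_scalar (h : IsChainEncoding a d φ E) (ha : 1 < a) (c : Bool)
    {B : Matrix (Fin (d * 2 + 1) → Fin 2) (Fin (d * 2 + 1) → Fin 2) ℂ}
    (hBh : Bᴴ = B) (hB : B * zeroMode a d c = zeroMode a d c * B)
    (hBP : parity _ * B = B * parity _) :
    ∃ r : ℝ, φᴴ * B * φ = (r : ℂ) • 1 := by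
  set w : Matrix (Fin 2) (Fin 2) ℂ := φᴴ * parity (d * 2 + 1) * φ with hw
  have hinv : parity (d * 2 + 1) * φ = φ * w := h.invariant ha fun c => parity_mul_halfHamiltonian c
  have hpar : (parity (d * 2 + 1))ᴴ = parity _ := by
    rw [parity, piTensor_conjTranspose]
    simp only [pauliY_conjTranspose]
  have hwh : wᴴ = w := by
    rw [hw, Matrix.conjTranspose_mul, Matrix.conjTranspose_mul, hpar,
      Matrix.conjTranspose_conjTranspose, Matrix.mul_assoc]
  have hinv' : φᴴ * parity (d * 2 + 1) = w * φᴴ := by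
    have h1 := congrArg Matrix.conjTranspose hinv
    rwa [Matrix.conjTranspose_mul, Matrix.conjTranspose_mul, hpar, hwh] at h1
  obtain ⟨r, hr⟩ := eq_smul_one_of_commute_pauliXY (c := c) (A := φᴴ * B * φ) (w := w)
    (h.conj_commute c hB)
    (by
      rw [hw, Matrix.mul_assoc φᴴ, hinv, ← Matrix.mul_assoc φᴴ, h.isometry, Matrix.one_mul]
      have h1 : φ * (w * w) = φ := by
        rw [← Matrix.mul_assoc, ← hinv, Matrix.mul_assoc, ← hinv, ← Matrix.mul_assoc,
          parity_mul_self, Matrix.one_mul]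
      have h2 := congrArg (fun M => φᴴ * M) h1
      simp only [← Matrix.mul_assoc, h.isometry, Matrix.one_mul] at h2
      exact h2)
    (by
      rw [hw, Matrix.mul_assoc, ← h.zeroMode_mul, ← Matrix.mul_assoc, Matrix.mul_assoc φᴴ,
        parity_mul_zeroMode, Matrix.mul_neg, ← Matrix.mul_assoc, h.conj_mul_zeroMode,
        Matrix.neg_mul]
      simp only [Matrix.mul_assoc])
    (by
      rw [Matrix.mul_assoc, ← hinv, ← Matrix.mul_assoc, Matrix.mul_assoc φᴴ, ← hBP,
        ← Matrix.mul_assoc, hinv']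
      simp only [Matrix.mul_assoc])
  refine ⟨r.re, ?_⟩
  have h1 : (φᴴ * B * φ)ᴴ = φᴴ * B * φ := by
    rw [Matrix.conjTranspose_mul, Matrix.conjTranspose_mul, hBh,
      Matrix.conjTranspose_conjTranspose, Matrix.mul_assoc]
  rw [hr, Matrix.conjTranspose_smul, Matrix.conjTranspose_one] at h1
  have h2 := congrFun (congrFun h1 0) 0
  simp at h2
  rw [hr, Complex.conj_eq_iff_re.mp h2]

/-- Each half commutes with the full Hamiltonian, so it preserves the ground space, and
`conj_scalar` makes it constant there. -/
theorem halfHamiltonian_mul (h : IsChainEncoding a d φ E) (ha : 1 < a) (c : Bool) :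
    ∃ e : ℝ, halfHamiltonian a d c * φ = (e : ℂ) • φ := by
  have h1 : halfHamiltonian a d c * φ = φ * (φᴴ * halfHamiltonian a d c * φ) := by
    refine h.invariant ha fun c' => ?_
    rcases Bool.eq_or_eq_not c' c with rfl | rfl
    · rfl
    · rw [halfHamiltonian_comm]
  obtain ⟨e, he⟩ := h.conj_scalar ha c (B := halfHamiltonian a d c)
    (by
      rw [halfHamiltonian, Matrix.conjTranspose_sum]
      refine Finset.sum_congr rfl fun l _ => ?_
      rw [Matrix.conjTranspose_smul, Matrix.conjTranspose_mul, chainG_conjTranspose,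
        chainQ_conjTranspose, chainG_mul_chainQ]
      simp)
    (zeroMode_mul_halfHamiltonian ha c c).symm (parity_mul_halfHamiltonian c)
  exact ⟨e, by rw [h1, he]; simp⟩

/-- Write `chainG` as [h, q]/2i with h the half Hamiltonian. As h commutes with B and has one
eigenvalue on the ground space, both terms of the commutator contribute equally. -/
theorem conj_chainG_mul (h : IsChainEncoding a d φ E) (ha : 1 < a) (c : Bool) (l : Fin d)
    {B : Matrix (Fin (d * 2 + 1) → Fin 2) (Fin (d * 2 + 1) → Fin 2) ℂ}
    (hB : B * halfHamiltonian a d c = halfHamiltonian a d c * B) :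
    φᴴ * (chainG a d (c, l) * B) * φ = 0 := by
  obtain ⟨e, he⟩ := h.halfHamiltonian_mul ha c
  have hh : (halfHamiltonian a d c)ᴴ = halfHamiltonian a d c := by
    rw [halfHamiltonian, Matrix.conjTranspose_sum]
    refine Finset.sum_congr rfl fun l _ => ?_
    rw [Matrix.conjTranspose_smul, Matrix.conjTranspose_mul, chainG_conjTranspose,
      chainQ_conjTranspose, chainG_mul_chainQ]
    simp
  have he' : φᴴ * halfHamiltonian a d c = (e : ℂ) • φᴴ := by
    have h1 := congrArg Matrix.conjTranspose he
    rw [Matrix.conjTranspose_mul, hh, Matrix.conjTranspose_smul] at h1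
    simpa using h1
  have h1 : (2 * Complex.I) • (φᴴ * (chainG a d (c, l) * B) * φ) = 0 := by
    rw [← Matrix.smul_mul, ← Matrix.mul_smul, ← Matrix.smul_mul, ← halfHamiltonian_mul_chainQ,
      Matrix.sub_mul, Matrix.mul_sub, Matrix.sub_mul, sub_eq_zero]
    calc φᴴ * (halfHamiltonian a d c * chainQ d (c, l) * B) * φ
        = φᴴ * halfHamiltonian a d c * (chainQ d (c, l) * B * φ) := by
          simp only [Matrix.mul_assoc]
      _ = φᴴ * (chainQ d (c, l) * (B * (halfHamiltonian a d c * φ))) := by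
          rw [he', he]
          simp [Matrix.mul_assoc]
      _ = φᴴ * (chainQ d (c, l) * halfHamiltonian a d c * B) * φ := by
          rw [← Matrix.mul_assoc B, hB]
          simp only [Matrix.mul_assoc]
  exact (smul_eq_zero.mp h1).resolve_left (by simp)

/-- Vanishing of the `chainG` compressions makes those of successive even Majoranas geometric.
Summing them with the zero-mode coefficients recovers the logical Pauli, and normalization leaves
the factor `edgeAmp`. -/
theorem conj_majorana_zero_mul (h : IsChainEncoding a d φ E) (ha : 1 < a) (c : Bool)
    {B : Matrix (Fin (d * 2 + 1) → Fin 2) (Fin (d * 2 + 1) → Fin 2) ℂ}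
    (hB : B * halfHamiltonian a d c = halfHamiltonian a d c * B) :
    φᴴ * (majorana _ c 0 * B) * φ = (edgeAmp a d c : ℂ) • (pauliXY c * (φᴴ * B * φ)) := by
  have h1 : ∀ i ≤ d, φᴴ * (majorana _ c (2 * i) * B) * φ =
      ((decay a c ^ i : ℝ) : ℂ) • (φᴴ * (majorana _ c 0 * B) * φ) := by
    intro i
    induction i with
    | zero => intro _; simp
    | succ i ih =>
      intro hi
      have h2 := h.conj_chainG_mul ha c ⟨i, by omega⟩ hB
      rw [chainG] at h2
      simp only [Matrix.sub_mul, Matrix.mul_sub, Matrix.smul_mul, Matrix.mul_smul] at h2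
      rw [ih (by omega), sub_eq_zero] at h2
      have h3 : (rightCoeff a c : ℂ) ≠ 0 := Complex.ofReal_ne_zero.mpr (rightCoeff_pos ha c).ne'
      have h4 := congrArg (fun M => (rightCoeff a c : ℂ)⁻¹ • M) h2
      simp only [smul_smul] at h4
      rw [inv_mul_cancel₀ h3, one_smul] at h4
      rw [← h4]
      congr 1
      rw [pow_succ, decay]
      push_cast
      ring
  have h2 : φᴴ * (zeroMode a d c * B) * φ = ((edgeAmp a d c)⁻¹ : ℂ) •
      (φᴴ * (majorana _ c 0 * B) * φ) := by
    rw [zeroMode, Matrix.sum_mul, Matrix.mul_sum, Matrix.sum_mul]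
    simp only [Matrix.smul_mul, Matrix.mul_smul]
    have h3 : ∀ l : Fin (d + 1), ((edgeAmp a d c * decay a c ^ (l : ℕ) : ℝ) : ℂ) •
        (φᴴ * (majorana (d * 2 + 1) c (2 * l) * B) * φ) =
        ((edgeAmp a d c * (decay a c ^ (l : ℕ)) ^ 2 : ℝ) : ℂ) •
          (φᴴ * (majorana _ c 0 * B) * φ) := by
      intro l
      rw [h1 l (by omega), smul_smul, ← Complex.ofReal_mul]
      congr 2
      ring
    simp only [h3]
    rw [← Finset.sum_smul, ← Complex.ofReal_sum, ← Finset.mul_sum]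
    congr 1
    rw [← Complex.ofReal_inv]
    congr 1
    have h4 := edgeAmp_sq_mul_sum a d c
    have h5 := (edgeAmp_pos a d c).ne'
    field_simp
    linarith
  rw [← Matrix.mul_assoc φᴴ, h.conj_mul_zeroMode] at h2
  have h3 : (edgeAmp a d c : ℂ) ≠ 0 := Complex.ofReal_ne_zero.mpr (edgeAmp_pos a d c).ne'
  have h4 := congrArg (fun M => (edgeAmp a d c : ℂ) • M) h2
  simp only [smul_smul] at h4
  rw [mul_inv_cancel₀ h3, one_smul] at h4
  rw [← h4]
  simp only [Matrix.mul_assoc]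

theorem conj_majorana_zero (h : IsChainEncoding a d φ E) (ha : 1 < a) (c : Bool) :
    φᴴ * majorana (d * 2 + 1) c 0 * φ = (edgeAmp a d c : ℂ) • pauliXY c := by
  have h1 := h.conj_majorana_zero_mul ha c (B := 1) (by rw [one_mul, mul_one])
  rwa [mul_one, Matrix.mul_one, h.isometry, Matrix.mul_one] at h1

/-- The sign of τ is variational. Flipping the first bond by γ₀ changes the ground energy by -2
`leftCoeff` τ, while the flipped state overlaps the ground space with weight only `edgeAmp`², so the
gap bounds this change from below. -/
theorem exists_conj_firstBond (h : IsChainEncoding a d φ E) (ha : 1 < a) (hd : 0 < d) (c : Bool) :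
    ∃ τ : ℝ, φᴴ * firstBond d c * φ = (τ : ℂ) • 1 ∧
      φᴴ * (majorana _ c 0 * firstBond d c) * φ = ((edgeAmp a d c * τ : ℝ) : ℂ) • pauliXY c ∧
      (a - 1) * (1 - edgeAmp a d (!c) ^ 2) ≤ - leftCoeff a (!c) * τ := by
  obtain ⟨τ, hτ⟩ := h.conj_scalar ha c (firstBond_conjTranspose hd c)
    (firstBond_mul_zeroMode hd c) (parity_mul_firstBond hd c)
  refine ⟨τ, hτ, ?_, ?_⟩
  · rw [h.conj_majorana_zero_mul ha c (firstBond_mul_halfHamiltonian hd c), hτ,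
      Matrix.mul_smul, Matrix.mul_one, smul_smul, Complex.ofReal_mul]
  · set D := majorana (d * 2 + 1) (!c) 0 with hD
    have hDD : D * D = 1 := majorana_mul_self _ _
    have hDh : Dᴴ = D := majorana_conjTranspose _ _
    have hDφ : φᴴ * D * φ = _ := h.conj_majorana_zero ha (!c)
    have h1 := (Matrix.le_iff.mp h.gap).conjTranspose_mul_mul_same (D * φ)
    rw [Matrix.conjTranspose_mul, hDh] at h1
    have h2 : φᴴ * D * (chainHamiltonian a d - (E : ℂ) • 1 -
        ((2 * (a - 1) : ℝ) : ℂ) • (1 - φ * φᴴ)) * (D * φ) =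
        ((- (2 * leftCoeff a (!c) * τ) - 2 * (a - 1) * (1 - edgeAmp a d (!c) ^ 2) : ℝ) : ℂ) • 1 := by
      have e1 : φᴴ * D * chainHamiltonian a d * (D * φ) =
          (E : ℂ) • 1 - ((2 * leftCoeff a (!c) * τ : ℝ) : ℂ) • 1 := by
        calc φᴴ * D * chainHamiltonian a d * (D * φ)
            = φᴴ * (D * chainHamiltonian a d * D) * φ := by simp only [Matrix.mul_assoc]
          _ = _ := by
            rw [hD, majorana_conj_chainHamiltonian hd, Matrix.mul_sub, Matrix.sub_mul,
              Matrix.mul_assoc, h.eigen, Matrix.mul_smul, h.isometry, Matrix.mul_smul,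
              Matrix.smul_mul, hτ, smul_smul, Complex.ofReal_mul _ τ]
      have e2 : φᴴ * D * (D * φ) = 1 := by
        rw [Matrix.mul_assoc, ← Matrix.mul_assoc D, hDD, Matrix.one_mul, h.isometry]
      have e3 : φᴴ * D * (φ * φᴴ) * (D * φ) = ((edgeAmp a d (!c) ^ 2 : ℝ) : ℂ) • 1 := by
        calc φᴴ * D * (φ * φᴴ) * (D * φ) = (φᴴ * D * φ) * (φᴴ * D * φ) := by
              simp only [Matrix.mul_assoc]
          _ = _ := by
            rw [hDφ, smul_mul_smul_comm, pauliXY_mul_self, ← Complex.ofReal_mul, pow_two]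
      rw [Matrix.mul_sub, Matrix.mul_sub, Matrix.sub_mul, Matrix.sub_mul, e1, Matrix.mul_smul,
        Matrix.mul_smul, Matrix.smul_mul, Matrix.smul_mul, Matrix.mul_one, e2, Matrix.mul_sub,
        Matrix.sub_mul, Matrix.mul_one, e2, e3]
      push_cast
      module
    rw [h2] at h1
    have h3 := h1.diag_nonneg (i := 0)
    simp only [Matrix.smul_apply, Matrix.one_apply_eq, smul_eq_mul, mul_one,
      Complex.zero_le_real] at h3
    linarith

end IsChainEncoding

/-! ### Quantitative properties of one encoded block -/

section ChainBlock

variable {a : ℝ} {d : ℕ}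

theorem decay_true (a : ℝ) : decay a true = a⁻¹ := by simp [decay, leftCoeff, rightCoeff]

theorem decay_false (a : ℝ) : decay a false = a := by simp [decay, leftCoeff, rightCoeff]

/-- The two modes are mirror images: reversing the sum over sites turns powers of a into powers of
a⁻¹ at the cost of a factor a²ᵈ. -/
theorem edgeAmp_false_sq (ha : 1 < a) (d : ℕ) :
    edgeAmp a d false ^ 2 = edgeAmp a d true ^ 2 * (a⁻¹ ^ d) ^ 2 := by
  have h0 : a ≠ 0 := by linarith
  rw [edgeAmp_sq, edgeAmp_sq, decay_true, decay_false]
  have h : ∑ l : Fin (d + 1), (a ^ (l : ℕ)) ^ 2 =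
      (a ^ d) ^ 2 * ∑ l : Fin (d + 1), (a⁻¹ ^ (l : ℕ)) ^ 2 := by
    rw [← Equiv.sum_comp Fin.revPerm, Finset.mul_sum]
    refine Finset.sum_congr rfl fun l _ => ?_
    have hl : a ^ d = a ^ (d - (l : ℕ)) * a ^ (l : ℕ) := by rw [← pow_add]; congr 1; omega
    have : ((Fin.revPerm l : Fin (d + 1)) : ℕ) = d - l := by simp [Fin.val_rev]
    rw [this, hl]
    rw [inv_pow, ← mul_pow, mul_inv_cancel_right₀ (pow_ne_zero _ h0)]
  rw [h, mul_inv, mul_comm]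
  simp [inv_pow]

theorem edgeAmp_true_sq_le (a : ℝ) (d : ℕ) : edgeAmp a d true ^ 2 ≤ 1 := by
  rw [edgeAmp_sq]
  refine inv_le_one_of_one_le₀ ?_
  refine le_trans ?_ (Finset.single_le_sum (fun _ _ => sq_nonneg _) (Finset.mem_univ 0))
  simp

theorem le_edgeAmp_true_sq (ha : 1 < a) (d : ℕ) : 1 - a⁻¹ ^ 2 ≤ edgeAmp a d true ^ 2 := by
  have h0 : 0 < a⁻¹ := inv_pos.mpr (by linarith)
  have h1 : a⁻¹ < 1 := inv_lt_one_of_one_lt₀ ha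
  have h2 := edgeAmp_sq_mul_sum a d true
  rw [decay_true] at h2
  have h3 : (1 - a⁻¹ ^ 2) * ∑ l : Fin (d + 1), (a⁻¹ ^ (l : ℕ)) ^ 2 ≤ 1 := by
    rw [Fin.sum_univ_eq_sum_range (fun l => (a⁻¹ ^ l) ^ 2)]
    simp only [← pow_mul, mul_comm _ 2]
    simp only [pow_mul]
    rw [mul_comm, geom_sum_mul_neg]
    have : 0 ≤ (a⁻¹ ^ 2) ^ (d + 1) := by positivity
    linarith
  have h4 := edgeAmp_normSq_pos a d true
  rw [decay_true] at h4
  nlinarith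

/-- The properties of a chain of `2 d + 1` qubits used as an encoded qubit. -/
theorem exists_chain_block (ha : 1 < a) (hd : 0 < d) :
    ∃ (φ : Matrix (Fin (d * 2 + 1) → Fin 2) (Fin 2) ℂ) (E x z t t' : ℝ),
      φᴴ * φ = 1 ∧ chainHamiltonian a d * φ = (E : ℂ) • φ ∧
      ((2 * (a - 1) : ℝ) : ℂ) • (1 - φ * φᴴ) ≤ chainHamiltonian a d - (E : ℂ) • 1 ∧
      φᴴ * site (0 : Fin (d * 2 + 1)) pauliX * φ = (x : ℂ) • pauliX ∧
      φᴴ * site (0 : Fin (d * 2 + 1)) pauliZ * φ = (z : ℂ) • pauliY ∧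
      φᴴ * site (⟨1, by omega⟩ : Fin (d * 2 + 1)) pauliX * φ = ((x * t : ℝ) : ℂ) • pauliX ∧
      φᴴ * site (⟨1, by omega⟩ : Fin (d * 2 + 1)) pauliZ * φ = ((z * t' : ℝ) : ℂ) • pauliY ∧
      1 - a⁻¹ ^ 2 ≤ x ^ 2 ∧ z ^ 2 = x ^ 2 * (a⁻¹ ^ d) ^ 2 ∧
      t ≤ -((a - 1) * (1 - a⁻¹ ^ 2) / a) ∧ 0 ≤ t' := by
  obtain ⟨φ, E, h⟩ := exists_isChainEncoding ha d
  obtain ⟨τ, -, h1, h2⟩ := h.exists_conj_firstBond ha hd true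
  obtain ⟨τ', -, h3, h4⟩ := h.exists_conj_firstBond ha hd false
  have hX0 : site (0 : Fin (d * 2 + 1)) pauliX = majorana _ true 0 :=
    (majorana_zero true (by omega)).symm
  have hZ0 : site (0 : Fin (d * 2 + 1)) pauliZ = majorana _ false 0 :=
    (majorana_zero false (by omega)).symm
  -- X₁ = X₀ (X₀X₁) reduces the second qubit to the first qubit times a bond. For Z the bond enters
  -- with a minus sign, which is why t' is -τ'.
  have hX1 : site (⟨1, by omega⟩ : Fin (d * 2 + 1)) pauliX =
      majorana _ true 0 * firstBond d true := by
    have h5 := site_pauliX_mul_site_pauliX (k := d * 2 + 1) (i := 0) (by omega)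
    change site 0 pauliX * site ⟨1, _⟩ pauliX = firstBond d true at h5
    rw [← h5, ← hX0, ← mul_assoc, site_mul, pauliX_mul_self, site_one, one_mul]
  have hZ1 : site (⟨1, by omega⟩ : Fin (d * 2 + 1)) pauliZ =
      -(majorana _ false 0 * firstBond d false) := by
    have h5 := site_pauliZ_mul_site_pauliZ (k := d * 2 + 1) (i := 0) (by omega)
    change site 0 pauliZ * site ⟨1, _⟩ pauliZ = -firstBond d false at h5
    rw [← mul_neg, ← h5, ← hZ0, ← mul_assoc, site_mul, pauliZ_mul_self, site_one, one_mul]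
  have h0 : 0 < a⁻¹ := inv_pos.mpr (by linarith)
  have hlt : a⁻¹ < 1 := inv_lt_one_of_one_lt₀ ha
  have hz := edgeAmp_false_sq ha d
  have hx1 := edgeAmp_true_sq_le a d
  refine ⟨φ, E, edgeAmp a d true, edgeAmp a d false, τ, -τ', h.isometry, h.eigen, h.gap, ?_, ?_,
    ?_, ?_, le_edgeAmp_true_sq ha d, hz, ?_, ?_⟩
  · rw [hX0, h.conj_majorana_zero ha]
    rfl
  · rw [hZ0, h.conj_majorana_zero ha]
    rfl
  · rw [hX1, h1]
    rfl
  · rw [hZ1, Matrix.mul_neg, Matrix.neg_mul, h3, mul_neg, Complex.ofReal_neg, neg_smul]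
    rfl
  -- Here d ≥ 1 is needed, and it makes the bound on t independent of d.
  · have h5 : edgeAmp a d false ^ 2 ≤ a⁻¹ ^ 2 := by
      rw [hz]
      have h6 : a⁻¹ ^ d ≤ a⁻¹ ^ 1 := pow_le_pow_of_le_one h0.le hlt.le hd
      have h7 : (a⁻¹ ^ d) ^ 2 ≤ a⁻¹ ^ 2 := by
        rw [pow_one] at h6
        exact pow_le_pow_left₀ (by positivity) h6 2
      calc edgeAmp a d true ^ 2 * (a⁻¹ ^ d) ^ 2 ≤ 1 * a⁻¹ ^ 2 := by gcongr
        _ = a⁻¹ ^ 2 := one_mul _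
    have h6 : (a - 1) * (1 - a⁻¹ ^ 2) ≤ -a * τ := by
      refine le_trans ?_ h2
      simp only [Bool.not_true]
      gcongr
    rw [le_neg, div_le_iff₀ (by linarith)]
    linarith
  · have h5 : (0 : ℝ) ≤ -1 * τ' := by
      refine le_trans ?_ h4
      simp only [Bool.not_false]
      exact mul_nonneg (by linarith) (by linarith)
    linarith

end ChainBlock

/-! ### First-order perturbation theory for a gapped ground space -/

section Perturbation

variable {V W : Type*}
  [NormedAddCommGroup V] [InnerProductSpace ℂ V]
  [NormedAddCommGroup W] [InnerProductSpace ℂ W]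

theorem norm_sq_eigen {ι : Type*} [Fintype ι] (b : OrthonormalBasis ι ℂ W) (e : ι → ℝ)
    {H : W →ₗ[ℂ] W} (hH : H.IsSymmetric) (hb : ∀ i, H (b i) = (e i : ℂ) • b i) (x : W) :
    ‖H x‖ ^ 2 = ∑ i, e i ^ 2 * ‖inner ℂ (b i) x‖ ^ 2 := by
  rw [← b.sum_sq_norm_inner_right]
  refine Finset.sum_congr rfl fun i _ => ?_
  rw [← hH, hb, inner_smul_left, norm_mul, mul_pow]
  simp

theorem re_inner_eigen {ι : Type*} [Fintype ι] (b : OrthonormalBasis ι ℂ W) (e : ι → ℝ)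
    {H : W →ₗ[ℂ] W} (hH : H.IsSymmetric) (hb : ∀ i, H (b i) = (e i : ℂ) • b i) (x : W) :
    (inner ℂ x (H x)).re = ∑ i, e i * ‖inner ℂ (b i) x‖ ^ 2 := by
  rw [← b.sum_inner_mul_inner, Complex.re_sum]
  refine Finset.sum_congr rfl fun i _ => ?_
  rw [← hH, hb, inner_smul_left, mul_left_comm, Complex.conj_ofReal, Complex.re_ofReal_mul,
    ← inner_conj_symm x (b i), Complex.conj_mul']
  norm_cast

variable [FiniteDimensional ℂ V]

/-- A linear map which is nearly isometric is close to a unitary. -/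
theorem exists_unitary_near (T : V →ₗ[ℂ] V) {δ : ℝ} (hδ1 : δ < 1) (hδ0 : 0 ≤ δ)
    (hT1 : ∀ x, ‖T x‖ ≤ ‖x‖) (hT2 : ∀ x, (1 - δ ^ 2) * ‖x‖ ^ 2 ≤ ‖T x‖ ^ 2) :
    ∃ U : V ≃ₗᵢ[ℂ] V, ∀ x, ‖U x - T x‖ ≤ δ ^ 2 * ‖x‖ := by
  -- The unitary is the polar factor of T, built by normalizing the images of an eigenbasis of T†T.
  -- For a singular value s, 1 - s ≤ 1 - s² ≤ δ².
  have hS : (LinearMap.adjoint T * T).IsSymmetric := LinearMap.isSymmetric_adjoint_mul_self T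
  set h := hS.eigenvectorBasis rfl with hh
  have hinner : ∀ i j, inner ℂ (T (h i)) (T (h j)) =
      if i = j then ((‖T (h i)‖ ^ 2 : ℝ) : ℂ) else 0 := by
    intro i j
    split_ifs with hij
    · rw [hij, inner_self_eq_norm_sq_to_K]; norm_cast
    · have h1 : inner ℂ (T (h i)) (T (h j)) = inner ℂ (h i) ((LinearMap.adjoint T * T) (h j)) := by
        rw [Module.End.mul_apply, LinearMap.adjoint_inner_right]
      rw [h1, hS.apply_eigenvectorBasis, inner_smul_right, ← hh, orthonormal_iff_ite.mp h.orthonormal,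
        if_neg hij, mul_zero]
  have hδ2 : δ ^ 2 < 1 := by nlinarith
  have hTpos : ∀ i, 0 < ‖T (h i)‖ := by
    intro i
    have h1 := hT2 (h i)
    rw [h.orthonormal.1 i] at h1
    by_contra h2
    have h3 : ‖T (h i)‖ = 0 := le_antisymm (not_lt.mp h2) (norm_nonneg _)
    rw [h3] at h1
    nlinarith
  set u : Fin (Module.finrank ℂ V) → V := fun i => ((‖T (h i)‖⁻¹ : ℝ) : ℂ) • T (h i) with hu
  have huo : Orthonormal ℂ u := by
    rw [orthonormal_iff_ite]
    intro i j
    rw [hu]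
    simp only [inner_smul_left, inner_smul_right, hinner, Complex.conj_ofReal]
    split_ifs with hij
    · rw [← hij, ← Complex.ofReal_mul, ← Complex.ofReal_mul]
      have := (hTpos i).ne'
      rw [show ‖T (h i)‖⁻¹ * (‖T (h i)‖⁻¹ * ‖T (h i)‖ ^ 2) = 1 by field_simp]
      simp
    · simp
  have hlin : Orthonormal ℂ ((h.toBasis.constr ℂ u) ∘ h.toBasis) := by
    convert huo using 1
    funext i
    simp
  set U0 : V →ₗᵢ[ℂ] V := (h.toBasis.constr ℂ u).isometryOfOrthonormal
    (by simp [h.orthonormal]) hlin with hU0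
  have hU0h : ∀ i, U0 (h i) = u i := by
    intro i
    have h1 : U0 (h i) = h.toBasis.constr ℂ u (h.toBasis i) := by
      rw [hU0, OrthonormalBasis.coe_toBasis]; rfl
    rw [h1, Module.Basis.constr_basis]
  refine ⟨U0.toLinearIsometryEquiv rfl, fun x => ?_⟩
  rw [LinearIsometry.coe_toLinearIsometryEquiv]
  set y : V := ∑ i, ((1 - ‖T (h i)‖ : ℝ) : ℂ) • (inner ℂ (h i) x) • h i with hy
  have hUy : U0 x - T x = U0 y := by
    conv_lhs => rw [← h.sum_repr' x]
    rw [map_sum, map_sum, hy, map_sum, ← Finset.sum_sub_distrib]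
    refine Finset.sum_congr rfl fun i _ => ?_
    rw [map_smul, map_smul, map_smul, map_smul, hU0h, ← smul_sub, smul_comm]
    congr 1
    have h1 : T (h i) = ((‖T (h i)‖ : ℝ) : ℂ) • u i := by
      rw [hu]
      simp only [smul_smul]
      rw [← Complex.ofReal_mul, mul_inv_cancel₀ (hTpos i).ne', Complex.ofReal_one, one_smul]
    conv_lhs => rw [h1]
    push_cast
    module
  rw [hUy, U0.norm_map]
  have hyi : ∀ i, inner ℂ (h i) y = ((1 - ‖T (h i)‖ : ℝ) : ℂ) * inner ℂ (h i) x := by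
    intro i
    rw [hy, inner_sum]
    simp only [inner_smul_right, orthonormal_iff_ite.mp h.orthonormal, mul_ite, mul_one, mul_zero,
      Finset.sum_ite_eq, Finset.mem_univ, if_true]
  have hcoef : ∀ i, |1 - ‖T (h i)‖| ≤ δ ^ 2 := by
    intro i
    have h1 := hT1 (h i)
    have h2 := hT2 (h i)
    rw [h.orthonormal.1 i] at h1 h2
    rw [abs_of_nonneg (by linarith)]
    nlinarith [norm_nonneg (T (h i))]
  rw [← sq_le_sq₀ (norm_nonneg _) (by positivity)]
  rw [← h.sum_sq_norm_inner_right y, mul_pow, ← h.sum_sq_norm_inner_right x, Finset.mul_sum]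
  refine Finset.sum_le_sum fun i _ => ?_
  rw [hyi, norm_mul, mul_pow, Complex.norm_real, Real.norm_eq_abs]
  gcongr
  exact hcoef i

variable [FiniteDimensional ℂ W] [CompleteSpace V] [CompleteSpace W]

/-- First-order perturbation theory: adding a small term `V₁` to a Hamiltonian `H₀` whose gapped
zero-energy space is the range of `E` simulates the restriction of `V₁` to that space. -/
theorem simulates_of_gap {H₀ V₁ : W →L[ℂ] W} {E : V →ₗᵢ[ℂ] W} {Ht : V →L[ℂ] V}
    (h₀ : (H₀ : W →ₗ[ℂ] W).IsSymmetric) (h₁ : (V₁ : W →ₗ[ℂ] W).IsSymmetric)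
    (hE : ∀ x, H₀ (E x) = 0) {g v δ ε : ℝ} (hg : 0 < g)
    (hgap : ∀ y, g * ‖y - E (ContinuousLinearMap.adjoint E.toContinuousLinearMap y)‖ ^ 2 ≤
      (inner ℂ y (H₀ y)).re)
    (hv : ‖V₁‖ ≤ v) (hδ0 : 0 ≤ δ) (hδ1 : δ < 1) (hδ : 2 * v ≤ g * δ ^ 2)
    (hε : ‖Ht - (ContinuousLinearMap.adjoint E.toContinuousLinearMap).comp
      (V₁.comp E.toContinuousLinearMap)‖ ≤ ε) :
    Simulates (H₀ + V₁) E Ht (2 * δ) (ε + 4 * v * δ) := by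
  have hv0 : 0 ≤ v := (norm_nonneg _).trans hv
  have hVle : ∀ x, ‖V₁ x‖ ≤ v * ‖x‖ := fun x => V₁.le_of_opNorm_le hv x
  set Ea := ContinuousLinearMap.adjoint E.toContinuousLinearMap with hEa
  have hEaE : ∀ x, Ea (E x) = x := by
    intro x
    refine ext_inner_right ℂ fun y => ?_
    rw [hEa, ContinuousLinearMap.adjoint_inner_left]
    exact E.inner_map_map x y
  have hEan : ‖Ea‖ ≤ 1 := by
    rw [hEa, LinearIsometryEquiv.norm_map]
    exact E.norm_toContinuousLinearMap_le
  have hEale : ∀ y, ‖Ea y‖ ≤ ‖y‖ := fun y => by simpa using Ea.le_of_opNorm_le hEan y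
  set H : W →L[ℂ] W := H₀ + V₁ with hHdef
  have hHs : (H : W →ₗ[ℂ] W).IsSymmetric := h₀.add h₁
  have hH₀pos : ∀ y, 0 ≤ (inner ℂ y (H₀ y)).re := fun y =>
    le_trans (mul_nonneg hg.le (sq_nonneg _)) (hgap y)
  have hVre : ∀ y, |(inner ℂ y (V₁ y)).re| ≤ v * ‖y‖ ^ 2 := fun y =>
    calc |(inner ℂ y (V₁ y)).re| ≤ ‖inner ℂ y (V₁ y)‖ := Complex.abs_re_le_norm _
      _ ≤ ‖y‖ * ‖V₁ y‖ := norm_inner_le_norm _ _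
      _ ≤ ‖y‖ * (v * ‖y‖) := by gcongr; exact hVle y
      _ = v * ‖y‖ ^ 2 := by ring
  have hHre : ∀ y, (inner ℂ y (H y)).re = (inner ℂ y (H₀ y)).re + (inner ℂ y (V₁ y)).re := by
    intro y
    rw [hHdef, _root_.add_apply, inner_add_right, Complex.add_re]
  -- the ordered eigenbasis
  set n := Module.finrank ℂ W with hn
  set D := Module.finrank ℂ V with hD
  have hDn : D ≤ n := LinearMap.finrank_le_finrank_of_injective (f := E.toLinearMap) E.injective
  set b : OrthonormalBasis (Fin n) ℂ W := (hHs.eigenvectorBasis rfl).reindex Fin.revPerm with hb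
  set e : Fin n → ℝ := fun i => hHs.eigenvalues rfl (Fin.rev i) with he
  have hemono : Monotone e := fun i j hij =>
    hHs.eigenvalues_antitone rfl (Fin.rev_le_rev.mpr hij)
  have hbe : ∀ i, H (b i) = (e i : ℂ) • b i := by
    intro i
    rw [hb, OrthonormalBasis.reindex_apply]
    exact hHs.apply_eigenvectorBasis rfl _
  have hle : ∀ i : Fin n, (i : ℕ) < D → e i ≤ v := by
    intro i hi
    -- Min-max: i < D linear conditions leave a nonzero x with E x orthogonal to the first i
    -- eigenvectors, and its energy is at most v because H₀ E = 0.
    let f : V →ₗ[ℂ] (Fin (i : ℕ) → ℂ) := LinearMap.pi fun j =>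
      (innerSL ℂ (b ⟨j, j.2.trans i.2⟩)).toLinearMap ∘ₗ E.toLinearMap
    have hf : LinearMap.ker f ≠ ⊥ := by
      apply LinearMap.ker_ne_bot_of_finrank_lt
      rw [Module.finrank_fin_fun]
      exact hi
    obtain ⟨x, hx, hx0⟩ := Submodule.exists_mem_ne_zero_of_ne_bot hf
    have hxj : ∀ j : Fin n, j < i → inner ℂ (b j) (E x) = 0 := by
      intro j hj
      exact congrFun (LinearMap.mem_ker.mp hx) (⟨j, hj⟩ : Fin (i : ℕ))
    have h2 := re_inner_eigen b e hHs hbe (E x)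
    have h3 : e i * ‖E x‖ ^ 2 ≤ ∑ j, e j * ‖inner ℂ (b j) (E x)‖ ^ 2 := by
      rw [← b.sum_sq_norm_inner_right, Finset.mul_sum]
      refine Finset.sum_le_sum fun j _ => ?_
      rcases lt_or_ge j i with hj | hj
      · simp [hxj j hj]
      · exact mul_le_mul_of_nonneg_right (hemono hj) (sq_nonneg _)
    have h4 : (inner ℂ (E x) (H (E x))).re ≤ v * ‖E x‖ ^ 2 := by
      rw [hHre, hE, inner_zero_right, Complex.zero_re, zero_add]
      exact (le_abs_self _).trans (hVre _)
    have h5 : 0 < ‖E x‖ ^ 2 := by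
      rw [E.norm_map]
      exact pow_pos (norm_pos_iff.mpr hx0) 2
    have h6 : e i * ‖E x‖ ^ 2 ≤ v * ‖E x‖ ^ 2 := h3.trans (h2.symm.le.trans h4)
    exact le_of_mul_le_mul_right h6 h5
  have hge : ∀ i, -v ≤ e i := by
    intro i
    have h2 : (inner ℂ (b i) (H (b i))).re = e i := by
      rw [hbe, inner_smul_right, inner_self_eq_norm_sq_to_K, b.orthonormal.1 i]
      simp
    rw [← h2, hHre]
    have h3 := hH₀pos (b i)
    have h4 := (abs_le.mp (hVre (b i))).1
    rw [b.orthonormal.1 i] at h4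
    linarith
  -- an isometry onto the low-energy space
  set f := stdOrthonormalBasis ℂ V with hf
  set w : Fin D → W := fun i => b (Fin.castLE hDn i) with hw
  have hwo : Orthonormal ℂ w := b.orthonormal.comp _ (Fin.castLE_injective hDn)
  have hfo : Orthonormal ℂ f.toBasis := by
    rw [OrthonormalBasis.coe_toBasis]
    exact f.orthonormal
  have hlin : Orthonormal ℂ ((f.toBasis.constr ℂ w) ∘ f.toBasis) := by
    convert hwo using 1
    funext i
    rw [Function.comp_apply, Module.Basis.constr_basis]
  set Q : V →ₗᵢ[ℂ] W := (f.toBasis.constr ℂ w).isometryOfOrthonormal hfo hlin with hQ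
  have hQf : ∀ i, Q (f i) = w i := by
    intro i
    have h2 : Q (f i) = f.toBasis.constr ℂ w (f.toBasis i) := by
      rw [hQ, OrthonormalBasis.coe_toBasis]; rfl
    rw [h2, Module.Basis.constr_basis]
  have hQrange : LinearMap.range Q.toLinearMap = Submodule.span ℂ (b '' {i | (i : ℕ) < D}) := by
    rw [← Submodule.map_top, ← f.toBasis.span_eq, Submodule.map_span, ← Set.range_comp]
    congr 1
    ext y
    constructor
    · rintro ⟨i, rfl⟩
      refine ⟨Fin.castLE hDn i, by simp, ?_⟩
      rw [Function.comp_apply, OrthonormalBasis.coe_toBasis]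
      exact (hQf i).symm
    · rintro ⟨i, hi, rfl⟩
      refine ⟨⟨i, hi⟩, ?_⟩
      rw [Function.comp_apply, OrthonormalBasis.coe_toBasis]
      exact hQf _
  have hQi : ∀ x (i : Fin n), D ≤ (i : ℕ) → inner ℂ (b i) (Q x) = 0 := by
    intro x i hi
    rw [← f.sum_repr' x, map_sum, inner_sum]
    refine Finset.sum_eq_zero fun j _ => ?_
    rw [map_smul, hQf, inner_smul_right, hw, b.orthonormal.2, mul_zero]
    intro h
    rw [h] at hi
    simp at hi
    omega
  have hHQ : ∀ x, ‖H (Q x)‖ ≤ v * ‖x‖ := by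
    intro x
    rw [← sq_le_sq₀ (norm_nonneg _) (by positivity), mul_pow, ← Q.norm_map x]
    have h2 := norm_sq_eigen b e hHs hbe (Q x)
    refine h2.le.trans ?_
    rw [← b.sum_sq_norm_inner_right, Finset.mul_sum]
    refine Finset.sum_le_sum fun i _ => ?_
    rcases lt_or_ge (i : ℕ) D with hi | hi
    · exact mul_le_mul_of_nonneg_right (sq_le_sq' (hge i) (hle i hi)) (sq_nonneg _)
    · simp [hQi x i hi]
  have hHQr : ∀ x, ∃ y, H (Q x) = Q y := by
    intro x
    refine ⟨∑ i, inner ℂ (f i) x • (e (Fin.castLE hDn i) : ℂ) • f i, ?_⟩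
    conv_lhs => rw [← f.sum_repr' x]
    simp only [map_sum, map_smul, hQf, hw, hbe]
  -- the low-energy space is close to the range of `E`
  have hR : ∀ x, ‖Q x - E (Ea (Q x))‖ ≤ δ * ‖x‖ := by
    intro x
    rw [← sq_le_sq₀ (norm_nonneg _) (by positivity), mul_pow]
    -- Total energy at most v and V₁ ≥ -v leave at most 2v for H₀, which charges g per unit of
    -- leakage.
    have h2 : (inner ℂ (Q x) (H (Q x))).re ≤ v * ‖x‖ ^ 2 :=
      calc (inner ℂ (Q x) (H (Q x))).re ≤ ‖Q x‖ * ‖H (Q x)‖ :=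
            (Complex.re_le_norm _).trans (norm_inner_le_norm _ _)
        _ ≤ ‖x‖ * (v * ‖x‖) := by rw [Q.norm_map]; gcongr; exact hHQ x
        _ = v * ‖x‖ ^ 2 := by ring
    have h3 := (abs_le.mp (hVre (Q x))).1
    have h4 := hgap (Q x)
    rw [hHre] at h2
    rw [Q.norm_map] at h3
    have h5 : g * ‖Q x - E (Ea (Q x))‖ ^ 2 ≤ g * (δ ^ 2 * ‖x‖ ^ 2) := by
      nlinarith [sq_nonneg ‖x‖]
    exact le_of_mul_le_mul_left h5 hg
  have hpyth : ∀ y, ‖y‖ ^ 2 = ‖Ea y‖ ^ 2 + ‖y - E (Ea y)‖ ^ 2 := by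
    intro y
    have h2 : inner ℂ (E (Ea y)) (y - E (Ea y)) = 0 := by
      have h3 : inner ℂ (E (Ea y)) (y - E (Ea y)) = inner ℂ (Ea y) (Ea (y - E (Ea y))) := by
        rw [hEa, ContinuousLinearMap.adjoint_inner_right]; rfl
      rw [h3, map_sub, hEaE, sub_self, inner_zero_right]
    have h3 := norm_add_sq_eq_norm_sq_add_norm_sq_of_inner_eq_zero _ _ h2
    rw [add_sub_cancel, E.norm_map] at h3
    linarith [h3]
  obtain ⟨U, hU⟩ := exists_unitary_near (Ea.toLinearMap ∘ₗ Q.toLinearMap) hδ1 hδ0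
    (fun x => (hEale _).trans_eq (Q.norm_map x))
    (fun x => by
      have h2 := hpyth (Q x)
      have h3 := hR x
      rw [Q.norm_map] at h2
      have h4 : ‖Q x - E (Ea (Q x))‖ ^ 2 ≤ (δ * ‖x‖) ^ 2 := by gcongr
      change (1 - δ ^ 2) * ‖x‖ ^ 2 ≤ ‖Ea (Q x)‖ ^ 2
      nlinarith)
  -- Undoing the polar factor of E†Q aligns the basis of the low-energy space with E.
  set E' : V →ₗᵢ[ℂ] W := Q.comp U.symm.toLinearIsometry with hE'
  have hE'x : ∀ x, E' x = Q (U.symm x) := fun x => rfl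
  have hE'range : LinearMap.range E'.toLinearMap = LinearMap.range Q.toLinearMap := by
    ext y
    constructor
    · rintro ⟨x, rfl⟩
      exact ⟨U.symm x, rfl⟩
    · rintro ⟨x, rfl⟩
      exact ⟨U x, by change Q (U.symm (U x)) = Q x; rw [U.symm_apply_apply]⟩
  have hEE' : ∀ x, ‖E x - E' x‖ ≤ 2 * δ * ‖x‖ := by
    intro x
    obtain ⟨y, rfl⟩ := U.surjective x
    rw [hE'x, U.symm_apply_apply, U.norm_map]
    have h2 : E (U y) - Q y = E (U y - Ea (Q y)) - (Q y - E (Ea (Q y))) := by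
      rw [map_sub]; abel
    rw [h2]
    have h3 := hU y
    change ‖U y - Ea (Q y)‖ ≤ _ at h3
    calc _ ≤ ‖E (U y - Ea (Q y))‖ + ‖Q y - E (Ea (Q y))‖ := norm_sub_le _ _
      _ ≤ δ ^ 2 * ‖y‖ + δ * ‖y‖ := by
        rw [E.norm_map]
        exact add_le_add h3 (hR y)
      _ ≤ 2 * δ * ‖y‖ := by nlinarith [norm_nonneg y, mul_nonneg hδ0 (norm_nonneg y)]
  set Ea' := ContinuousLinearMap.adjoint E'.toContinuousLinearMap with hEa'
  have hEaE' : ∀ x, Ea' (E' x) = x := by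
    intro x
    refine ext_inner_right ℂ fun y => ?_
    rw [hEa', ContinuousLinearMap.adjoint_inner_left]
    exact E'.inner_map_map x y
  have hK : ∀ x, E' (Ea' (H (E' x))) = H (E' x) := by
    intro x
    obtain ⟨y, hy⟩ := hHQr (U.symm x)
    have h2 : H (E' x) = E' (U y) := by rw [hE'x, hE'x, hy, U.symm_apply_apply]
    rw [h2, hEaE']
  refine ⟨E', ⟨hDn, b, e, hemono, hbe, hE'range.trans hQrange⟩, ?_, ?_⟩
  · refine ContinuousLinearMap.opNorm_le_bound _ (by
      have := (norm_nonneg _).trans hε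
      positivity) fun x => ?_
    set k := Ea' (H (E' x)) with hk
    have hkn : ‖k‖ ≤ v * ‖x‖ := by
      rw [← E'.norm_map, hk, hK, hE'x]
      simpa using hHQ (U.symm x)
    -- E†H₀ = (H₀E)† = 0 removes the large term, so the error involves only v, never the norm of H₀.
    have h2 : Ea (E' k) = Ea (V₁ (E' x)) := by
      rw [hk, hK, hHdef, _root_.add_apply, map_add]
      have h3 : Ea (H₀ (E' x)) = 0 := by
        refine ext_inner_right ℂ fun y => ?_
        rw [hEa, ContinuousLinearMap.adjoint_inner_left, inner_zero_left]
        have h4 := h₀ (E' x) (E y)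
        refine h4.trans ?_
        change inner ℂ (E' x) (H₀ (E y)) = 0
        rw [hE, inner_zero_right]
      rw [h3, zero_add]
    have h3 : (Ht - Ea'.comp (H.comp E'.toContinuousLinearMap)) x =
        (Ht - Ea.comp (V₁.comp E.toContinuousLinearMap)) x - Ea (E k - E' k) +
          Ea (V₁ (E x - E' x)) := by
      change Ht x - k = Ht x - Ea (V₁ (E x)) - Ea (E k - E' k) + Ea (V₁ (E x - E' x))
      rw [map_sub, hEaE, h2, map_sub, map_sub]
      abel
    rw [h3]
    calc _ ≤ ‖(Ht - Ea.comp (V₁.comp E.toContinuousLinearMap)) x‖ + ‖Ea (E k - E' k)‖ +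
          ‖Ea (V₁ (E x - E' x))‖ := (norm_add_le _ _).trans (add_le_add (norm_sub_le _ _) le_rfl)
      _ ≤ ε * ‖x‖ + 2 * δ * (v * ‖x‖) + v * (2 * δ * ‖x‖) := by
        refine add_le_add (add_le_add (ContinuousLinearMap.le_of_opNorm_le _ hε x) ?_) ?_
        · refine (hEale _).trans ((hEE' k).trans ?_)
          gcongr
        · refine (hEale _).trans ((hVle _).trans ?_)
          gcongr
          exact hEE' x
      _ = (ε + 4 * v * δ) * ‖x‖ := by ring
  · exact ContinuousLinearMap.opNorm_le_bound _ (by positivity) hEE'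

end Perturbation

/-! ### The gap of a sum of independent blocks -/

section BlockGap

variable {ι α β : Type*} [Fintype ι] [DecidableEq ι] [Fintype α] [DecidableEq α]

theorem site_mono {A B : Matrix α α ℂ} (h : A ≤ B) (i : ι) : site i A ≤ site i B := by
  rw [Matrix.le_iff] at h ⊢
  rw [← site_sub]
  exact site_posSemidef h i

/-- The union bound for commuting projections at different sites. -/
theorem one_sub_piTensor_le_sum {P : Matrix α α ℂ} (h1 : Pᴴ = P) (h2 : P * P = P) :
    1 - piTensor (fun _ : ι => P) ≤ ∑ b : ι, site b (1 - P) := by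
  -- Adding one site at a time, the commuting projections 1 - `site c P` and 1 - R have a positive
  -- product.
  have key : ∀ S : Finset ι,
      1 - piTensor (fun b : ι => if b ∈ S then P else 1) ≤ ∑ b ∈ S, site b (1 - P) := by
    intro S
    induction S using Finset.induction_on with
    | empty => simp [piTensor_one]
    | insert c S hc ih =>
      set R := piTensor (fun b : ι => if b ∈ S then P else 1) with hR
      have hRh : Rᴴ = R := by
        rw [hR, piTensor_conjTranspose]
        congr 1
        funext b
        split_ifs <;> simp [h1]
      have hRR : R * R = R := by
        rw [hR, piTensor_mul]
        congr 1
        funext b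
        split_ifs <;> simp [h2]
      have hins : piTensor (fun b : ι => if b ∈ insert c S then P else 1) = site c P * R := by
        rw [site, hR, piTensor_mul]
        congr 1
        funext b
        rcases eq_or_ne b c with rfl | hb
        · simp [hc]
        · simp [hb]
      have hcomm : site c P * R = R * site c P := by
        rw [site, hR, piTensor_mul, piTensor_mul]
        congr 1
        funext b
        rcases eq_or_ne b c with rfl | hb
        · simp [hc]
        · simp [hb]
      have hph : (site c P)ᴴ = site c P := by rw [site_conjTranspose, h1]
      have hpp : site c P * site c P = site c P := by rw [site_mul, h2]
      have hpos : 0 ≤ (1 - site c P) * (1 - R) := by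
        apply nonneg_of_projection
        · rw [Matrix.conjTranspose_mul, Matrix.conjTranspose_sub, Matrix.conjTranspose_sub,
            Matrix.conjTranspose_one, hRh, hph]
          simp only [mul_sub, sub_mul, one_mul, mul_one, hcomm]
          abel
        · have h3 : (1 - R) * (1 - site c P) = (1 - site c P) * (1 - R) := by
            simp only [mul_sub, sub_mul, one_mul, mul_one, hcomm]
            abel
          have h4 : (1 - site c P) * (1 - site c P) = 1 - site c P := by
            simp [mul_sub, sub_mul, hpp]
          have h5 : (1 - R) * (1 - R) = 1 - R := by
            simp [mul_sub, sub_mul, hRR]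
          calc (1 - site c P) * (1 - R) * ((1 - site c P) * (1 - R))
              = (1 - site c P) * ((1 - R) * (1 - site c P)) * (1 - R) := by
                simp only [mul_assoc]
            _ = (1 - site c P) * (1 - site c P) * ((1 - R) * (1 - R)) := by
                rw [h3]; simp only [mul_assoc]
            _ = _ := by rw [h4, h5]
      rw [hins, Finset.sum_insert hc, site_sub, site_one]
      calc 1 - site c P * R ≤ 1 - site c P * R + (1 - site c P) * (1 - R) :=
            le_add_of_nonneg_right hpos
        _ = (1 - site c P) + (1 - R) := by
            simp only [mul_sub, sub_mul, one_mul, mul_one]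
            abel
        _ ≤ _ := add_le_add le_rfl ih
  simpa using key Finset.univ

/-- A gap of the blocks is a gap of their sum. -/
theorem sum_site_gap [Fintype β] [DecidableEq β] {φ : Matrix α β ℂ} (hφ : φᴴ * φ = 1)
    {K : Matrix α α ℂ} {g : ℝ} (hg : 0 ≤ g) (h : (g : ℂ) • (1 - φ * φᴴ) ≤ K) :
    (g : ℂ) • (1 - (piTensor fun _ : ι => φ) * (piTensor fun _ : ι => φ)ᴴ) ≤
      ∑ b : ι, site b K := by
  have h1 : (φ * φᴴ)ᴴ = φ * φᴴ := by
    rw [Matrix.conjTranspose_mul, Matrix.conjTranspose_conjTranspose]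
  have h2 : (φ * φᴴ) * (φ * φᴴ) = φ * φᴴ := by
    rw [Matrix.mul_assoc, ← Matrix.mul_assoc φᴴ, hφ, Matrix.one_mul]
  have h3 := one_sub_piTensor_le_sum (ι := ι) h1 h2
  rw [piTensor_conjTranspose, piTensor_mul]
  have h4 : (g : ℂ) • (1 - piTensor fun _ : ι => φ * φᴴ) ≤
      (g : ℂ) • ∑ b : ι, site b (1 - φ * φᴴ) := by
    rw [← sub_nonneg, ← smul_sub]
    exact smul_nonneg_matrix hg (sub_nonneg.mpr h3)
  refine h4.trans ?_
  rw [Finset.smul_sum]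
  refine Finset.sum_le_sum fun b _ => ?_
  rw [← site_smul]
  exact site_mono h b

end BlockGap

/-! ### The perturbation lemma in matrix form -/

section MatrixSimulation

variable {σ τ : Type*} [Fintype σ] [DecidableEq σ] [Fintype τ] [DecidableEq τ]

/-- The isometry of Euclidean spaces given by a matrix with orthonormal columns. -/
def matrixIsometry (M : Matrix σ τ ℂ) (hM : Mᴴ * M = 1) :
    EuclideanSpace ℂ τ →ₗᵢ[ℂ] EuclideanSpace ℂ σ where
  toLinearMap := Matrix.toEuclideanLin M
  norm_map' x := by
    have h : inner ℂ (Matrix.toEuclideanLin M x) (Matrix.toEuclideanLin M x) = inner ℂ x x := by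
      rw [← LinearMap.adjoint_inner_right, ← Matrix.toEuclideanLin_conjTranspose_eq_adjoint]
      congr 1
      simp only [Matrix.toLpLin_apply, Matrix.mulVec_mulVec, hM, Matrix.one_mulVec]
    rw [@norm_eq_sqrt_re_inner ℂ, @norm_eq_sqrt_re_inner ℂ _ _ _ _ x, h]

theorem matrixIsometry_apply (M : Matrix σ τ ℂ) (hM : Mᴴ * M = 1) (x : EuclideanSpace ℂ τ) :
    matrixIsometry M hM x = Matrix.toEuclideanLin M x := rfl

theorem adjoint_matrixIsometry_apply (M : Matrix σ τ ℂ) (hM : Mᴴ * M = 1)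
    (y : EuclideanSpace ℂ σ) :
    ContinuousLinearMap.adjoint (matrixIsometry M hM).toContinuousLinearMap y =
      Matrix.toEuclideanLin Mᴴ y := by
  refine ext_inner_right ℂ fun x => ?_
  rw [ContinuousLinearMap.adjoint_inner_left, Matrix.toEuclideanLin_conjTranspose_eq_adjoint,
    LinearMap.adjoint_inner_left]
  rfl

theorem toEuclideanCLM_apply (A : Matrix σ σ ℂ) (x : EuclideanSpace ℂ σ) :
    Matrix.toEuclideanCLM (𝕜 := ℂ) A x = Matrix.toEuclideanLin A x := by
  rw [← Matrix.coe_toEuclideanCLM_eq_toEuclideanLin]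
  rfl

theorem isSymmetric_toEuclideanCLM {A : Matrix σ σ ℂ} (hA : Aᴴ = A) :
    (Matrix.toEuclideanCLM (𝕜 := ℂ) A : EuclideanSpace ℂ σ →ₗ[ℂ] EuclideanSpace ℂ σ).IsSymmetric := by
  rw [Matrix.coe_toEuclideanCLM_eq_toEuclideanLin, Matrix.isSymmetric_toEuclideanLin_iff]
  exact hA

theorem re_inner_toEuclideanCLM_nonneg {A : Matrix σ σ ℂ} (hA : 0 ≤ A) (y : EuclideanSpace ℂ σ) :
    0 ≤ (inner ℂ y (Matrix.toEuclideanCLM (𝕜 := ℂ) A y)).re := by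
  rw [Matrix.nonneg_iff_posSemidef, ← Matrix.isPositive_toEuclideanLin_iff] at hA
  rw [toEuclideanCLM_apply]
  exact hA.re_inner_nonneg_right y

/-- First-order perturbation theory for matrices. -/
theorem simulates_of_matrix_gap {M : Matrix σ τ ℂ} (hM : Mᴴ * M = 1) {H₀ V₁ : Matrix σ σ ℂ}
    {Ht : Matrix τ τ ℂ} (h₀ : H₀ᴴ = H₀) (h₁ : V₁ᴴ = V₁) (hE : H₀ * M = 0)
    {g v δ ε : ℝ} (hg : 0 < g) (hgap : (g : ℂ) • (1 - M * Mᴴ) ≤ H₀)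
    (hv : ‖V₁‖ ≤ v) (hδ0 : 0 ≤ δ) (hδ1 : δ < 1) (hδ : 2 * v ≤ g * δ ^ 2)
    (hε : ‖Ht - Mᴴ * V₁ * M‖ ≤ ε) :
    Simulates (Matrix.toEuclideanCLM (𝕜 := ℂ) (H₀ + V₁)) (matrixIsometry M hM)
      (Matrix.toEuclideanCLM (𝕜 := ℂ) Ht) (2 * δ) (ε + 4 * v * δ) := by
  rw [map_add]
  refine simulates_of_gap (isSymmetric_toEuclideanCLM h₀) (isSymmetric_toEuclideanCLM h₁) ?_ hg ?_
    hv hδ0 hδ1 hδ ?_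
  · intro x
    rw [toEuclideanCLM_apply, matrixIsometry_apply]
    simp only [Matrix.toLpLin_apply, Matrix.mulVec_mulVec, hE, Matrix.zero_mulVec]
    rfl
  · intro y
    have h2 := re_inner_toEuclideanCLM_nonneg (sub_nonneg.mpr hgap) y
    rw [map_sub, map_smul, _root_.sub_apply, inner_sub_right, Complex.sub_re,
      _root_.smul_apply, inner_smul_right, Complex.re_ofReal_mul] at h2
    refine le_trans (le_of_eq ?_) (sub_nonneg.mp h2)
    congr 1
    -- The component of y outside the range of M is its image under the projection 1 - M M†, so its
    -- squared norm is the quadratic form of that projection.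
    set y' := y - matrixIsometry M hM
      (ContinuousLinearMap.adjoint (matrixIsometry M hM).toContinuousLinearMap y) with hy'
    have h3 : y' = Matrix.toEuclideanCLM (𝕜 := ℂ) (1 - M * Mᴴ) y := by
      rw [hy', adjoint_matrixIsometry_apply, matrixIsometry_apply, map_sub, map_one,
        _root_.sub_apply, toEuclideanCLM_apply]
      simp only [Matrix.toLpLin_apply, Matrix.mulVec_mulVec]
      rfl
    have h4 : (1 - M * Mᴴ)ᴴ = 1 - M * Mᴴ := by
      simp
    have h5 : (1 - M * Mᴴ) * (1 - M * Mᴴ) = 1 - M * Mᴴ := by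
      have : M * Mᴴ * (M * Mᴴ) = M * Mᴴ := by
        rw [Matrix.mul_assoc, ← Matrix.mul_assoc Mᴴ, hM, Matrix.one_mul]
      simp [mul_sub, sub_mul, this]
    have h6 : (‖y'‖ ^ 2 : ℝ) = (inner ℂ y' y').re := by
      rw [inner_self_eq_norm_sq_to_K]; norm_cast
    rw [h6, h3]
    have h7 := isSymmetric_toEuclideanCLM h4 y
      (Matrix.toEuclideanCLM (𝕜 := ℂ) (1 - M * Mᴴ) y)
    refine congrArg Complex.re (h7.trans ?_)
    have h8 : ∀ A : Matrix σ σ ℂ, Matrix.toEuclideanCLM (𝕜 := ℂ) A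
        (Matrix.toEuclideanCLM (𝕜 := ℂ) A y) = Matrix.toEuclideanCLM (𝕜 := ℂ) (A * A) y := by
      intro A
      rw [map_mul]
      rfl
    exact congrArg (inner ℂ y) ((h8 _).trans (by rw [h5]))
  · refine le_trans (le_of_eq ?_) hε
    rw [Matrix.cstar_norm_def]
    congr 1
    ext1 x
    rw [map_sub, _root_.sub_apply, _root_.sub_apply]
    congr 1
    change ContinuousLinearMap.adjoint (matrixIsometry M hM).toContinuousLinearMap
      (Matrix.toEuclideanCLM (𝕜 := ℂ) V₁ (matrixIsometry M hM x)) = _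
    rw [adjoint_matrixIsometry_apply, toEuclideanCLM_apply, toEuclideanCLM_apply,
      matrixIsometry_apply]
    simp only [Matrix.toLpLin_apply, Matrix.mulVec_mulVec, Matrix.mul_assoc]

end MatrixSimulation

/-! ### Operator norm bounds -/

section Norms

theorem l2_norm_eq_one_of_isometry {σ τ : Type*} [Fintype σ] [DecidableEq σ] [Fintype τ]
    [DecidableEq τ] [Nonempty τ] {M : Matrix σ τ ℂ} (hM : Mᴴ * M = 1) : ‖M‖ = 1 := by
  have h := Matrix.l2_opNorm_conjTranspose_mul_self M
  rw [hM, CStarRing.norm_one] at h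
  nlinarith [norm_nonneg M]

theorem l2_norm_site_mul_site {n : ℕ} {A B : Matrix (Fin 2) (Fin 2) ℂ} (hA : Aᴴ * A = 1)
    (hB : Bᴴ * B = 1) (i j : Fin n) : ‖site i A * site j B‖ = 1 := by
  apply l2_norm_eq_one_of_isometry
  rw [Matrix.conjTranspose_mul, Matrix.mul_assoc, ← Matrix.mul_assoc (site i A)ᴴ,
    site_conjTranspose i, site_mul i, hA, site_one, Matrix.one_mul, site_conjTranspose, site_mul, hB,
    site_one]

theorem norm_site_pauliX {n : ℕ} (i j : Fin n) : ‖site i pauliX * site j pauliX‖ = 1 :=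
  have h : pauliXᴴ * pauliX = 1 := by rw [pauliX_conjTranspose, pauliX_mul_self]
  l2_norm_site_mul_site h h i j

theorem norm_site_pauliY {n : ℕ} (i j : Fin n) : ‖site i pauliY * site j pauliY‖ = 1 :=
  have h : pauliYᴴ * pauliY = 1 := by rw [pauliY_conjTranspose, pauliY_mul_self]
  l2_norm_site_mul_site h h i j

theorem norm_site_pauliZ {n : ℕ} (i j : Fin n) : ‖site i pauliZ * site j pauliZ‖ = 1 :=
  have h : pauliZᴴ * pauliZ = 1 := by rw [pauliZ_conjTranspose, pauliZ_mul_self]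
  l2_norm_site_mul_site h h i j

theorem norm_axx_sub_zz_le {n : ℕ} {a : ℝ} (ha : 0 ≤ a) (i j : Fin n) :
    ‖(a : ℂ) • (site i pauliX * site j pauliX) - site i pauliZ * site j pauliZ‖ ≤ a + 1 := by
  refine (norm_sub_le _ _).trans ?_
  rw [norm_smul, norm_site_pauliX, norm_site_pauliZ, Complex.norm_real, Real.norm_eq_abs,
    abs_of_nonneg ha, mul_one]

theorem norm_chainHamiltonian_le {a : ℝ} (ha : 0 ≤ a) (d : ℕ) :
    ‖chainHamiltonian a d‖ ≤ (d * 2) * (a + 1) := by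
  refine (norm_sum_le _ _).trans ((Finset.sum_le_sum fun i _ => norm_axx_sub_zz_le ha _ _).trans ?_)
  simp [mul_add]

theorem abs_eigenvalue_le {σ τ : Type*} [Fintype σ] [DecidableEq σ] [Fintype τ]
    [DecidableEq τ] [Nonempty τ] {A : Matrix σ σ ℂ} {M : Matrix σ τ ℂ} {E : ℝ} (hM : Mᴴ * M = 1)
    (h : A * M = (E : ℂ) • M) : |E| ≤ ‖A‖ := by
  have h1 := Matrix.l2_opNorm_mul A M
  rwa [h, norm_smul, l2_norm_eq_one_of_isometry hM, mul_one, mul_one, Complex.norm_real,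
    Real.norm_eq_abs] at h1

end Norms

/-! ### Hamiltonians built from one type of term -/

section Terms

variable {n : ℕ}

theorem onQubits_smul (c : ℂ) (A : TwoQubitOp) (i j : Fin n) :
    onQubits (c • A) i j = c • onQubits A i j := by
  ext x y
  simp [onQubits]

theorem onQubits_sub (A B : TwoQubitOp) (i j : Fin n) :
    onQubits (A - B) i j = onQubits A i j - onQubits B i j := by
  ext x y
  simp only [onQubits, Matrix.of_apply, Matrix.sub_apply]
  split_ifs <;> simp

theorem onQubits_neg (A : TwoQubitOp) (i j : Fin n) : onQubits (-A) i j = -onQubits A i j := by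
  simpa using onQubits_smul (-1) A i j

theorem onQubits_axx_sub_zz (a : ℝ) {i j : Fin n} (hij : i ≠ j) :
    onQubits ((a : ℂ) • termXX - termZZ) i j =
      (a : ℂ) • (site i pauliX * site j pauliX) - site i pauliZ * site j pauliZ := by
  rw [onQubits_sub, onQubits_smul, termXX, termZZ, onQubits_kronecker _ _ hij,
    onQubits_kronecker _ _ hij]

theorem onQubits_axx_sub_zz_conjTranspose (a : ℝ) {i j : Fin n} (hij : i ≠ j) :
    (onQubits ((a : ℂ) • termXX - termZZ) i j)ᴴ = onQubits ((a : ℂ) • termXX - termZZ) i j := by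
  rw [onQubits_axx_sub_zz a hij, Matrix.conjTranspose_sub, Matrix.conjTranspose_smul,
    Matrix.conjTranspose_mul, Matrix.conjTranspose_mul]
  simp only [site_conjTranspose, pauliX_conjTranspose, pauliZ_conjTranspose]
  rw [site_comm hij.symm, site_comm hij.symm]
  congr 2
  exact Complex.conj_ofReal a

/-- The `S`-Hamiltonian with a single type of term, indexed by an arbitrary finite type. -/
def PlusHamiltonian.ofFintype {S : Set TwoQubitOp} {κ : Type*} [Fintype κ] {A : TwoQubitOp}
    (hA : A ∈ S) (i j : κ → Fin n) (hij : ∀ l, i l ≠ j l) (w : κ → ℝ) (hw : ∀ l, 0 < w l) :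
    PlusHamiltonian S n where
  numTerms := Fintype.card κ
  term _ := A
  term_mem _ := hA
  fst l := i ((Fintype.equivFin κ).symm l)
  snd l := j ((Fintype.equivFin κ).symm l)
  fst_ne_snd _ := hij _
  weight l := w ((Fintype.equivFin κ).symm l)
  weight_pos _ := hw _

theorem PlusHamiltonian.toMatrix_ofFintype {S : Set TwoQubitOp} {κ : Type*} [Fintype κ]
    {A : TwoQubitOp} (hA : A ∈ S) (i j : κ → Fin n) (hij : ∀ l, i l ≠ j l) (w : κ → ℝ)
    (hw : ∀ l, 0 < w l) :
    (PlusHamiltonian.ofFintype hA i j hij w hw).toMatrix =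
      ∑ l, (w l : ℂ) • onQubits A (i l) (j l) :=
  (Fintype.equivFin κ).symm.sum_comp fun l => (w l : ℂ) • onQubits A (i l) (j l)

end Terms

/-! ### Positive weights for the two target terms -/

section Gadget

/-- The encoded interactions of two blocks combine with positive weights to each target term. -/
theorem exists_gadget_weights {a x z t t' ρ x₀ t₀ : ℝ} (ha : 1 < a) (hρ : 0 < ρ) (hρ1 : ρ ≤ 1)
    (hx₀ : 0 < x₀) (ht₀ : 0 < t₀) (hx : x₀ ≤ x ^ 2) (hz : z ^ 2 = x ^ 2 * ρ ^ 2) (ht : t ≤ -t₀)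
    (ht' : 0 ≤ t') {A : TwoQubitOp} (hA : A ∈ ({termXX, -termYY} : Set TwoQubitOp)) :
    ∃ (s : Bool → Bool) (ω : Bool → ℝ), (∀ i, 0 < ω i) ∧
      (∀ i, ω i ≤ (x₀⁻¹ + (x₀ * t₀)⁻¹) * (ρ ^ 2)⁻¹) ∧
      ∀ (n : ℕ) (b c : Fin n), b ≠ c →
        ‖onQubits A b c - ∑ i, (ω i : ℂ) •
          (((a * (x * (x * if s i then t else 1)) : ℝ) : ℂ) • (site b pauliX * site c pauliX) -
            ((z * (z * if s i then t' else 1) : ℝ) : ℂ) • (site b pauliY * site c pauliY))‖ ≤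
          ρ ^ 2 := by
  have hxp : 0 < x ^ 2 := hx₀.trans_le hx
  have hzp : 0 < z ^ 2 := by rw [hz]; positivity
  have hxn : x ≠ 0 := pow_ne_zero_iff two_ne_zero |>.mp hxp.ne'
  have hzn : z ≠ 0 := pow_ne_zero_iff two_ne_zero |>.mp hzp.ne'
  have hz0 : x₀ * ρ ^ 2 ≤ z ^ 2 := by rw [hz]; gcongr
  have hρ2 : ρ ^ 2 ≤ 1 := pow_le_one₀ hρ.le hρ1
  have hxi : x₀⁻¹ ≤ x₀⁻¹ * (ρ ^ 2)⁻¹ :=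
    le_mul_of_one_le_right (by positivity) ((one_le_inv₀ (by positivity)).mpr hρ2)
  have hB : 0 < (x₀ * t₀)⁻¹ * (ρ ^ 2)⁻¹ := by positivity
  have hB' : 0 < x₀⁻¹ * (ρ ^ 2)⁻¹ := by positivity
  rcases hA with rfl | rfl
  -- For XX the same interaction is used twice at half weight, to match the two-term format required
  -- by YY. The residue is (ρ²/a) YY.
  · refine ⟨fun _ => false, fun _ => (2 * (a * x ^ 2))⁻¹, fun _ => by positivity, fun _ => ?_, ?_⟩
    · have h1 : (2 * (a * x ^ 2))⁻¹ ≤ x₀⁻¹ := by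
        apply inv_anti₀ hx₀
        nlinarith
      rw [add_mul]
      linarith
    · intro n b c hbc
      have h1 : onQubits termXX b c - ∑ i : Bool, (((2 * (a * x ^ 2))⁻¹ : ℝ) : ℂ) •
          (((a * (x * (x * if (fun _ : Bool => false) i then t else 1)) : ℝ) : ℂ) •
            (site b pauliX * site c pauliX) -
            ((z * (z * if (fun _ : Bool => false) i then t' else 1) : ℝ) : ℂ) •
              (site b pauliY * site c pauliY)) =
          ((ρ ^ 2 / a : ℝ) : ℂ) • (site b pauliY * site c pauliY) := by
        rw [termXX, onQubits_kronecker _ _ hbc, Fintype.sum_bool]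
        simp only [smul_sub, smul_smul, ← Complex.ofReal_mul, Bool.false_eq_true, if_false, mul_one]
        have h2 : (2 * (a * x ^ 2))⁻¹ * (a * (x * x)) = 1 / 2 := by
          field_simp
        have h3 : (2 * (a * x ^ 2))⁻¹ * (z * z) = ρ ^ 2 / a / 2 := by
          rw [← pow_two, hz]
          field_simp
        rw [h2, h3]
        push_cast
        module
      rw [h1, norm_smul, norm_site_pauliY, mul_one, Complex.norm_real, Real.norm_eq_abs,
        abs_of_nonneg (by positivity)]
      exact div_le_self (by positivity) ha.le
  · have htt : 0 < -t + t' := by linarith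
    have ht1 : 0 < -t := by linarith
    -- Relative weights 1 and -t cancel XX identically; the common factor normalizes the YY
    -- coefficient, so this term is simulated without encoding error.
    refine ⟨fun i => i, fun i => (if i then 1 else -t) * (z ^ 2 * (-t + t'))⁻¹, fun i => ?_,
      fun i => ?_, ?_⟩
    · dsimp only
      split_ifs
      · positivity
      · positivity
    · rw [add_mul]
      dsimp only
      split_ifs
      · have h1 : (z ^ 2 * (-t + t'))⁻¹ ≤ (x₀ * ρ ^ 2 * t₀)⁻¹ := by
          apply inv_anti₀ (by positivity)
          gcongr
          linarith
        have h2 : (x₀ * ρ ^ 2 * t₀)⁻¹ = (x₀ * t₀)⁻¹ * (ρ ^ 2)⁻¹ := by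
          rw [← mul_inv]; ring_nf
        linarith
      · have h1 : -t * (z ^ 2 * (-t + t'))⁻¹ ≤ (x₀ * ρ ^ 2)⁻¹ := by
          rw [← div_eq_mul_inv, div_le_iff₀ (by positivity), ← div_eq_inv_mul,
            le_div_iff₀ (by positivity)]
          have h2 : -t * (x₀ * ρ ^ 2) ≤ -t * z ^ 2 := by gcongr
          nlinarith
        rw [mul_inv x₀] at h1
        linarith
    · intro n b c hbc
      refine le_trans (le_of_eq ?_) (sq_nonneg ρ)
      rw [norm_eq_zero, sub_eq_zero, onQubits_neg, termYY, onQubits_kronecker _ _ hbc,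
        Fintype.sum_bool]
      simp only [smul_sub, smul_smul, ← Complex.ofReal_mul, Bool.false_eq_true, if_false, if_true,
        mul_one, one_mul]
      set X := site b pauliX * site c pauliX
      set Y := site b pauliY * site c pauliY
      set lam := (z ^ 2 * (-t + t'))⁻¹ with hlam
      have h1 : lam * (z * (z * t')) + -t * lam * (z * z) = 1 := by
        rw [hlam]
        field_simp
        ring
      have h2 : lam * (a * (x * (x * t))) + -t * lam * (a * (x * x)) = 0 := by ring
      have h3 : ((lam * (z * (z * t')) : ℝ) : ℂ) + ((-t * lam * (z * z) : ℝ) : ℂ) = 1 := by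
        rw [← Complex.ofReal_add, h1, Complex.ofReal_one]
      have h4 : ((lam * (a * (x * (x * t))) : ℝ) : ℂ) + ((-t * lam * (a * (x * x)) : ℝ) : ℂ) = 0 := by
        rw [← Complex.ofReal_add, h2, Complex.ofReal_zero]
      rw [sub_add_sub_comm, ← add_smul, ← add_smul, h3, h4]
      simp

end Gadget

/-! ### Assembling the simulator from encoded blocks -/

section Assembly

variable {n k : ℕ}

/-- Transport of operators on `n` blocks of `k` qubits to `n * k` qubits. -/
def blockAlgEquiv (n k : ℕ) :
    Matrix (Fin n → Fin k → Fin 2) (Fin n → Fin k → Fin 2) ℂ ≃ₐ[ℂ]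
      Matrix (Fin (n * k) → Fin 2) (Fin (n * k) → Fin 2) ℂ :=
  Matrix.reindexAlgEquiv ℂ ℂ (blockEquiv n k).symm

theorem blockAlgEquiv_apply (A : Matrix (Fin n → Fin k → Fin 2) (Fin n → Fin k → Fin 2) ℂ) :
    blockAlgEquiv n k A = A.submatrix (blockEquiv n k) (blockEquiv n k) := rfl

theorem blockAlgEquiv_mono {A B : Matrix (Fin n → Fin k → Fin 2) (Fin n → Fin k → Fin 2) ℂ}
    (h : A ≤ B) : blockAlgEquiv n k A ≤ blockAlgEquiv n k B := by
  rw [Matrix.le_iff] at h ⊢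
  rw [← map_sub]
  exact h.submatrix _

theorem blockAlgEquiv_site_site (b : Fin n) (i : Fin k) (A : Matrix (Fin 2) (Fin 2) ℂ) :
    blockAlgEquiv n k (site b (site i A)) = site (finProdFinEquiv (b, i)) A :=
  (site_finProdFinEquiv b i A).symm

theorem blockAlgEquiv_chainHamiltonian (a : ℝ) (d : ℕ) (b : Fin n) :
    blockAlgEquiv n (d * 2 + 1) (site b (chainHamiltonian a d)) =
      ∑ i : Fin (d * 2), onQubits ((a : ℂ) • termXX - termZZ)
        (finProdFinEquiv (b, i.castSucc)) (finProdFinEquiv (b, i.succ)) := by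
  rw [chainHamiltonian, site_sum, map_sum]
  refine Finset.sum_congr rfl fun i _ => ?_
  rw [onQubits_axx_sub_zz a, site_sub, site_smul, ← site_mul, ← site_mul, map_sub, map_smul,
    map_mul, map_mul]
  · simp only [blockAlgEquiv_site_site]
  · intro h
    have := congrArg Prod.snd (finProdFinEquiv.injective h)
    exact (Fin.castSucc_lt_succ (i := i)).ne this

/-- The encoding of each of `n` qubits in a block of `k` qubits. -/
def blockEncoding (n : ℕ) (φ : Matrix (Fin k → Fin 2) (Fin 2) ℂ) :
    Matrix (Fin (n * k) → Fin 2) (Fin n → Fin 2) ℂ :=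
  (piTensor fun _ : Fin n => φ).submatrix (blockEquiv n k) id

variable {φ : Matrix (Fin k → Fin 2) (Fin 2) ℂ}

theorem blockEncoding_conjTranspose_mul_self (hφ : φᴴ * φ = 1) :
    (blockEncoding n φ)ᴴ * blockEncoding n φ = 1 := by
  rw [blockEncoding, Matrix.conjTranspose_submatrix, Matrix.submatrix_mul_equiv,
    piTensor_isometry hφ, Matrix.submatrix_id_id]

theorem blockEncoding_mul_conjTranspose :
    blockEncoding n φ * (blockEncoding n φ)ᴴ =
      blockAlgEquiv n k ((piTensor fun _ : Fin n => φ) * (piTensor fun _ : Fin n => φ)ᴴ) := by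
  rw [blockEncoding, Matrix.conjTranspose_submatrix, blockAlgEquiv_apply]
  exact Matrix.submatrix_mul_equiv _ _ _ (Equiv.refl _) _

theorem blockAlgEquiv_mul_blockEncoding
    (A : Matrix (Fin n → Fin k → Fin 2) (Fin n → Fin k → Fin 2) ℂ) :
    blockAlgEquiv n k A * blockEncoding n φ =
      (A * piTensor fun _ : Fin n => φ).submatrix (blockEquiv n k) id := by
  rw [blockEncoding, blockAlgEquiv_apply, Matrix.submatrix_mul_equiv]

theorem blockEncoding_conj (A : Matrix (Fin n → Fin k → Fin 2) (Fin n → Fin k → Fin 2) ℂ) :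
    (blockEncoding n φ)ᴴ * blockAlgEquiv n k A * blockEncoding n φ =
      (piTensor fun _ : Fin n => φ)ᴴ * A * piTensor fun _ : Fin n => φ := by
  rw [Matrix.mul_assoc, blockAlgEquiv_mul_blockEncoding, blockEncoding,
    Matrix.conjTranspose_submatrix, Matrix.submatrix_mul_equiv, Matrix.submatrix_id_id,
    Matrix.mul_assoc]

theorem finProdFinEquiv_ne {b c : Fin n} (hbc : b ≠ c) (i j : Fin k) :
    finProdFinEquiv (b, i) ≠ finProdFinEquiv (c, j) := fun h =>
  hbc (congrArg Prod.fst (finProdFinEquiv.injective h))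

/-- The encoded interaction between two different blocks. -/
theorem blockEncoding_conj_onQubits (hφ : φᴴ * φ = 1) (a : ℝ) {b c : Fin n} (hbc : b ≠ c)
    {i j : Fin k} {x z x' z' : ℝ} (hxi : φᴴ * site i pauliX * φ = (x : ℂ) • pauliX)
    (hzi : φᴴ * site i pauliZ * φ = (z : ℂ) • pauliY)
    (hxj : φᴴ * site j pauliX * φ = (x' : ℂ) • pauliX)
    (hzj : φᴴ * site j pauliZ * φ = (z' : ℂ) • pauliY) :
    (blockEncoding n φ)ᴴ * onQubits ((a : ℂ) • termXX - termZZ)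
        (finProdFinEquiv (b, i)) (finProdFinEquiv (c, j)) * blockEncoding n φ =
      ((a * (x * x') : ℝ) : ℂ) • (site b pauliX * site c pauliX) -
        ((z * z' : ℝ) : ℂ) • (site b pauliY * site c pauliY) := by
  rw [onQubits_axx_sub_zz a (finProdFinEquiv_ne hbc i j)]
  simp only [← blockAlgEquiv_site_site, ← map_mul, ← map_smul, ← map_sub]
  rw [blockEncoding_conj, Matrix.mul_sub, Matrix.sub_mul, Matrix.mul_smul, Matrix.smul_mul,
    piTensor_conj_site_mul_site hφ hbc, piTensor_conj_site_mul_site hφ hbc, hxi, hzi, hxj, hzj]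
  simp only [site_smul, Matrix.smul_mul, Matrix.mul_smul, smul_smul]
  push_cast
  congr 2 <;> ring

/-- Chains of strength Δ, shifted to ground energy zero, form H₀, and the gadget interactions form
V₁. The gap of H₀ is at least 2Δ(a - 1), V₁ has norm at most v, and its compression misses the
target by at most ρ² per unit of weight, hence by p²ρ² in total. -/
theorem exists_simulation {a x z t t' ρ x₀ t₀ E : ℝ} {d : ℕ}
    {φ : Matrix (Fin (d * 2 + 1) → Fin 2) (Fin 2) ℂ} (ha : 1 < a) (hd : 0 < d)
    (hφ : φᴴ * φ = 1) (hEφ : chainHamiltonian a d * φ = (E : ℂ) • φ)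
    (hgap : ((2 * (a - 1) : ℝ) : ℂ) • (1 - φ * φᴴ) ≤ chainHamiltonian a d - (E : ℂ) • 1)
    (hX0 : φᴴ * site (0 : Fin (d * 2 + 1)) pauliX * φ = (x : ℂ) • pauliX)
    (hZ0 : φᴴ * site (0 : Fin (d * 2 + 1)) pauliZ * φ = (z : ℂ) • pauliY)
    (hX1 : φᴴ * site (⟨1, by omega⟩ : Fin (d * 2 + 1)) pauliX * φ = ((x * t : ℝ) : ℂ) • pauliX)
    (hZ1 : φᴴ * site (⟨1, by omega⟩ : Fin (d * 2 + 1)) pauliZ * φ = ((z * t' : ℝ) : ℂ) • pauliY)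
    (hρ : 0 < ρ) (hρ1 : ρ ≤ 1) (hx₀ : 0 < x₀) (ht₀ : 0 < t₀) (hx : x₀ ≤ x ^ 2)
    (hz : z ^ 2 = x ^ 2 * ρ ^ 2) (ht : t ≤ -t₀) (ht' : 0 ≤ t')
    {n : ℕ} (H : PlusHamiltonian {termXX, -termYY} n) {p C v δ Δ : ℝ} (hp : 0 ≤ p)
    (hm : (H.numTerms : ℝ) ≤ p) (hw : ∀ l, H.weight l ≤ p)
    (hC : (x₀⁻¹ + (x₀ * t₀)⁻¹) * (ρ ^ 2)⁻¹ ≤ C) (hv : 2 * p ^ 2 * C * (a + 1) ≤ v)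
    (hδ0 : 0 ≤ δ) (hδ1 : δ < 1) (hΔ : 0 < Δ) (hδ : 2 * v ≤ Δ * (2 * (a - 1)) * δ ^ 2) :
    ∃ (H' : PlusHamiltonian {(a : ℂ) • termXX - termZZ} (n * (d * 2 + 1))) (c : ℝ)
      (F : QubitSpace n →ₗᵢ[ℂ] QubitSpace (n * (d * 2 + 1))),
      H'.numTerms = n * (d * 2) + H.numTerms * 2 ∧ (∀ l, H'.weight l ≤ max Δ (p * C)) ∧
      |c| ≤ Δ * (n * ((d * 2) * (a + 1))) ∧
      Simulates (H'.toOperator + (c : ℂ) • ContinuousLinearMap.id ℂ (QubitSpace _)) F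
        H.toOperator (2 * δ) (p ^ 2 * ρ ^ 2 + 4 * v * δ) := by
  choose s ω hω0 hωC hωn using fun l => exists_gadget_weights ha hρ hρ1 hx₀ ht₀ hx hz ht ht'
    (H.term_mem l)
  have ha0 : 0 ≤ a := by linarith
  have hC0 : 0 ≤ C := le_trans (by positivity) hC
  have hg : 0 < 2 * (a - 1) := by linarith
  set T : TwoQubitOp := (a : ℂ) • termXX - termZZ with hT
  let pos : Bool → Fin (d * 2 + 1) := fun r => if r then ⟨1, by omega⟩ else 0
  have hXpos : ∀ r, φᴴ * site (pos r) pauliX * φ = ((x * if r then t else 1 : ℝ) : ℂ) • pauliX := by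
    rintro (_ | _)
    · simpa [pos] using hX0
    · exact hX1
  have hZpos : ∀ r, φᴴ * site (pos r) pauliZ * φ = ((z * if r then t' else 1 : ℝ) : ℂ) • pauliY := by
    rintro (_ | _)
    · simpa [pos] using hZ0
    · exact hZ1
  let κ := (Fin n × Fin (d * 2)) ⊕ (Fin H.numTerms × Bool)
  let i₁ : κ → Fin (n * (d * 2 + 1)) := Sum.elim
    (fun r => finProdFinEquiv (r.1, r.2.castSucc)) (fun r => finProdFinEquiv (H.fst r.1, 0))
  let i₂ : κ → Fin (n * (d * 2 + 1)) := Sum.elim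
    (fun r => finProdFinEquiv (r.1, r.2.succ))
    (fun r => finProdFinEquiv (H.snd r.1, pos (s r.1 r.2)))
  let w : κ → ℝ := Sum.elim (fun _ => Δ) (fun r => H.weight r.1 * ω r.1 r.2)
  have hne : ∀ l, i₁ l ≠ i₂ l := by
    rintro (r | r)
    · intro h
      have := congrArg Prod.snd (finProdFinEquiv.injective h)
      exact (Fin.castSucc_lt_succ (i := r.2)).ne this
    · exact finProdFinEquiv_ne (H.fst_ne_snd r.1) _ _
  have hwpos : ∀ l, 0 < w l := by
    rintro (r | r)
    · exact hΔ
    · exact mul_pos (H.weight_pos _) (hω0 _ _)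
  have hwle : ∀ l (r : Bool), H.weight l * ω l r ≤ p * C := fun l r =>
    mul_le_mul (hw l) ((hωC l r).trans hC) (hω0 l r).le hp
  set M := blockEncoding n φ with hM
  have hMM : Mᴴ * M = 1 := blockEncoding_conjTranspose_mul_self hφ
  set K := chainHamiltonian a d - (E : ℂ) • 1 with hK
  set H₀ := (Δ : ℂ) • blockAlgEquiv n (d * 2 + 1) (∑ b, site b K) with hH₀
  set V₁ : Matrix (Fin (n * (d * 2 + 1)) → Fin 2) (Fin (n * (d * 2 + 1)) → Fin 2) ℂ :=
    ∑ l, ∑ r : Bool, ((H.weight l * ω l r : ℝ) : ℂ) • onQubits T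
      (finProdFinEquiv (H.fst l, 0)) (finProdFinEquiv (H.snd l, pos (s l r))) with hV₁
  have hgapH : ((Δ * (2 * (a - 1)) : ℝ) : ℂ) • (1 - M * Mᴴ) ≤ H₀ := by
    have h1 := blockAlgEquiv_mono (sum_site_gap (ι := Fin n) hφ hg.le hgap)
    rw [map_smul, map_sub, map_one, ← blockEncoding_mul_conjTranspose] at h1
    rw [Complex.ofReal_mul, mul_smul, hH₀, ← sub_nonneg, ← smul_sub]
    exact smul_nonneg_matrix hΔ.le (sub_nonneg.mpr h1)
  have hproj : 0 ≤ 1 - M * Mᴴ := by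
    apply nonneg_of_projection
    · simp
    · have : M * Mᴴ * (M * Mᴴ) = M * Mᴴ := by
        rw [Matrix.mul_assoc, ← Matrix.mul_assoc Mᴴ, hMM, Matrix.one_mul]
      simp [mul_sub, sub_mul, this]
  have hH₀h : H₀ᴴ = H₀ :=
    (Matrix.nonneg_iff_posSemidef.mp
      ((smul_nonneg_matrix (mul_pos hΔ hg).le hproj).trans hgapH)).isHermitian
  have hV₁h : V₁ᴴ = V₁ := by
    rw [hV₁, Matrix.conjTranspose_sum]
    refine Finset.sum_congr rfl fun l _ => ?_
    rw [Matrix.conjTranspose_sum]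
    refine Finset.sum_congr rfl fun r _ => ?_
    rw [Matrix.conjTranspose_smul,
      onQubits_axx_sub_zz_conjTranspose a (finProdFinEquiv_ne (H.fst_ne_snd l) _ _)]
    congr 1
    exact Complex.conj_ofReal _
  have hKφ : K * φ = (0 : ℂ) • φ := by
    rw [hK, Matrix.sub_mul, hEφ, Matrix.smul_mul, Matrix.one_mul, sub_self, zero_smul]
  have hH₀M : H₀ * M = 0 := by
    rw [hH₀, Matrix.smul_mul, hM, blockAlgEquiv_mul_blockEncoding, Matrix.sum_mul]
    simp only [site_mul_piTensor hKφ, zero_smul, Finset.sum_const_zero]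
    exact smul_zero _
  have hV₁n : ‖V₁‖ ≤ v := by
    refine le_trans ?_ hv
    calc ‖V₁‖ ≤ ∑ l, ‖∑ r : Bool, ((H.weight l * ω l r : ℝ) : ℂ) • onQubits T
          (finProdFinEquiv (H.fst l, 0)) (finProdFinEquiv (H.snd l, pos (s l r)))‖ :=
            norm_sum_le _ _
      _ ≤ ∑ l : Fin H.numTerms, 2 * (p * C * (a + 1)) := by
        refine Finset.sum_le_sum fun l _ => ?_
        refine (norm_sum_le _ _).trans ?_
        refine (Finset.sum_le_sum (g := fun _ => p * C * (a + 1)) fun r _ => ?_).trans ?_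
        · rw [norm_smul, Complex.norm_real, Real.norm_eq_abs,
            abs_of_nonneg (mul_pos (H.weight_pos _) (hω0 _ _)).le, hT,
            onQubits_axx_sub_zz a (finProdFinEquiv_ne (H.fst_ne_snd l) _ _)]
          exact mul_le_mul (hwle l r) (norm_axx_sub_zz_le ha0 _ _) (norm_nonneg _) (by positivity)
        · simp
      _ = H.numTerms * (2 * (p * C * (a + 1))) := by simp
      _ ≤ p * (2 * (p * C * (a + 1))) := by gcongr
      _ = 2 * p ^ 2 * C * (a + 1) := by ring
  have herr : ‖H.toMatrix - Mᴴ * V₁ * M‖ ≤ p ^ 2 * ρ ^ 2 := by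
    have h1 : H.toMatrix - Mᴴ * V₁ * M = ∑ l, (H.weight l : ℂ) •
        (onQubits (H.term l) (H.fst l) (H.snd l) - ∑ r, (ω l r : ℂ) •
          (((a * (x * (x * if s l r then t else 1)) : ℝ) : ℂ) •
              (site (H.fst l) pauliX * site (H.snd l) pauliX) -
            ((z * (z * if s l r then t' else 1) : ℝ) : ℂ) •
              (site (H.fst l) pauliY * site (H.snd l) pauliY))) := by
      rw [PlusHamiltonian.toMatrix, hV₁, Matrix.mul_sum, Matrix.sum_mul, ← Finset.sum_sub_distrib]
      refine Finset.sum_congr rfl fun l _ => ?_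
      rw [smul_sub, Matrix.mul_sum, Matrix.sum_mul, Finset.smul_sum]
      congr 1
      refine Finset.sum_congr rfl fun r _ => ?_
      rw [Matrix.mul_smul, Matrix.smul_mul, hM, hT, blockEncoding_conj_onQubits hφ a
        (H.fst_ne_snd l) hX0 hZ0 (hXpos (s l r)) (hZpos (s l r)), Complex.ofReal_mul, mul_smul]
    rw [h1]
    calc _ ≤ ∑ l : Fin H.numTerms, p * ρ ^ 2 := by
          refine (norm_sum_le _ _).trans (Finset.sum_le_sum fun l _ => ?_)
          rw [norm_smul, Complex.norm_real, Real.norm_eq_abs, abs_of_pos (H.weight_pos l)]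
          exact mul_le_mul (hw l) (hωn l n _ _ (H.fst_ne_snd l)) (norm_nonneg _) hp
      _ = H.numTerms * (p * ρ ^ 2) := by simp
      _ ≤ p * (p * ρ ^ 2) := by gcongr
      _ = p ^ 2 * ρ ^ 2 := by ring
  -- The shift moves the joint ground energy n Δ E of the blocks to zero.
  refine ⟨PlusHamiltonian.ofFintype (Set.mem_singleton _) i₁ i₂ hne w hwpos, -(Δ * (n * E)),
    matrixIsometry M hMM, ?_, ?_, ?_, ?_⟩
  · change Fintype.card κ = _
    simp [κ]
  · intro l
    change w _ ≤ _
    rcases (Fintype.equivFin κ).symm l with r | r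
    · exact le_max_left _ _
    · exact (hwle _ _).trans (le_max_right _ _)
  · rw [abs_neg, abs_mul, abs_mul, abs_of_pos hΔ, abs_of_nonneg (Nat.cast_nonneg n : (0 : ℝ) ≤ n)]
    gcongr
    exact (abs_eigenvalue_le hφ hEφ).trans (norm_chainHamiltonian_le ha0 d)
  · have h1 : (PlusHamiltonian.ofFintype (Set.mem_singleton T) i₁ i₂ hne w hwpos).toMatrix +
        ((-(Δ * (n * E)) : ℝ) : ℂ) • 1 = H₀ + V₁ := by
      rw [PlusHamiltonian.toMatrix_ofFintype, Fintype.sum_sum_type, Fintype.sum_prod_type,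
        Fintype.sum_prod_type, hH₀, hV₁, hK]
      simp only [w, i₁, i₂, Sum.elim_inl, Sum.elim_inr, ← Finset.smul_sum, hT,
        ← blockAlgEquiv_chainHamiltonian, site_sub, site_smul, site_one, Finset.sum_sub_distrib,
        map_sub, map_sum, map_smul, map_nsmul, map_one, Finset.sum_const, Finset.card_univ,
        Fintype.card_fin]
      rw [← Nat.cast_smul_eq_nsmul ℂ]
      push_cast
      module
    have h2 : (PlusHamiltonian.ofFintype (Set.mem_singleton T) i₁ i₂ hne w hwpos).toOperator +
        ((-(Δ * (n * E)) : ℝ) : ℂ) • ContinuousLinearMap.id ℂ (QubitSpace (n * (d * 2 + 1))) =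
        Matrix.toEuclideanCLM (𝕜 := ℂ) (H₀ + V₁) := by
      rw [← h1, map_add, map_smul, map_one]
      rfl
    rw [h2]
    exact simulates_of_matrix_gap hMM hH₀h hV₁h hH₀M (mul_pos hΔ hg) hgapH hV₁n hδ0 hδ1 hδ herr

end Assembly

/-! ### Polynomial choice of the parameters -/

section Parameters

theorem Simulates.mono {V W : Type*}
    [NormedAddCommGroup V] [InnerProductSpace ℂ V] [CompleteSpace V] [FiniteDimensional ℂ V]
    [NormedAddCommGroup W] [InnerProductSpace ℂ W] [CompleteSpace W] [FiniteDimensional ℂ W]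
    {Hsim : W →L[ℂ] W} {E : V →ₗᵢ[ℂ] W} {Ht : V →L[ℂ] V} {η η' ε ε' : ℝ}
    (h : Simulates Hsim E Ht η ε) (hη : η ≤ η') (hε : ε ≤ ε') : Simulates Hsim E Ht η' ε' := by
  obtain ⟨E', h1, h2, h3⟩ := h
  exact ⟨E', h1, h2.trans hε, h3.trans hη⟩

/-- The choice of the perturbation parameters: total error and gap condition. -/
theorem perturbation_parameters {p Q k v ρ G a : ℝ} (hp : 0 ≤ p) (hk : 1 ≤ k) (hv : 0 ≤ v)
    (ha : 1 < a) (hG : a / (a - 1) ≤ G) (hQ : Q = 2 * (p + 1) * k) (hρ0 : 0 ≤ ρ)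
    (hρ : ρ ≤ Q⁻¹) :
    2 * (1 / (8 * (v + 1) * k)) ≤ 1 / k ∧
    p ^ 2 * ρ ^ 2 + 4 * v * (1 / (8 * (v + 1) * k)) ≤ 1 / k ∧
    2 * v ≤ 64 * (v + 1) ^ 3 * k ^ 2 * G * (2 * (a - 1)) * (1 / (8 * (v + 1) * k)) ^ 2 := by
  have hk0 : 0 < k := by linarith
  have hv1 : 0 < v + 1 := by linarith
  have hp1 : 0 < p + 1 := by linarith
  have ha1 : 0 < a - 1 := by linarith
  have hGa : 1 ≤ G * (a - 1) := by
    rw [div_le_iff₀ ha1] at hG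
    linarith
  refine ⟨?_, ?_, ?_⟩
  · rw [mul_one_div, div_le_div_iff₀ (by positivity) hk0]
    nlinarith
  -- The error budget 1/k is split: a quarter for the encoding error, half for perturbation.
  · have h1 : p ^ 2 * ρ ^ 2 ≤ 1 / (4 * k) := by
      have h2 : p * ρ ≤ 1 / (2 * k) := by
        calc p * ρ ≤ (p + 1) * Q⁻¹ := by gcongr; linarith
          _ = 1 / (2 * k) := by rw [hQ]; field_simp
      calc p ^ 2 * ρ ^ 2 = (p * ρ) ^ 2 := by ring
        _ ≤ (1 / (2 * k)) ^ 2 := by gcongr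
        _ ≤ 1 / (4 * k) := by
          rw [div_pow, one_pow]
          apply one_div_le_one_div_of_le (by positivity)
          nlinarith
    have h2 : 4 * v * (1 / (8 * (v + 1) * k)) ≤ 1 / (2 * k) := by
      rw [mul_one_div, div_le_div_iff₀ (by positivity) (by positivity)]
      nlinarith
    have h3 : 1 / (4 * k) + 1 / (2 * k) ≤ 1 / k := by
      have : 1 / (4 * k) + 1 / (2 * k) = 3 / 4 * (1 / k) := by
        field_simp
        norm_num
      rw [this]
      have : 0 < 1 / k := by positivity
      linarith
    linarith
  -- Two powers of v + 1 cancel those in δ², the third dominates v, and G(a - 1) ≥ 1 absorbs a small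
  -- gap.
  · have h1 : 64 * (v + 1) ^ 3 * k ^ 2 * G * (2 * (a - 1)) * (1 / (8 * (v + 1) * k)) ^ 2 =
        2 * (v + 1) * (G * (a - 1)) := by
      field_simp
      ring
    rw [h1]
    nlinarith

/-- An exponent `d` for which `a ^ d` lies between `Q` and `a * Q`. -/
theorem exists_exponent {a G : ℝ} (ha : 1 < a) (hG : a / (a - 1) ≤ G) {Q : ℝ} (hQ : 1 ≤ Q) :
    ∃ d : ℕ, 0 < d ∧ Q ≤ a ^ d ∧ a ^ d ≤ a * Q ∧ (d : ℝ) ≤ G * Q := by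
  obtain ⟨m, hm, hm'⟩ := exists_nat_pow_near hQ ha
  have h1 : a ^ (m + 1) ≤ a * Q := by
    rw [pow_succ']
    gcongr
  refine ⟨m + 1, m.succ_pos, hm'.le, h1, ?_⟩
  have ha1 : 0 < a - 1 := by linarith
  -- Bernoulli's inequality; the resulting bound on d is linear in Q rather than logarithmic, which
  -- suffices.
  have h2 := one_add_mul_sub_le_pow (a := a) (by linarith) (m + 1)
  have h3 : ((m + 1 : ℕ) : ℝ) ≤ a / (a - 1) * Q := by
    rw [div_mul_eq_mul_div, le_div_iff₀ ha1]
    linarith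
  exact h3.trans (by gcongr)

theorem canSimulate_axx_sub_zz (a : ℝ) (ha : 1 < a) :
    CanSimulate {(a : ℂ) • termXX - termZZ} {termXX, -termYY} := by
  intro p q
  have ha0 : 0 < a := by linarith
  have hai : a⁻¹ < 1 := inv_lt_one_of_one_lt₀ ha
  have hai0 : 0 < a⁻¹ := by positivity
  set x₀ : ℝ := 1 - a⁻¹ ^ 2 with hx₀
  have hx₀p : 0 < x₀ := by
    have : a⁻¹ ^ 2 < 1 := pow_lt_one₀ hai0.le hai two_ne_zero
    linarith
  set t₀ : ℝ := (a - 1) * x₀ / a with ht₀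
  have ht₀p : 0 < t₀ := div_pos (mul_pos (by linarith) hx₀p) ha0
  set A : ℝ := x₀⁻¹ + (x₀ * t₀)⁻¹ with hA
  have hAp : 0 < A := by positivity
  -- `B` absorbs every constant in the norm of the interactions: gadget weights are at most A a²Q²,
  -- with ρ⁻² ≤ a²Q², and each term has norm at most a + 1.
  obtain ⟨B, hB⟩ := exists_nat_ge (2 * A * a ^ 2 * (a + 1))
  obtain ⟨G, hG⟩ := exists_nat_ge (a / (a - 1))
  obtain ⟨A₁, hA₁⟩ := exists_nat_ge (a + 1)
  have hGp : (0 : ℝ) < G := (div_pos ha0 (by linarith)).trans_le hG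
  let R : Polynomial ℕ := 2 * (p + 1) * (q + 1)
  let v : Polynomial ℕ := (B : Polynomial ℕ) * p ^ 2 * R ^ 2
  let D : Polynomial ℕ := 64 * (v + 1) ^ 3 * (q + 1) ^ 2 * (G : Polynomial ℕ)
  let L : Polynomial ℕ := (G : Polynomial ℕ) * R * 2
  -- The summands bound, in turn, the number of qubits, the number of terms, the chain weights, the
  -- gadget weights and the energy shift.
  refine ⟨Polynomial.X * (L + 1) + (Polynomial.X * L + p * 2) + D + p * ((B : Polynomial ℕ) * R ^ 2) +
    D * (Polynomial.X * (L * (A₁ : Polynomial ℕ))), fun n H hH => ?_⟩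
  set u : ℕ := p.eval n with hu
  set k : ℕ := q.eval n + 1 with hk
  set Q : ℕ := 2 * (u + 1) * k with hQ
  set w : ℕ := B * u ^ 2 * Q ^ 2 with hw
  set Δ : ℕ := 64 * (w + 1) ^ 3 * k ^ 2 * G with hΔ
  have hR : R.eval n = Q := by simp [R, hQ, hk, hu]
  have hv : v.eval n = w := by simp [v, hw, hR, hu]
  have hD : D.eval n = Δ := by simp [D, hΔ, hv, hk]
  have hL : L.eval n = G * Q * 2 := by simp [L, hR]
  simp only [Polynomial.eval_add, Polynomial.eval_mul, Polynomial.eval_X, Polynomial.eval_pow,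
    Polynomial.eval_natCast, Polynomial.eval_one, Polynomial.eval_ofNat, hR, hD, hL, ← hu]
  clear_value R v D L Δ w Q k u
  have hk1 : (1 : ℝ) ≤ k := by simp [hk]
  have hQ1 : (1 : ℝ) ≤ Q := by
    have : 0 < Q := by simp [hQ, hk]
    exact_mod_cast this
  obtain ⟨d, hd, hQd, hdQ, hdG⟩ := exists_exponent ha hG hQ1
  obtain ⟨φ, E, x, z, t, t', hφ, hEφ, hgap, hX0, hZ0, hX1, hZ1, hx, hz, ht, ht'⟩ :=
    exists_chain_block ha hd
  have hρ : a⁻¹ ^ d ≤ (Q : ℝ)⁻¹ := by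
    rw [inv_pow]
    exact inv_anti₀ (by linarith) hQd
  have hρ1 : a⁻¹ ^ d ≤ 1 := pow_le_one₀ hai0.le hai.le
  have hC : A * ((a⁻¹ ^ d) ^ 2)⁻¹ ≤ A * (a ^ 2 * Q ^ 2) := by
    rw [inv_pow, inv_pow, inv_inv, ← mul_pow]
    gcongr
  have hpv : 2 * (u : ℝ) ^ 2 * (A * (a ^ 2 * Q ^ 2)) * (a + 1) ≤ (w : ℝ) := by
    rw [hw]
    push_cast
    calc _ = 2 * A * a ^ 2 * (a + 1) * (u : ℝ) ^ 2 * Q ^ 2 := by ring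
      _ ≤ _ := by gcongr
  obtain ⟨h1, h2, h3⟩ := perturbation_parameters (p := u) (Q := Q) (k := k) (v := w)
    (Nat.cast_nonneg _) hk1 (Nat.cast_nonneg _) ha hG (by rw [hQ]; push_cast; ring)
    (by positivity) hρ
  set δ : ℝ := 1 / (8 * ((w : ℝ) + 1) * k) with hδ
  have hΔr : (Δ : ℝ) = 64 * ((w : ℝ) + 1) ^ 3 * (k : ℝ) ^ 2 * G := by rw [hΔ]; push_cast; ring
  have hδ1 : δ < 1 := by
    rw [hδ, div_lt_one (by positivity)]
    have : (1 : ℝ) ≤ (w : ℝ) + 1 := le_add_of_nonneg_left (Nat.cast_nonneg _)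
    calc (1 : ℝ) < 8 * 1 * 1 := by norm_num
      _ ≤ 8 * ((w : ℝ) + 1) * k := by gcongr
  have hΔp : (0 : ℝ) < Δ := by rw [hΔr]; positivity
  obtain ⟨H', c, F, hterms, hweight, hc, hsim⟩ := exists_simulation ha hd hφ hEφ hgap hX0 hZ0 hX1 hZ1
    (by positivity) hρ1 hx₀p ht₀p hx hz ht ht' H (Nat.cast_nonneg u)
    (by exact_mod_cast hH.1) hH.2 hC hpv (by positivity) hδ1 hΔp (by rw [hΔr]; exact h3)
  have hdN : d ≤ G * Q := by exact_mod_cast hdG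
  have hd2 : d * 2 ≤ G * Q * 2 := by gcongr
  have hN : n * (d * 2 + 1) ≤ n * (G * Q * 2 + 1) := by gcongr
  have hm : n * (d * 2) + H.numTerms * 2 ≤ n * (G * Q * 2) + u * 2 := by
    have := hH.1
    gcongr
  have hW : max (Δ : ℝ) (u * (A * (a ^ 2 * Q ^ 2))) ≤
      ((Δ + u * (B * Q ^ 2) : ℕ) : ℝ) := by
    have h4 : A * (a ^ 2 * Q ^ 2) ≤ B * (Q : ℝ) ^ 2 := by
      rw [← mul_assoc]
      gcongr
      refine le_trans ?_ hB
      calc A * a ^ 2 ≤ A * a ^ 2 * (2 * (a + 1)) :=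
            le_mul_of_one_le_right (by positivity) (by linarith)
        _ = 2 * A * a ^ 2 * (a + 1) := by ring
    push_cast
    refine max_le (le_add_of_nonneg_right (by positivity)) ?_
    calc _ ≤ (u : ℝ) * (B * (Q : ℝ) ^ 2) := by gcongr
      _ ≤ _ := le_add_of_nonneg_left hΔp.le
  have hcP : |c| ≤ ((Δ * (n * (G * Q * 2 * A₁)) : ℕ) : ℝ) := by
    refine hc.trans ?_
    push_cast
    have h4 : (d : ℝ) * 2 ≤ G * Q * 2 := by linarith
    gcongr
  refine ⟨n * (d * 2 + 1), H', c, F, by omega, ⟨by rw [hterms]; omega, fun l => ?_⟩, ?_, ?_⟩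
  · refine (hweight l).trans (hW.trans ?_)
    norm_cast
    omega
  · refine hcP.trans ?_
    norm_cast
    omega
  · have hkq : ((k : ℕ) : ℝ) = ((q.eval n : ℕ) : ℝ) + 1 := by rw [hk]; push_cast; rfl
    rw [hkq] at h1 h2
    exact hsim.mono h1 h2

end Parameters

end QubitSim

end


theorem mainTheorem7 (a : ℝ) (ha : 1 < a) :
    QubitSim.CanSimulate
      {(a : ℂ) • QubitSim.termXX - QubitSim.termZZ}
      {QubitSim.termXX, -QubitSim.termYY} :=
  QubitSim.canSimulate_axx_sub_zz a ha
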